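/- Let $d\ge 1$, let $\mathbb T^d=\mathbb R^d/\mathbb Z^d$ be equipped with Lebesgue measure, and let $\mathbb E$ be $(0,\infty)$ or $[0,\infty)$. Let $\mathcal M_{ac}(\mathbb T^d)$ be the set of finite positive measures on $\mathbb T^d$ that are absolutely continuous with respect to Lebesgue measure; for an integrable $m\ge 0$, write $\mathbf m$ for the measure with density $m$. Let $h:\mathcal M_{ac}(\mathbb T^d)\to C(\mathbb T^d)$, let $g:\mathbb T^d\times\mathbb E\times\mathbb R\to\mathbb R$ be continuous, and let $H:\mathbb T^d\times\mathbb R^d\times\mathbb R^{d\times d}\times\mathbb E\times\mathbb R\to\mathbb R$, $(x,p,M,m,\theta)\mapsto H(x,p,M,m,\theta)$. Below, $H$, $D_pH$, $D_{M_{ij}}H$ inside an equation or integral are evaluated at $(x,Du(x),D^2u(x),m(x),h(\mathbf m)(x))$, similarly for $g,g_1,g_2$ at $(x,m(x),h(\mathbf m)(x))$; repeated indices are summed; densities $m$ in (g) and (H1) are those with values in $\mathbb E$ almost everywhere; and, except for the integrability of $g_2$, which is part of (g)(ii), integral conditions are imposed whenever the integrals in them exist and are finite. Assume: * **(h)** For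 every integer $\kappa>\frac d2+1$: $h(\mathbf m)\in W^{\kappa,2}(\mathbb T^d)$ for every nonnegative $m\in W^{\kappa,2}(\mathbb T^d)$, and $m\mapsto h(\mathbf m)$ is Fréchet differentiable, with respect to the $W^{\kappa,2}$ norms, on the cone of nonnegative elements of $W^{\kappa,2}(\mathbb T^d)$. * **(g)** There are functions $g_1,g_2:\mathbb T^d\times\mathbb E\times\mathbb R\to\mathbb R$ with $g=g_1+g_2$ such that, for all densities $m$ of measures in $\mathcal M_{ac}(\mathbb T^d)$: (i) $g_2(x,m(x),h(\mathbf m)(x))\ge 0$ for a.e. $x$; (ii) $g_2(\cdot,m,h(\mathbf m))$ is integrable and $\int_{\mathbb T^d} g_2\,dx\le c\,(1+\int_{\mathbb T^d} m\,dx)$, with a constant $c>0$ independent of $m$; (iii) for every $\delta>0$ there is $C_\delta>0$, independent of $m$, with $\max\{\int_{\mathbb T^d} g_1\,dx,\int_{\mathbb T^d} m\,dx\}\le\delta\int_{\mathbb T^d} m g_1\,dx+C_\delta$; (iv) $\int_{\mathbb T^d} m g_1\,dx\ge -R$ with a constant $R\ge 0$ independent of $m$. * **(H1)** There are constants $\gamma>1$,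 $0\le\tau<1$ and $C_1,C_2,C_3,C_4>0$ such that: (a) for all $x\in\mathbb T^d$, $p\in\mathbb R^d$, symmetric $M\in\mathbb R^{d\times d}$, $m\in\mathbb E$, $\theta\in\mathbb R$, $$-H+D_pH\cdot p+D_MH:M\ \ge\ \tfrac1{C_1}m^{-\tau}|p|^\gamma+C_2\,g(x,m,\theta)-C_1;$$ (b) for all densities $m$ of measures in $\mathcal M_{ac}(\mathbb T^d)$ and all $u\in W^{1,\gamma}(\mathbb T^d)$ whose weak second derivatives are integrable functions, $$-C_3\!\int_{\mathbb T^d}\! g\,dx+\tfrac1{C_1}\!\int_{\mathbb T^d}\!|Du|^\gamma m^{-\tau}dx-C_1\le\int_{\mathbb T^d}\! H\,dx\le -C_4\!\int_{\mathbb T^d}\! g\,dx+C_1\Big(1+\int_{\mathbb T^d}\!|Du|^\gamma m^{-\tau}dx\Big).$$ * **(H2)** $H$ is of class $C^\infty$ on $\mathbb T^d\times\mathbb R^d\times\mathbb R^{d\times d}\times\mathbb E\times\mathbb R$. * **(H3)** The operator $$A\begin{bmatrix}m\\u\end{bmatrix}=\begin{bmatrix}-u-H\\ m-\operatorname{div}(mD_pH)+(mD_{M_{ij}}H)_{x_ix_j}-1\end{bmatrix}$$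 is monotone for the $L^2(\mathbb T^d)\times L^2(\mathbb T^d)$ inner product on $C^\infty(\mathbb T^d;\mathbb E)\times C^\infty(\mathbb T^d)$. Let $p\in\mathbb N$ with $2p-4>\frac d2+1$, let $q>d$, let $\epsilon_1,\epsilon_2\in(0,1)$, and let $\beta_{\epsilon_1}:(0,\infty)\to(-\infty,0]$ be a non-decreasing $C^\infty$ function with $\beta_{\epsilon_1}(s)=0$ for $s\ge\epsilon_1$ and $\beta_{\epsilon_1}(s)=-s^{-q}$ for $0<s\le\epsilon_1/2$. Then there exist $m,u\in C^\infty(\mathbb T^d)$ with $\inf_{\mathbb T^d}m>0$ such that, at every point of $\mathbb T^d$, $$\begin{cases}-u-H+\epsilon_1(m+\Delta^{2p}m)+\epsilon_2(m-\Delta m)+\beta_{\epsilon_1}(m)=0,\\ m-\operatorname{div}(mD_pH)+(mD_{M_{ij}}H)_{x_ix_j}-1+\epsilon_1(u+\Delta^{2p}u)+\epsilon_2(u-\Delta u)=0.\end{cases}$$ -/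

import Mathlib

open MeasureTheory
open scoped ContDiff

noncomputable section

namespace RegMFG

/-! ### Calculus on the flat torus -/

/-- The torus `ℝ^d / ℤ^d`, with its Lebesgue measure `volume` (of total mass one). -/
abbrev Torus (d : ℕ) : Type := UnitAddTorus (Fin d)

/-- The values of a gradient. -/
abbrev Vec (d : ℕ) : Type := EuclideanSpace ℝ (Fin d)

/-- Real `d × d` matrices, in the form of functions so that they are a normed space. -/
abbrev Mat (d : ℕ) : Type := Fin d → Fin d → ℝ

/-- The covering map `ℝ^d → ℝ^d / ℤ^d`. -/
def proj {d : ℕ} (y : Fin d → ℝ) : Torus d := fun i => (y i : UnitAddCircle)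

/-- `f ∈ C^∞(𝕋^d)`: the periodic lift of `f` to `ℝ^d` is of class `C^∞`. -/
def IsSmooth {d : ℕ} (f : Torus d → ℝ) : Prop :=
  ContDiff ℝ ∞ (fun y : Fin d → ℝ => f (proj y))

/-- The classical partial derivative `∂f/∂x_i` on the torus. -/
def pd {d : ℕ} (i : Fin d) (f : Torus d → ℝ) : Torus d → ℝ :=
  fun x => deriv (fun t : ℝ => f (x + Pi.single i (t : UnitAddCircle))) 0

/-- The gradient `Du`. -/
def grad {d : ℕ} (u : Torus d → ℝ) (x : Torus d) : Vec d :=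
  WithLp.toLp 2 (fun i => pd i u x)

/-- The Hessian `D²u`. -/
def hess {d : ℕ} (u : Torus d → ℝ) (x : Torus d) : Mat d :=
  fun i j => pd i (pd j u) x

/-- The Laplacian. -/
def lap {d : ℕ} (f : Torus d → ℝ) : Torus d → ℝ :=
  fun x => ∑ i, pd i (pd i f) x

lemma proj_add_single {d : ℕ} (y : Fin d → ℝ) (i : Fin d) (t : ℝ) :
    proj y + Pi.single i (t : UnitAddCircle) = proj (y + t • Pi.single i (1 : ℝ)) := by
  funext j
  by_cases hj : j = i
  · subst hj
    simp [proj]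
  · simp [proj, hj]

lemma continuous_proj {d : ℕ} : Continuous (proj (d := d)) :=
  continuous_pi fun i => (AddCircle.continuous_mk' (1 : ℝ)).comp (continuous_apply i)

lemma isQuotientMap_proj {d : ℕ} : Topology.IsQuotientMap (proj (d := d)) := by
  refine IsOpenMap.isQuotientMap ?_ continuous_proj ?_
  · refine IsOpenMap.piMap (f := fun _ : Fin d => ((↑) : ℝ → UnitAddCircle)) (fun i => ?_) ?_
    · exact QuotientAddGroup.isOpenMap_coe
    · exact Filter.Eventually.of_forall fun i => QuotientAddGroup.mk_surjective
  · intro x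
    choose y hy using fun i => QuotientAddGroup.mk_surjective (x i)
    exact ⟨y, funext hy⟩

lemma IsSmooth.continuous {d : ℕ} {f : Torus d → ℝ} (hf : IsSmooth f) : Continuous f :=
  isQuotientMap_proj.continuous_iff.2 (ContDiff.continuous hf)

lemma IsSmooth.pd {d : ℕ} {f : Torus d → ℝ} (hf : IsSmooth f) (i : Fin d) :
    IsSmooth (pd i f) := by
  have h1 : (fun y : Fin d → ℝ => RegMFG.pd i f (proj y)) =
      fun y => fderiv ℝ (fun y : Fin d → ℝ => f (proj y)) y (Pi.single i 1) := by
    funext y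
    have hd : DifferentiableAt ℝ (fun y : Fin d → ℝ => f (proj y)) y :=
      (ContDiff.differentiable hf (by simp)) y
    rw [← hd.lineDeriv_eq_fderiv]
    simp only [RegMFG.pd, lineDeriv, proj_add_single]
  unfold IsSmooth at hf ⊢
  rw [h1]
  exact (hf.fderiv_right (m := ∞) (by simp)).clm_apply contDiff_const

/-! ### Sobolev spaces on the torus -/

/-- `g` is the weak partial derivative of `f` in the direction `i`. -/
def IsWeakDeriv {d : ℕ} (i : Fin d) (f g : Torus d → ℝ) : Prop :=
  ∀ φ : Torus d → ℝ, IsSmooth φ → ∫ x, f x * pd i φ x = -∫ x, g x * φ x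

/-- Multi-indices `α ∈ ℕ^d` with `|α| ≤ κ`. -/
abbrev MultiIdx (d κ : ℕ) : Type := {α : Fin d → Fin (κ + 1) // ∑ i, (α i : ℕ) ≤ κ}

/-- The length `|α|`. -/
def MultiIdx.len {d κ : ℕ} (α : MultiIdx d κ) : ℕ := ∑ i, (α.1 i : ℕ)

/-- The multi-index zero. -/
def MultiIdx.zero (d κ : ℕ) : MultiIdx d κ := ⟨fun _ => 0, by simp⟩

/-- The classical derivative `∂^α f`. -/
def pdMulti {d κ : ℕ} (α : MultiIdx d κ) (f : Torus d → ℝ) : Torus d → ℝ :=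
  (List.finRange d).foldr (fun i ψ => (pd i)^[(α.1 i : ℕ)] ψ) f

lemma IsSmooth.pdMulti {d κ : ℕ} {f : Torus d → ℝ} (hf : IsSmooth f) (α : MultiIdx d κ) :
    IsSmooth (pdMulti α f) := by
  unfold RegMFG.pdMulti
  induction List.finRange d with
  | nil => exact hf
  | cons i l ih =>
    rw [List.foldr_cons]
    generalize (α.1 i : ℕ) = n
    induction n with
    | zero => exact ih
    | succ n ihn =>
      rw [Function.iterate_succ_apply']
      exact ihn.pd i

lemma IsSmooth.memLp {d : ℕ} {f : Torus d → ℝ} (hf : IsSmooth f) (q : ENNReal) :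
    MemLp f q (volume : Measure (Torus d)) := by
  obtain ⟨C, hC⟩ := isCompact_univ.exists_bound_of_continuousOn hf.continuous.continuousOn
  exact MemLp.of_bound hf.continuous.aestronglyMeasurable C
    (Filter.Eventually.of_forall fun x => hC x (Set.mem_univ x))

/-- The Sobolev space `W^{κ,2}(𝕋^d)`: the families `(f_α)_{|α| ≤ κ}` in `L²(𝕋^d)` such that `f_α`
is the weak derivative `D^α f` of `f = f_0`, with the norm `(∑_{|α| ≤ κ} ‖D^α f‖²)^{1/2}`. -/
def Sobolev (d κ : ℕ) :
    Submodule ℝ (PiLp 2 (fun _ : MultiIdx d κ => Lp ℝ 2 (volume : Measure (Torus d)))) where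
  carrier := {F | ∀ (α : MultiIdx d κ) (φ : Torus d → ℝ), IsSmooth φ →
    ∫ x, F (MultiIdx.zero d κ) x * pdMulti α φ x = (-1) ^ α.len * ∫ x, F α x * φ x}
  zero_mem' := by
    intro α φ hφ
    simp
  add_mem' := by
    intro F G hF hG α φ hφ
    have hadd : ∀ (a b : Lp ℝ 2 (volume : Measure (Torus d))) (ψ : Torus d → ℝ), IsSmooth ψ →
        ∫ x, (a + b) x * ψ x = (∫ x, a x * ψ x) + ∫ x, b x * ψ x := by
      intro a b ψ hψ
      have ha : Integrable (fun x => a x * ψ x) volume :=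
        (Lp.memLp a).integrable_mul (hψ.memLp 2)
      have hb : Integrable (fun x => b x * ψ x) volume :=
        (Lp.memLp b).integrable_mul (hψ.memLp 2)
      rw [← integral_add ha hb]
      refine integral_congr_ae ?_
      filter_upwards [Lp.coeFn_add a b] with x hx
      rw [hx, Pi.add_apply, add_mul]
    rw [PiLp.add_apply, PiLp.add_apply, hadd _ _ _ (hφ.pdMulti α), hadd _ _ _ hφ, hF α φ hφ,
      hG α φ hφ, mul_add]
  smul_mem' := by
    intro c F hF α φ hφ
    have hsmul : ∀ (a : Lp ℝ 2 (volume : Measure (Torus d))) (ψ : Torus d → ℝ),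
        ∫ x, (c • a) x * ψ x = c * ∫ x, a x * ψ x := by
      intro a ψ
      rw [← integral_const_mul]
      refine integral_congr_ae ?_
      filter_upwards [Lp.coeFn_smul c a] with x hx
      simp [hx, mul_assoc]
    rw [PiLp.smul_apply, PiLp.smul_apply, hsmul, hsmul, hF α φ hφ]
    ring

/-- The function (a representative of its class) underlying an element of `W^{κ,2}(𝕋^d)`. -/
def sobFn {d κ : ℕ} (f : Sobolev d κ) : Torus d → ℝ := f.1 (MultiIdx.zero d κ)

/-- `u ∈ W^{1,γ}(𝕋^d)` with weak gradient `P`, and the weak second derivatives of `u` are the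
functions `Q i j = ∂_i ∂_j u`. -/
structure HasWeakDerivs {d : ℕ} (γ : ℝ) (u : Torus d → ℝ) (P : Torus d → Vec d)
    (Q : Torus d → Mat d) : Prop where
  memLp : MemLp u (ENNReal.ofReal γ) volume
  memLp_grad : ∀ i, MemLp (fun x => P x i) (ENNReal.ofReal γ) volume
  grad_eq : ∀ i, IsWeakDeriv i u (fun x => P x i)
  integrable_hess : ∀ i j, Integrable (fun x => Q x i j) volume
  hess_eq : ∀ i j, IsWeakDeriv i (fun x => P x j) (fun x => Q x i j)

/-! ### Absolutely continuous measures and the nonlocal operator -/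

/-- `M_ac(𝕋^d)`: the finite positive measures that are absolutely continuous with respect to the
Lebesgue measure. -/
def Mac (d : ℕ) : Type :=
  {ν : Measure (Torus d) // IsFiniteMeasure ν ∧ ν ≪ (volume : Measure (Torus d))}

open Classical in
/-- The measure with density `m`, for an integrable `m ≥ 0`. (The value for other `m` is
irrelevant: it is never used.) -/
def bold {d : ℕ} (m : Torus d → ℝ) : Mac d :=
  if hm : Integrable m volume then
    ⟨volume.withDensity (fun x => ENNReal.ofReal (m x)),
      isFiniteMeasure_withDensity_ofReal hm.2, withDensity_absolutelyContinuous _ _⟩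
  else ⟨0, inferInstance, Measure.AbsolutelyContinuous.zero _⟩

/-- `m` is the density of a measure in `M_ac(𝕋^d)` with values in `E` (almost everywhere), where
`E` is `(0,∞)` or `[0,∞)`. -/
structure IsDensity {d : ℕ} (E : Set ℝ) (m : Torus d → ℝ) : Prop where
  integrable : Integrable m volume
  mem : ∀ᵐ x ∂(volume : Measure (Torus d)), m x ∈ E

/-- Assumption (h): for every `κ > d/2 + 1`, the map `m ↦ h(𝐦)` sends `W^{κ,2}(𝕋^d)` to itself and
is Fréchet differentiable there. As `h` acts on positive measures, `m` ranges over the cone of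
the nonnegative functions of `W^{κ,2}(𝕋^d)`. -/
def AssumptionH {d : ℕ} (h : Mac d → C(Torus d, ℝ)) : Prop :=
  ∀ κ : ℕ, (d : ℝ) / 2 + 1 < κ →
    ∃ F : Sobolev d κ → Sobolev d κ,
      (∀ m : Sobolev d κ, 0 ≤ᵐ[volume] sobFn m → sobFn (F m) =ᵐ[volume] h (bold (sobFn m))) ∧
      DifferentiableOn ℝ F {m : Sobolev d κ | 0 ≤ᵐ[volume] sobFn m}

/-- Assumption (g). Integral conditions are imposed on those densities for which the integrals
exist; for the nonnegative function `g₂` integrability is part of the condition. -/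
def AssumptionG {d : ℕ} (E : Set ℝ) (h : Mac d → C(Torus d, ℝ))
    (g : Torus d → ℝ → ℝ → ℝ) : Prop :=
  ∃ g₁ g₂ : Torus d → ℝ → ℝ → ℝ,
    (∀ x, ∀ m ∈ E, ∀ θ, g x m θ = g₁ x m θ + g₂ x m θ) ∧
    (∀ m : Torus d → ℝ, IsDensity E m →
      ∀ᵐ x ∂(volume : Measure (Torus d)), 0 ≤ g₂ x (m x) (h (bold m) x)) ∧
    (∃ c : ℝ, 0 < c ∧ ∀ m : Torus d → ℝ, IsDensity E m →
      Integrable (fun x => g₂ x (m x) (h (bold m) x)) volume ∧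
      ∫ x, g₂ x (m x) (h (bold m) x) ≤ c * (1 + ∫ x, m x)) ∧
    (∀ δ : ℝ, 0 < δ → ∃ Cδ : ℝ, 0 < Cδ ∧ ∀ m : Torus d → ℝ, IsDensity E m →
      Integrable (fun x => g₁ x (m x) (h (bold m) x)) volume →
      Integrable (fun x => m x * g₁ x (m x) (h (bold m) x)) volume →
      max (∫ x, g₁ x (m x) (h (bold m) x)) (∫ x, m x) ≤
        δ * (∫ x, m x * g₁ x (m x) (h (bold m) x)) + Cδ) ∧
    (∃ R : ℝ, 0 ≤ R ∧ ∀ m : Torus d → ℝ, IsDensity E m →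
      Integrable (fun x => m x * g₁ x (m x) (h (bold m) x)) volume →
      -R ≤ ∫ x, m x * g₁ x (m x) (h (bold m) x))

/-! ### The Hamiltonian -/

/-- Hamiltonians `H(x, p, M, m, θ)`; only the values with `m ∈ E` matter. -/
abbrev Hamiltonian (d : ℕ) : Type := Torus d → Vec d → Mat d → ℝ → ℝ → ℝ

/-- The partial derivative `∂H/∂p_i`. -/
def DpH {d : ℕ} (H : Hamiltonian d) (i : Fin d) (x : Torus d) (p : Vec d) (M : Mat d)
    (m θ : ℝ) : ℝ :=
  fderiv ℝ (fun p' : Vec d => H x p' M m θ) p (EuclideanSpace.single i 1)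

/-- The partial derivative `∂H/∂M_{ij}`. -/
def DMH {d : ℕ} (H : Hamiltonian d) (i j : Fin d) (x : Torus d) (p : Vec d) (M : Mat d)
    (m θ : ℝ) : ℝ :=
  fderiv ℝ (fun M' : Mat d => H x p M' m θ) M (Pi.single i (Pi.single j 1))

/-- Assumption (H1), with the function `g`. The product `D_M H : M` is used for symmetric `M`. The
integral condition is imposed on those pairs `(𝐦, u)` for which the integrals exist. -/
def AssumptionH1 {d : ℕ} (E : Set ℝ) (h : Mac d → C(Torus d, ℝ)) (g : Torus d → ℝ → ℝ → ℝ)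
    (H : Hamiltonian d) : Prop :=
  ContinuousOn (fun z : Torus d × ℝ × ℝ => g z.1 z.2.1 z.2.2) {z | z.2.1 ∈ E} ∧
  ∃ γ τ C₁ C₂ C₃ C₄ : ℝ, 1 < γ ∧ 0 ≤ τ ∧ τ < 1 ∧ 0 < C₁ ∧ 0 < C₂ ∧ 0 < C₃ ∧ 0 < C₄ ∧
    (∀ (x : Torus d) (p : Vec d) (M : Mat d), (∀ i j, M i j = M j i) → ∀ m ∈ E, ∀ θ : ℝ,
      1 / C₁ * (m ^ (-τ) * ‖p‖ ^ γ) + C₂ * g x m θ - C₁ ≤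
        -H x p M m θ + ∑ i, DpH H i x p M m θ * p i + ∑ i, ∑ j, DMH H i j x p M m θ * M i j) ∧
    (∀ (m u : Torus d → ℝ) (P : Torus d → Vec d) (Q : Torus d → Mat d),
      IsDensity E m → HasWeakDerivs γ u P Q →
      Integrable (fun x => g x (m x) (h (bold m) x)) volume →
      Integrable (fun x => ‖P x‖ ^ γ * m x ^ (-τ)) volume →
      Integrable (fun x => H x (P x) (Q x) (m x) (h (bold m) x)) volume →
      -C₃ * (∫ x, g x (m x) (h (bold m) x)) + 1 / C₁ * (∫ x, ‖P x‖ ^ γ * m x ^ (-τ)) - C₁ ≤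
          ∫ x, H x (P x) (Q x) (m x) (h (bold m) x) ∧
        ∫ x, H x (P x) (Q x) (m x) (h (bold m) x) ≤
          -C₄ * (∫ x, g x (m x) (h (bold m) x)) +
            C₁ * (1 + ∫ x, ‖P x‖ ^ γ * m x ^ (-τ)))

/-- Assumption (H2): `H` is of class `C^∞` on `𝕋^d × ℝ^d × ℝ^{d×d} × E × ℝ`. -/
def AssumptionH2 {d : ℕ} (E : Set ℝ) (H : Hamiltonian d) : Prop :=
  ContDiffOn ℝ ∞ (fun z : (Fin d → ℝ) × Vec d × Mat d × ℝ × ℝ =>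
    H (proj z.1) z.2.1 z.2.2.1 z.2.2.2.1 z.2.2.2.2) {z | z.2.2.2.1 ∈ E}

/-- First component of the mean-field game operator `A(η, v)`:
`-v - H(x, Dv, D²v, η, h(𝛈))`. -/
def opA₁ {d : ℕ} (h : Mac d → C(Torus d, ℝ)) (H : Hamiltonian d) (η v : Torus d → ℝ)
    (x : Torus d) : ℝ :=
  -v x - H x (grad v x) (hess v x) (η x) (h (bold η) x)

/-- Second component of the mean-field game operator `A(η, v)`:
`η - div(η D_p H) + (η D_{M_{ij}} H)_{x_i x_j} - 1`. -/
def opA₂ {d : ℕ} (h : Mac d → C(Torus d, ℝ)) (H : Hamiltonian d) (η v : Torus d → ℝ)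
    (x : Torus d) : ℝ :=
  η x
    - ∑ i, pd i (fun y => η y * DpH H i y (grad v y) (hess v y) (η y) (h (bold η) y)) x
    + ∑ i, ∑ j,
        pd i (pd j fun y => η y * DMH H i j y (grad v y) (hess v y) (η y) (h (bold η) y)) x
    - 1

/-- Assumption (H3): the operator `A` is monotone for the `L² × L²` inner product. -/
def AssumptionH3 {d : ℕ} (E : Set ℝ) (h : Mac d → C(Torus d, ℝ)) (H : Hamiltonian d) : Prop :=
  ∀ η v η' v' : Torus d → ℝ, IsSmooth η → IsSmooth v → IsSmooth η' → IsSmooth v' →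
    (∀ x, η x ∈ E) → (∀ x, η' x ∈ E) →
    0 ≤ (∫ x, (opA₁ h H η v x - opA₁ h H η' v' x) * (η x - η' x)) +
      ∫ x, (opA₂ h H η v x - opA₂ h H η' v' x) * (v x - v' x)

/-! ### The regularized problem -/

/-- `β : (0,∞) → (-∞,0]` is an admissible penalization with parameters `ε₁` and `q`. -/
structure IsPenalization (ε₁ q : ℝ) (β : ℝ → ℝ) : Prop where
  nonpos : ∀ s, 0 < s → β s ≤ 0
  mono : MonotoneOn β (Set.Ioi 0)
  smooth : ContDiffOn ℝ ∞ β (Set.Ioi 0)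
  eq_zero : ∀ s, ε₁ ≤ s → β s = 0
  eq_neg : ∀ s, 0 < s → s ≤ ε₁ / 2 → β s = -(1 / s ^ q)

/-- `(m, u)` solves the regularized system at every point of the torus. -/
def SolvesRP {d : ℕ} (h : Mac d → C(Torus d, ℝ)) (H : Hamiltonian d) (p : ℕ) (ε₁ ε₂ : ℝ)
    (β : ℝ → ℝ) (m u : Torus d → ℝ) : Prop :=
  ∀ x : Torus d,
    opA₁ h H m u x + ε₁ * (m x + lap^[2 * p] m x) + ε₂ * (m x - lap m x) + β (m x) = 0 ∧
    opA₂ h H m u x + ε₁ * (u x + lap^[2 * p] u x) + ε₂ * (u x - lap u x) = 0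

end RegMFG

end

/-!
The regularization makes the Galerkin systems, posed on trigonometric polynomials, strongly
monotone, so that a minimizer of the norm of the residual is a solution. Monotonicity of the
operator `A` also bounds the energy of these approximations, hence their `H^{2p}` norms. Since
`q > d`, a density with bounded gradient that comes close to zero has a large penalization
integral, so the densities also stay away from zero. By compactness the approximations converge to
a weak solution, and as the regularizing operator gains `4p` derivatives, more than the
nonlinearities lose, a bootstrap on the Fourier coefficients shows that it is smooth.
-/

noncomputable section

namespace RegMFG

open Filter Topology UnitAddTorus
open Complex (I)
open scoped Real

variable {d : ℕ}

/-! ### Differential calculus on the torus -/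

/-- `f ∈ C^n(𝕋^d)`: the periodic lift of `f` to `ℝ^d` is of class `C^n`. -/
def IsContDiff (n : WithTop ℕ∞) (f : Torus d → ℝ) : Prop :=
  ContDiff ℝ n fun y : Fin d → ℝ => f (proj y)

lemma IsSmooth.isContDiff {f : Torus d → ℝ} (hf : IsSmooth f) (n : ℕ) : IsContDiff n f :=
  ContDiff.of_le hf (by exact_mod_cast le_top)

lemma isSmooth_of_forall_isContDiff {f : Torus d → ℝ} (hf : ∀ n : ℕ, IsContDiff n f) :
    IsSmooth f :=
  contDiff_infty.2 hf

lemma IsSmooth.sub {f g : Torus d → ℝ} (hf : IsSmooth f) (hg : IsSmooth g) :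
    IsSmooth fun x => f x - g x :=
  ContDiff.sub hf hg

lemma IsSmooth.sum {ι : Type*} {s : Finset ι} {f : ι → Torus d → ℝ}
    (hf : ∀ j ∈ s, IsSmooth (f j)) : IsSmooth fun x => ∑ j ∈ s, f j x :=
  ContDiff.sum hf

lemma IsSmooth.lap {f : Torus d → ℝ} (hf : IsSmooth f) : IsSmooth (lap f) :=
  .sum fun i _ => (hf.pd i).pd i

lemma IsSmooth.lap_iterate {f : Torus d → ℝ} (hf : IsSmooth f) (n : ℕ) :
    IsSmooth (RegMFG.lap^[n] f) := by
  induction n with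
  | zero => exact hf
  | succ n ih => rw [Function.iterate_succ_apply']; exact ih.lap

lemma IsSmooth.pd_iterate {f : Torus d → ℝ} (hf : IsSmooth f) (i : Fin d) (n : ℕ) :
    IsSmooth ((RegMFG.pd i)^[n] f) := by
  induction n with
  | zero => exact hf
  | succ n ih => rw [Function.iterate_succ_apply']; exact ih.pd i

lemma pd_eq_of_hasDerivAt {f : Torus d → ℝ} {i : Fin d} {x : Torus d} {a : ℝ}
    (h : HasDerivAt (fun s : ℝ => f (x + Pi.single i (s : UnitAddCircle))) a 0) :
    pd i f x = a := h.deriv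

namespace IsContDiff

variable {n : WithTop ℕ∞} {f g : Torus d → ℝ}

lemma of_le {m : WithTop ℕ∞} (hf : IsContDiff n f) (h : m ≤ n) : IsContDiff m f :=
  ContDiff.of_le hf h

lemma continuous (hf : IsContDiff n f) : Continuous f :=
  isQuotientMap_proj.continuous_iff.2 (ContDiff.continuous hf)

lemma mul (hf : IsContDiff n f) (hg : IsContDiff n g) : IsContDiff n fun x => f x * g x :=
  ContDiff.mul hf hg

lemma pd_proj (hf : IsContDiff n f) (hn : 1 ≤ n) (i : Fin d) (y : Fin d → ℝ) :
    pd i f (proj y) = fderiv ℝ (fun y : Fin d → ℝ => f (proj y)) y (Pi.single i 1) := by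
  have hdiff := ContDiff.differentiable hf (zero_lt_one.trans_le hn).ne' y
  rw [← hdiff.lineDeriv_eq_fderiv]
  simp only [RegMFG.pd, lineDeriv, proj_add_single]

lemma pd (hf : IsContDiff (n + 1) f) (i : Fin d) : IsContDiff n (pd i f) := by
  unfold IsContDiff
  rw [funext (hf.pd_proj le_add_self i)]
  exact (ContDiff.fderiv_right hf le_rfl).clm_apply contDiff_const

lemma continuous_pd (hf : IsContDiff 1 f) (i : Fin d) : Continuous (RegMFG.pd i f) :=
  (pd (n := 0) (by simpa using hf) i).continuous

lemma pd_iterate {n j : ℕ} (hf : IsContDiff (n + j : ℕ) f) (i : Fin d) :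
    IsContDiff n ((RegMFG.pd i)^[j] f) := by
  induction j generalizing f with
  | zero => simpa using hf
  | succ j ih =>
    rw [Function.iterate_succ_apply]
    exact ih (pd (n := (n + j : ℕ)) (by exact_mod_cast hf) i)

lemma hasDerivAt (hf : IsContDiff 1 f) (i : Fin d) (x : Torus d) (t : ℝ) :
    HasDerivAt (fun s : ℝ => f (x + Pi.single i (s : UnitAddCircle)))
      (RegMFG.pd i f (x + Pi.single i (t : UnitAddCircle))) t := by
  obtain ⟨y, rfl⟩ := isQuotientMap_proj.surjective x
  simp only [proj_add_single]
  rw [hf.pd_proj le_rfl]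
  have hline : HasDerivAt (fun s : ℝ => y + s • Pi.single i (1 : ℝ)) (Pi.single i (1 : ℝ)) t := by
    simpa using ((hasDerivAt_id t).smul_const (Pi.single i (1 : ℝ))).const_add y
  exact ((ContDiff.differentiable hf one_ne_zero) _).hasFDerivAt.comp_hasDerivAt t hline

lemma hasDerivAt_zero (hf : IsContDiff 1 f) (i : Fin d) (x : Torus d) :
    HasDerivAt (fun s : ℝ => f (x + Pi.single i (s : UnitAddCircle))) (RegMFG.pd i f x) 0 := by
  simpa using hf.hasDerivAt i x 0

lemma pd_sub (hf : IsContDiff 1 f) (hg : IsContDiff 1 g) (i : Fin d) :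
    RegMFG.pd i (fun x => f x - g x) = fun x => RegMFG.pd i f x - RegMFG.pd i g x :=
  funext fun x => pd_eq_of_hasDerivAt ((hf.hasDerivAt_zero i x).sub (hg.hasDerivAt_zero i x))

lemma pd_add (hf : IsContDiff 1 f) (hg : IsContDiff 1 g) (i : Fin d) :
    RegMFG.pd i (f + g) = RegMFG.pd i f + RegMFG.pd i g :=
  funext fun x => pd_eq_of_hasDerivAt ((hf.hasDerivAt_zero i x).add (hg.hasDerivAt_zero i x))

lemma pd_const_smul (c : ℝ) (hf : IsContDiff 1 f) (i : Fin d) :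
    RegMFG.pd i (c • f) = c • RegMFG.pd i f :=
  funext fun x => pd_eq_of_hasDerivAt ((hf.hasDerivAt_zero i x).const_smul c)

lemma pd_mul (hf : IsContDiff 1 f) (hg : IsContDiff 1 g) (i : Fin d) :
    RegMFG.pd i (fun x => f x * g x) =
      fun x => RegMFG.pd i f x * g x + f x * RegMFG.pd i g x :=
  funext fun x => pd_eq_of_hasDerivAt <|
    ((hf.hasDerivAt_zero i x).mul (hg.hasDerivAt_zero i x)).congr_deriv (by simp)

end IsContDiff

/-- The space `C^∞(𝕋^d)`. -/
def smoothFun (d : ℕ) : Submodule ℝ (Torus d → ℝ) where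
  carrier := {f | IsSmooth f}
  add_mem' {f g} (hf : IsSmooth f) (hg : IsSmooth g) := ContDiff.add hf hg
  zero_mem' := (contDiff_const : IsSmooth fun _ => 0)
  smul_mem' c f (hf : IsSmooth f) := ContDiff.const_smul c hf

namespace smoothFun

instance : CoeFun (smoothFun d) fun _ => Torus d → ℝ := ⟨Subtype.val⟩

/-- The partial derivative `∂_i`, as a linear map. -/
def pdLM (i : Fin d) : smoothFun d →ₗ[ℝ] smoothFun d where
  toFun f := ⟨pd i f, IsSmooth.pd f.2 i⟩
  map_add' f g := Subtype.ext ((f.2.isContDiff 1).pd_add (g.2.isContDiff 1) i)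
  map_smul' c f := Subtype.ext ((f.2.isContDiff 1).pd_const_smul c i)

/-- The Laplacian, as a linear map. -/
def lapLM (d : ℕ) : smoothFun d →ₗ[ℝ] smoothFun d := ∑ i, pdLM i ∘ₗ pdLM i

lemma coe_lapLM (f : smoothFun d) : (lapLM d f : Torus d → ℝ) = lap f := by
  funext x
  simp [lapLM, lap, pdLM]

lemma coe_lapLM_pow (n : ℕ) (f : smoothFun d) :
    ((lapLM d ^ n) f : Torus d → ℝ) = lap^[n] f := by
  induction n with
  | zero => rfl
  | succ n ih => rw [pow_succ', Module.End.mul_apply, coe_lapLM, ih, Function.iterate_succ_apply']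

end smoothFun

instance : IsProbabilityMeasure (volume : Measure UnitAddCircle) :=
  ⟨by simp⟩

lemma integrable_of_continuous {F : Type*} [NormedAddCommGroup F] {f : Torus d → F}
    (hf : Continuous f) : Integrable f (volume : Measure (Torus d)) :=
  hf.integrable_of_hasCompactSupport (HasCompactSupport.of_compactSpace f)

lemma memLp_of_continuous {f : Torus d → ℝ} (hf : Continuous f) (q : ENNReal) :
    MemLp f q (volume : Measure (Torus d)) := by
  obtain ⟨C, hC⟩ := isCompact_univ.exists_bound_of_continuousOn hf.continuousOn
  exact MemLp.of_bound hf.aestronglyMeasurable C (.of_forall fun x => hC x (Set.mem_univ x))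

lemma hasDerivAt_integral_of_bounded {α : Type*} [MeasurableSpace α] {μ : Measure α}
    [IsFiniteMeasure μ] {F F' : ℝ → α → ℝ} {t₀ C : ℝ} (hF : ∀ t, Integrable (F t) μ)
    (hF' : AEStronglyMeasurable (F' t₀) μ) (hC : ∀ t x, ‖F' t x‖ ≤ C)
    (hderiv : ∀ t x, HasDerivAt (fun s => F s x) (F' t x) t) :
    HasDerivAt (fun t => ∫ x, F t x ∂μ) (∫ x, F' t₀ x ∂μ) t₀ :=
  (hasDerivAt_integral_of_dominated_loc_of_deriv_le (bound := fun _ => C) univ_mem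
    (.of_forall fun t => (hF t).aestronglyMeasurable) (hF t₀) hF'
    (.of_forall fun x t _ => hC t x) (integrable_const C)
    (.of_forall fun x t _ => hderiv t x)).2

lemma hasDerivAt_integral_translate {f : Torus d → ℝ} (hf : IsContDiff 1 f) (i : Fin d) :
    HasDerivAt (fun t : ℝ => ∫ x : Torus d, f (x + Pi.single i (t : UnitAddCircle)))
      (∫ x, pd i f x) 0 := by
  obtain ⟨C, hC⟩ := isCompact_univ.exists_bound_of_continuousOn (hf.continuous_pd i).continuousOn
  have hcont {g : Torus d → ℝ} (hg : Continuous g) (t : ℝ) :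
      Continuous fun x : Torus d => g (x + Pi.single i (t : UnitAddCircle)) :=
    hg.comp (continuous_id.add continuous_const)
  simpa using hasDerivAt_integral_of_bounded (t₀ := 0)
    (fun t => integrable_of_continuous (hcont hf.continuous t))
    (hcont (hf.continuous_pd i) 0).aestronglyMeasurable (fun t x => hC _ (Set.mem_univ _))
    (fun t x => hf.hasDerivAt i x t)

lemma integral_pd {f : Torus d → ℝ} (hf : IsContDiff 1 f) (i : Fin d) : ∫ x, pd i f x = 0 := by
  have h := hasDerivAt_integral_translate hf i
  simp only [integral_add_right_eq_self] at h
  exact h.unique (hasDerivAt_const 0 _)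

lemma integral_pd_mul {f φ : Torus d → ℝ} (hf : IsContDiff 1 f) (hφ : IsContDiff 1 φ)
    (i : Fin d) : ∫ x, pd i f x * φ x = -∫ x, f x * pd i φ x := by
  have h := integral_pd (hf.mul hφ) i
  have hinteg₁ : Integrable (fun x => pd i f x * φ x) :=
    integrable_of_continuous ((hf.continuous_pd i).mul hφ.continuous)
  have hinteg₂ : Integrable (fun x => f x * pd i φ x) :=
    integrable_of_continuous (hf.continuous.mul (hφ.continuous_pd i))
  rw [hf.pd_mul hφ, integral_add hinteg₁ hinteg₂] at h
  linarith

/-! ### Fourier coefficients -/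

/-- The Fourier symbol `2πi k_i` of `∂_i`. -/
def symbol (k : Fin d → ℤ) (i : Fin d) : ℂ := 2 * π * I * k i

lemma symbol_neg (k : Fin d → ℤ) (i : Fin d) : symbol (-k) i = -symbol k i := by
  simp [symbol]

lemma conj_symbol (k : Fin d → ℤ) (i : Fin d) : starRingEnd ℂ (symbol k i) = -symbol k i := by
  simp [symbol, Complex.conj_ofNat]

lemma norm_symbol (k : Fin d → ℤ) (i : Fin d) : ‖symbol k i‖ = 2 * π * |(k i : ℝ)| := by
  simp [symbol, abs_of_pos Real.pi_pos]

lemma abs_le_norm_symbol (k : Fin d → ℤ) (i : Fin d) : |(k i : ℝ)| ≤ ‖symbol k i‖ := by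
  rw [norm_symbol]
  nlinarith [Real.pi_gt_three, abs_nonneg (k i : ℝ)]

lemma norm_mFourier_apply (k : Fin d → ℤ) (x : Torus d) : ‖mFourier k x‖ = 1 := by
  simp only [mFourier, ContinuousMap.coe_mk, norm_prod, fourier_apply, Circle.norm_coe,
    Finset.prod_const_one]

/-- The phase `y ↦ 2π k·y` of the character `mFourier k`. -/
def phase (k : Fin d → ℤ) : (Fin d → ℝ) →L[ℝ] ℝ :=
  ∑ i, (2 * π * (k i : ℝ)) • ContinuousLinearMap.proj (R := ℝ) (φ := fun _ => ℝ) i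

lemma phase_apply (k : Fin d → ℤ) (y : Fin d → ℝ) : phase k y = 2 * π * ∑ i, (k i : ℝ) * y i := by
  simp [phase, Finset.mul_sum, mul_assoc]

lemma mFourier_proj (k : Fin d → ℤ) (y : Fin d → ℝ) :
    mFourier k (proj y) = Complex.exp (phase k y * I) := by
  simp only [mFourier, ContinuousMap.coe_mk, proj, fourier_coe_apply, phase_apply,
    ← Complex.exp_sum]
  congr 1
  push_cast
  rw [Finset.mul_sum, Finset.sum_mul]
  exact Finset.sum_congr rfl fun i _ => by ring

lemma contDiff_mFourier_proj (k : Fin d → ℤ) (n : WithTop ℕ∞) :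
    ContDiff ℝ n fun y : Fin d → ℝ => mFourier k (proj y) := by
  simp only [mFourier_proj]
  exact ((Complex.ofRealCLM.contDiff.comp (phase k).contDiff).mul contDiff_const).cexp

lemma mFourier_add_single (k : Fin d → ℤ) (x : Torus d) (i : Fin d) (t : ℝ) :
    mFourier k (x + Pi.single i (t : UnitAddCircle)) =
      mFourier k x * Complex.exp (symbol k i * t) := by
  obtain ⟨y, rfl⟩ := isQuotientMap_proj.surjective x
  rw [proj_add_single, mFourier_proj, mFourier_proj, ← Complex.exp_add, map_add, map_smul]
  have hphase : phase k (Pi.single i 1) = 2 * π * k i := by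
    simp [phase_apply, Pi.single_apply]
  rw [hphase, symbol]
  push_cast
  congr 1
  simp only [smul_eq_mul, Complex.ofReal_mul, Complex.ofReal_ofNat, Complex.ofReal_intCast]
  ring

/-- The real trigonometric monomial `Re (c e_k)`. -/
def trig (c : ℂ) (k : Fin d → ℤ) (x : Torus d) : ℝ := (c * mFourier k x).re

lemma isSmooth_trig (c : ℂ) (k : Fin d → ℤ) : IsSmooth (trig c k) :=
  Complex.reCLM.contDiff.comp (contDiff_const.mul (contDiff_mFourier_proj k ∞))

lemma pd_trig (c : ℂ) (k : Fin d → ℤ) (i : Fin d) :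
    pd i (trig c k) = trig (symbol k i * c) k := by
  funext x
  refine pd_eq_of_hasDerivAt ?_
  simp only [trig, mFourier_add_single]
  have hexp : HasDerivAt (fun s : ℝ => c * (mFourier k x * Complex.exp (symbol k i * s)))
      (symbol k i * c * mFourier k x) 0 := by
    refine ((((hasDerivAt_id (0 : ℝ)).ofReal_comp.const_mul (symbol k i)).cexp.const_mul
      (mFourier k x)).const_mul c).congr_deriv ?_
    simp only [id_eq, Complex.ofReal_zero, mul_zero, Complex.exp_zero, Complex.ofReal_one]
    ring
  exact Complex.reCLM.hasFDerivAt.comp_hasDerivAt (0 : ℝ) hexp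

lemma pd_iterate_trig (c : ℂ) (k : Fin d → ℤ) (i : Fin d) (n : ℕ) :
    (pd i)^[n] (trig c k) = trig (symbol k i ^ n * c) k := by
  induction n with
  | zero => simp
  | succ n ih => rw [Function.iterate_succ_apply', ih, pd_trig, pow_succ', mul_assoc]

/-- The `k`-th Fourier coefficient of a real function on the torus. -/
def coeff (f : Torus d → ℝ) (k : Fin d → ℤ) : ℂ := ∫ x, mFourier (-k) x * f x

-- Mathlib's Fourier analysis on `UnitAddTorus` uses the product of the Haar measures.
lemma volume_eq_pi_haar :
    (volume : Measure (Torus d)) = Measure.pi fun _ => AddCircle.haarAddCircle := by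
  rw [volume_pi]
  congr 1
  funext i
  rw [AddCircle.volume_eq_smul_haarAddCircle]
  simp

lemma coeff_eq_mFourierCoeff (f : Torus d → ℝ) :
    coeff f = mFourierCoeff fun x => (f x : ℂ) := by
  funext k
  rw [coeff, volume_eq_pi_haar]
  rfl

lemma coeff_congr {f g : Torus d → ℝ} (h : f =ᵐ[volume] g) (k : Fin d → ℤ) :
    coeff f k = coeff g k :=
  integral_congr_ae (by filter_upwards [h] with x hx; rw [hx])

lemma integrable_mFourier_mul {f : Torus d → ℝ} (hf : Integrable f volume) (k : Fin d → ℤ) :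
    Integrable (fun x => mFourier k x * (f x : ℂ)) volume :=
  hf.ofReal.bdd_mul (c := 1) (mFourier k).continuous.aestronglyMeasurable
    (.of_forall fun x => (norm_mFourier_apply k x).le)

lemma coeff_add {f g : Torus d → ℝ} (hf : Integrable f volume) (hg : Integrable g volume)
    (k : Fin d → ℤ) : coeff (fun x => f x + g x) k = coeff f k + coeff g k := by
  simp only [coeff, Complex.ofReal_add, mul_add]
  exact integral_add (integrable_mFourier_mul hf _) (integrable_mFourier_mul hg _)

lemma coeff_const_mul (f : Torus d → ℝ) (c : ℝ) (k : Fin d → ℤ) :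
    coeff (fun x => c * f x) k = c * coeff f k := by
  simp only [coeff, Complex.ofReal_mul, mul_left_comm _ (c : ℂ)]
  exact integral_const_mul _ _

lemma coeff_sub {f g : Torus d → ℝ} (hf : Integrable f volume) (hg : Integrable g volume)
    (k : Fin d → ℤ) : coeff (fun x => f x - g x) k = coeff f k - coeff g k := by
  simp only [coeff, Complex.ofReal_sub, mul_sub]
  exact integral_sub (integrable_mFourier_mul hf _) (integrable_mFourier_mul hg _)

lemma coeff_sum {ι : Type*} (s : Finset ι) {f : ι → Torus d → ℝ}
    (hf : ∀ j ∈ s, Integrable (f j) volume) (k : Fin d → ℤ) :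
    coeff (fun x => ∑ j ∈ s, f j x) k = ∑ j ∈ s, coeff (f j) k := by
  simp only [coeff, Complex.ofReal_sum, Finset.mul_sum]
  exact integral_finsetSum s fun j hj => integrable_mFourier_mul (hf j hj) _

lemma norm_coeff_le {f : Torus d → ℝ} {C : ℝ} (hC : ∀ x, |f x| ≤ C) (k : Fin d → ℤ) :
    ‖coeff f k‖ ≤ C := by
  have h := norm_integral_le_of_norm_le_const (μ := (volume : Measure (Torus d))) (C := C)
    (f := fun x => mFourier (-k) x * (f x : ℂ)) (.of_forall fun x => by
      rw [norm_mul, norm_mFourier_apply, one_mul, Complex.norm_real]; exact hC x)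
  simpa [coeff] using h

lemma integral_mul_trig {f : Torus d → ℝ} (hf : Integrable f volume) (c : ℂ) (k : Fin d → ℤ) :
    ∫ x, f x * trig c (-k) x = (c * coeff f k).re := by
  rw [coeff, ← integral_const_mul, ← Complex.reCLM_apply, ← Complex.reCLM.integral_comp_comm
    ((integrable_mFourier_mul hf _).const_mul c)]
  refine integral_congr_ae (.of_forall fun x => ?_)
  simp only [trig, Complex.reCLM_apply, ← mul_assoc, Complex.re_mul_ofReal]
  exact mul_comm _ _

lemma eq_of_forall_re_mul_eq {z w : ℂ} (h : ∀ c : ℂ, (c * z).re = (c * w).re) : z = w :=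
  Complex.ext (by simpa using h 1) (by simpa using h I)

lemma coeff_pd {f : Torus d → ℝ} (hf : IsContDiff 1 f) (i : Fin d) (k : Fin d → ℤ) :
    coeff (pd i f) k = symbol k i * coeff f k := by
  refine eq_of_forall_re_mul_eq fun c => ?_
  rw [← integral_mul_trig (integrable_of_continuous (hf.continuous_pd i)),
    integral_pd_mul hf ((isSmooth_trig _ _).isContDiff 1), pd_trig,
    integral_mul_trig (integrable_of_continuous hf.continuous), symbol_neg, ← Complex.neg_re]
  congr 1
  ring

lemma coeff_pd_iterate {n : ℕ} {f : Torus d → ℝ} (hf : IsContDiff n f) (i : Fin d)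
    (k : Fin d → ℤ) : coeff ((pd i)^[n] f) k = symbol k i ^ n * coeff f k := by
  induction n with
  | zero => simp
  | succ n ih =>
    rw [Function.iterate_succ_apply', coeff_pd, ih (hf.of_le (by exact_mod_cast Nat.le_succ n)),
      pow_succ', mul_assoc]
    exact IsContDiff.pd_iterate (n := 1) (j := n) (by rwa [add_comm]) i

/-! ### Weighted square-summability of Fourier coefficients -/

/-- The weight `1 + |k|` on frequencies. -/
def weight (k : Fin d → ℤ) : ℝ := 1 + ‖k‖

lemma one_le_weight (k : Fin d → ℤ) : 1 ≤ weight k := le_add_of_nonneg_right (norm_nonneg k)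

lemma weight_pos (k : Fin d → ℤ) : 0 < weight k := one_pos.trans_le (one_le_weight k)

lemma weight_pow_mul_nonneg (k : Fin d → ℤ) (n : ℕ) {a : ℝ} (ha : 0 ≤ a) :
    0 ≤ weight k ^ n * a :=
  mul_nonneg (pow_nonneg (weight_pos k).le n) ha

lemma abs_le_weight (k : Fin d → ℤ) (i : Fin d) : |(k i : ℝ)| ≤ weight k := by
  rw [← Int.norm_eq_abs]
  exact (norm_le_pi_norm k i).trans (le_add_of_nonneg_left zero_le_one)

lemma norm_symbol_le (k : Fin d → ℤ) (i : Fin d) : ‖symbol k i‖ ≤ 2 * π * weight k := by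
  rw [norm_symbol]
  exact mul_le_mul_of_nonneg_left (abs_le_weight k i) (by positivity)

lemma weight_pow_le (k : Fin d → ℤ) (n : ℕ) :
    weight k ^ n ≤ 2 ^ n * (1 + ∑ i, |(k i : ℝ)| ^ n) := by
  have hsum : 0 ≤ ∑ i, |(k i : ℝ)| ^ n := Finset.sum_nonneg fun i _ => by positivity
  rcases le_or_gt ‖k‖ 1 with hk | hk
  · calc weight k ^ n ≤ 2 ^ n * 1 := by
          rw [mul_one]
          exact pow_le_pow_left₀ (weight_pos k).le (by unfold weight; linarith) n
      _ ≤ _ := by gcongr; linarith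
  · obtain ⟨i, hi⟩ : ∃ i, ‖k‖ ≤ |(k i : ℝ)| := by
      by_contra! hlt
      simp only [← Int.norm_eq_abs] at hlt
      exact lt_irrefl _ ((pi_norm_lt_iff (zero_lt_one.trans hk)).2 hlt)
    calc weight k ^ n ≤ (2 * |(k i : ℝ)|) ^ n :=
          pow_le_pow_left₀ (weight_pos k).le (by unfold weight; linarith) n
      _ = 2 ^ n * |(k i : ℝ)| ^ n := mul_pow _ _ _
      _ ≤ _ := by
          gcongr
          exact (Finset.single_le_sum (f := fun i => |(k i : ℝ)| ^ n)
            (fun i _ => by positivity) (Finset.mem_univ i)).trans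
              (le_add_of_nonneg_left zero_le_one)

lemma weight_pow_mul_sq_norm_le (k : Fin d → ℤ) (n : ℕ) (z : ℂ) :
    weight k ^ (2 * n) * ‖z‖ ^ 2 ≤ 2 ^ (2 * n) * (‖z‖ ^ 2 + ∑ i, ‖symbol k i ^ n * z‖ ^ 2) := by
  calc weight k ^ (2 * n) * ‖z‖ ^ 2
      ≤ 2 ^ (2 * n) * (1 + ∑ i, |(k i : ℝ)| ^ (2 * n)) * ‖z‖ ^ 2 := by
        gcongr
        exact weight_pow_le k _
    _ = 2 ^ (2 * n) * (‖z‖ ^ 2 + ∑ i, (|(k i : ℝ)| ^ n * ‖z‖) ^ 2) := by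
        simp only [mul_assoc, add_mul, one_mul, Finset.sum_mul, mul_pow, ← pow_mul, mul_comm n]
    _ ≤ _ := by
        gcongr with i
        rw [norm_mul, norm_pow]
        gcongr
        exact abs_le_norm_symbol k i

lemma summable_inv_weight_pow {n : ℕ} (hn : d < n) :
    Summable fun k : Fin d → ℤ => (weight k)⁻¹ ^ n := by
  let B := Pi.basisFun ℝ (Fin d)
  let L : Submodule ℤ (Fin d → ℝ) := Submodule.span ℤ (Set.range B)
  let b : Module.Basis (Fin d) ℤ L := B.restrictScalars ℤ
  have hrank : Module.finrank ℤ L = d := by simpa using Module.finrank_eq_card_basis b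
  have hlattice := (ZLattice.summable_norm_pow_inv L n (hrank.symm ▸ hn)).comp_injective
    b.equivFun.symm.injective
  have hnorm (k : Fin d → ℤ) : ‖b.equivFun.symm k‖ = ‖k‖ := by
    have hcoe : ((b.equivFun.symm k : L) : Fin d → ℝ) = fun i => (k i : ℝ) := by
      have hb (i : Fin d) : ((b i : L) : Fin d → ℝ) = Pi.single i 1 := by
        rw [Module.Basis.restrictScalars_apply, Pi.basisFun_apply]
      funext j
      simp [Module.Basis.equivFun_symm_apply, hb, Finset.sum_apply, Pi.single_apply]
    rw [Submodule.coe_norm, hcoe]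
    simp only [Pi.norm_def]
    congr 2
  refine Summable.of_norm_bounded_eventually hlattice ?_
  filter_upwards [(Set.finite_singleton (0 : Fin d → ℤ)).compl_mem_cofinite] with k hk
  simp only [Function.comp_apply, hnorm]
  rw [Real.norm_of_nonneg (pow_nonneg (inv_nonneg.2 (weight_pos k).le) n)]
  exact pow_le_pow_left₀ (inv_nonneg.2 (weight_pos k).le)
    (inv_anti₀ (norm_pos_iff.2 hk) (le_add_of_nonneg_left zero_le_one)) n

lemma summable_mul_and_tsum_mul_le_sqrt {ι : Type*} {a b : ι → ℝ} (ha : ∀ i, 0 ≤ a i)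
    (hb : ∀ i, 0 ≤ b i) (hsa : Summable fun i => a i ^ 2) (hsb : Summable fun i => b i ^ 2) :
    Summable (fun i => a i * b i) ∧
      ∑' i, a i * b i ≤ √(∑' i, a i ^ 2) * √(∑' i, b i ^ 2) := by
  have hpartial (s : Finset ι) :
      ∑ i ∈ s, a i * b i ≤ √(∑' i, a i ^ 2) * √(∑' i, b i ^ 2) := by
    refine (Real.sum_mul_le_sqrt_mul_sqrt s a b).trans ?_
    gcongr
    · exact hsa.sum_le_tsum s fun i _ => sq_nonneg _
    · exact hsb.sum_le_tsum s fun i _ => sq_nonneg _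
  have hs := summable_of_sum_le (fun i => mul_nonneg (ha i) (hb i)) hpartial
  exact ⟨hs, hs.tsum_le_of_sum_le hpartial⟩

/-- The square of the `H^s` norm of a family of Fourier coefficients, for `s ∈ ℕ`; it is `0` if the
family does not satisfy `MemH s`. -/
def sqNormH (s : ℕ) (c : (Fin d → ℤ) → ℂ) : ℝ := ∑' k, weight k ^ (2 * s) * ‖c k‖ ^ 2

/-- The family `c` of Fourier coefficients has finite `H^s` norm. -/
def MemH (s : ℕ) (c : (Fin d → ℤ) → ℂ) : Prop :=
  Summable fun k => weight k ^ (2 * s) * ‖c k‖ ^ 2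

lemma sqNormH_nonneg (s : ℕ) (c : (Fin d → ℤ) → ℂ) : 0 ≤ sqNormH s c :=
  tsum_nonneg fun k => weight_pow_mul_nonneg k _ (sq_nonneg _)

/-- The constant of the embedding of `H^s` into the space of families with summable
`|k|^n`-moments. -/
def embConst (d s n : ℕ) : ℝ := √(∑' k : Fin d → ℤ, (weight k)⁻¹ ^ (2 * s - 2 * n))

namespace MemH

variable {s : ℕ} {c c' : (Fin d → ℤ) → ℂ}

lemma of_le {s' : ℕ} {C : ℝ} (h : MemH s c)
    (hc : ∀ k, weight k ^ s' * ‖c' k‖ ≤ C * (weight k ^ s * ‖c k‖)) : MemH s' c' := by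
  refine Summable.of_nonneg_of_le (fun k => weight_pow_mul_nonneg k _ (sq_nonneg _)) (fun k => ?_)
    (h.mul_left (C ^ 2))
  calc weight k ^ (2 * s') * ‖c' k‖ ^ 2 = (weight k ^ s' * ‖c' k‖) ^ 2 := by ring
    _ ≤ (C * (weight k ^ s * ‖c k‖)) ^ 2 :=
        pow_le_pow_left₀ (weight_pow_mul_nonneg k _ (norm_nonneg _)) (hc k) 2
    _ = C ^ 2 * (weight k ^ (2 * s) * ‖c k‖ ^ 2) := by ring

lemma mono {s' : ℕ} (h : MemH s c) (hs : s' ≤ s) : MemH s' c :=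
  h.of_le (C := 1) fun k => by
    rw [one_mul]
    gcongr
    exact one_le_weight k

lemma add (h : MemH s c) (h' : MemH s c') : MemH s fun k => c k + c' k := by
  refine Summable.of_nonneg_of_le (fun k => weight_pow_mul_nonneg k _ (sq_nonneg _)) (fun k => ?_)
    ((Summable.add h h').mul_left 2)
  calc weight k ^ (2 * s) * ‖c k + c' k‖ ^ 2
      ≤ weight k ^ (2 * s) * (2 * (‖c k‖ ^ 2 + ‖c' k‖ ^ 2)) := by
        refine mul_le_mul_of_nonneg_left ?_ (pow_nonneg (weight_pos k).le _)
        exact (pow_le_pow_left₀ (norm_nonneg _) (norm_add_le (c k) (c' k)) 2).trans add_sq_le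
    _ = _ := by ring

lemma const_mul (h : MemH s c) (a : ℂ) : MemH s fun k => a * c k :=
  h.of_le (C := ‖a‖) fun k => by rw [norm_mul]; exact le_of_eq (by ring)

lemma sub (h : MemH s c) (h' : MemH s c') : MemH s fun k => c k - c' k := by
  simpa [sub_eq_add_neg] using h.add (h'.const_mul (-1))

lemma sum {ι : Type*} (S : Finset ι) {c : ι → (Fin d → ℤ) → ℂ} (h : ∀ j ∈ S, MemH s (c j)) :
    MemH s fun k => ∑ j ∈ S, c j k := by
  classical
  induction S using Finset.induction_on with
  | empty => simp [MemH, summable_zero]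
  | insert a S ha ih =>
    simp only [Finset.sum_insert ha]
    exact (h a (Finset.mem_insert_self a S)).add
      (ih fun j hj => h j (Finset.mem_insert_of_mem hj))

lemma summable_and_tsum_le {n : ℕ} (h : MemH s c) (hs : 2 * n + d < 2 * s) :
    Summable (fun k => weight k ^ n * ‖c k‖) ∧
      ∑' k, weight k ^ n * ‖c k‖ ≤ embConst d s n * √(sqNormH s c) := by
  have hweight (k : Fin d → ℤ) :
      ((weight k)⁻¹ ^ (s - n)) ^ 2 = (weight k)⁻¹ ^ (2 * s - 2 * n) := by
    rw [← pow_mul, Nat.mul_comm, Nat.mul_sub]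
  have hterm (k : Fin d → ℤ) : (weight k ^ s * ‖c k‖) ^ 2 = weight k ^ (2 * s) * ‖c k‖ ^ 2 := by
    ring
  have hprod (k : Fin d → ℤ) :
      (weight k)⁻¹ ^ (s - n) * (weight k ^ s * ‖c k‖) = weight k ^ n * ‖c k‖ := by
    have hsplit : weight k ^ s = weight k ^ (s - n) * weight k ^ n := by
      rw [← pow_add, Nat.sub_add_cancel (by omega)]
    rw [hsplit, inv_pow, ← mul_assoc,
      inv_mul_cancel_left₀ (pow_ne_zero _ (weight_pos k).ne')]
  have hcs := summable_mul_and_tsum_mul_le_sqrt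
    (a := fun k : Fin d → ℤ => (weight k)⁻¹ ^ (s - n)) (b := fun k => weight k ^ s * ‖c k‖)
    (fun k => pow_nonneg (inv_nonneg.2 (weight_pos k).le) _)
    (fun k => weight_pow_mul_nonneg k _ (norm_nonneg _))
    (by simpa only [hweight] using summable_inv_weight_pow (by omega))
    (by simpa only [hterm] using! h)
  simpa only [hweight, hterm, hprod] using! hcs

lemma summable_norm_and_tsum_le (h : MemH s c) (hs : d < 2 * s) :
    Summable (fun k => ‖c k‖) ∧ ∑' k, ‖c k‖ ≤ embConst d s 0 * √(sqNormH s c) := by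
  simpa using h.summable_and_tsum_le (n := 0) (by omega)

end MemH

/-! ### Parseval's identity and regularity -/

lemma hasSum_conj_coeff_mul {f g : Torus d → ℝ} (hf : MemLp f 2 (volume : Measure (Torus d)))
    (hg : MemLp g 2 (volume : Measure (Torus d))) :
    HasSum (fun k => starRingEnd ℂ (coeff f k) * coeff g k) ((∫ x, f x * g x : ℝ) : ℂ) := by
  rw [coeff_eq_mFourierCoeff, coeff_eq_mFourierCoeff, ← integral_complex_ofReal]
  rw [volume_eq_pi_haar] at hf hg ⊢
  have hF : MemLp (fun x => (f x : ℂ)) 2 (Measure.pi fun _ => AddCircle.haarAddCircle) := hf.ofReal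
  have hG : MemLp (fun x => (g x : ℂ)) 2 (Measure.pi fun _ => AddCircle.haarAddCircle) := hg.ofReal
  convert! hasSum_prod_mFourierCoeff hF.toLp hG.toLp using 1
  · funext k
    congr 1
    · exact congrArg _ (integral_congr_ae (by filter_upwards [hF.coeFn_toLp] with x hx; rw [hx]))
    · exact integral_congr_ae (by filter_upwards [hG.coeFn_toLp] with x hx; rw [hx])
  · refine integral_congr_ae ?_
    filter_upwards [hF.coeFn_toLp, hG.coeFn_toLp] with x hx hx'
    rw [hx, hx', Complex.conj_ofReal, Complex.ofReal_mul]

lemma hasSum_sq_norm_coeff {f : Torus d → ℝ} (hf : MemLp f 2 (volume : Measure (Torus d))) :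
    HasSum (fun k => ‖coeff f k‖ ^ 2) (∫ x, f x ^ 2) := by
  simpa only [← Complex.normSq_eq_conj_mul_self, Complex.ofReal_re, Complex.normSq_eq_norm_sq,
    ← pow_two] using Complex.hasSum_re (hasSum_conj_coeff_mul hf hf)

lemma hasSum_sq_norm_coeff_Lp (a : Lp ℝ 2 (volume : Measure (Torus d))) :
    HasSum (fun k => ‖coeff a k‖ ^ 2) (‖a‖ ^ 2) := by
  convert hasSum_sq_norm_coeff (Lp.memLp a) using 1
  rw [← real_inner_self_eq_norm_sq, L2.inner_def]
  exact integral_congr_ae (.of_forall fun x => by simp [pow_two])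

lemma ae_eq_of_coeff_eq {f g : Torus d → ℝ} (hf : MemLp f 2 (volume : Measure (Torus d)))
    (hg : MemLp g 2 (volume : Measure (Torus d))) (h : coeff f = coeff g) :
    f =ᵐ[volume] g := by
  have hzero (k : Fin d → ℤ) : coeff (fun x => f x - g x) k = 0 := by
    rw [coeff_sub (hf.integrable one_le_two) (hg.integrable one_le_two), h, sub_self]
  have hsum := hasSum_sq_norm_coeff (hf.sub hg)
  simp only [Pi.sub_apply, Pi.sub_def, hzero, norm_zero, ne_eq, OfNat.ofNat_ne_zero,
    not_false_eq_true, zero_pow] at hsum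
  have hsq := (integral_eq_zero_iff_of_nonneg (fun x => sq_nonneg (f x - g x))
    (hf.sub hg).integrable_sq).1 (hsum.unique hasSum_zero)
  filter_upwards [hsq] with x hx
  simpa [sub_eq_zero] using hx

lemma eq_of_coeff_eq {f g : Torus d → ℝ} (hf : Continuous f) (hg : Continuous g)
    (h : coeff f = coeff g) : f = g :=
  (Continuous.ae_eq_iff_eq (volume : Measure (Torus d)) hf hg).1
    (ae_eq_of_coeff_eq (memLp_of_continuous hf 2) (memLp_of_continuous hg 2) h)

lemma hasSum_coeff_mul_mFourier {f : Torus d → ℝ} (hf : Continuous f)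
    (hs : Summable fun k => ‖coeff f k‖) (x : Torus d) :
    HasSum (fun k => coeff f k * mFourier k x) (f x : ℂ) := by
  rw [coeff_eq_mFourierCoeff] at hs ⊢
  exact hasSum_mFourier_series_apply_of_summable
    (f := ⟨fun x => (f x : ℂ), Complex.continuous_ofReal.comp hf⟩) hs.of_norm x

lemma abs_le_tsum_norm_coeff {f : Torus d → ℝ} (hf : Continuous f)
    (hs : Summable fun k => ‖coeff f k‖) (x : Torus d) : |f x| ≤ ∑' k, ‖coeff f k‖ := by
  have hnorm (k : Fin d → ℤ) : ‖coeff f k * mFourier k x‖ = ‖coeff f k‖ := by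
    rw [norm_mul, norm_mFourier_apply, mul_one]
  rw [← Real.norm_eq_abs, ← Complex.norm_real, ← (hasSum_coeff_mul_mFourier hf hs x).tsum_eq]
  simpa only [hnorm] using norm_tsum_le_tsum_norm
    (f := fun k => coeff f k * mFourier k x) (by simpa only [hnorm] using hs)

lemma norm_phase_le (k : Fin d → ℤ) : ‖phase k‖ ≤ 2 * π * d * weight k := by
  have hw := weight_pos k
  refine ContinuousLinearMap.opNorm_le_bound _ (by positivity) fun y => ?_
  rw [phase_apply, norm_mul, Real.norm_of_nonneg (by positivity)]
  calc 2 * π * ‖∑ i, (k i : ℝ) * y i‖ ≤ 2 * π * ∑ _i : Fin d, weight k * ‖y‖ := by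
        gcongr
        refine norm_sum_le_of_le _ fun i _ => ?_
        rw [norm_mul]
        exact mul_le_mul (abs_le_weight k i) (norm_le_pi_norm y i) (norm_nonneg _) hw.le
    _ = 2 * π * d * weight k * ‖y‖ := by
        rw [Fin.sum_const, nsmul_eq_mul]
        ring

lemma iteratedDeriv_exp_mul_I (n : ℕ) :
    iteratedDeriv n (fun t : ℝ => Complex.exp (t * I)) =
      fun t : ℝ => I ^ n * Complex.exp (t * I) := by
  induction n with
  | zero => simp
  | succ n ih =>
    rw [iteratedDeriv_succ, ih]
    funext t
    have h : HasDerivAt (fun t : ℝ => I ^ n * Complex.exp (t * I))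
        (I ^ n * (Complex.exp (t * I) * (1 * I))) t :=
      ((hasDerivAt_id t).ofReal_comp.mul_const I).cexp.const_mul _
    rw [h.deriv]
    ring

lemma norm_iteratedFDeriv_mFourier_le (k : Fin d → ℤ) (n : ℕ) (y : Fin d → ℝ) :
    ‖iteratedFDeriv ℝ n (fun y : Fin d → ℝ => mFourier k (proj y)) y‖ ≤
      (2 * π * d * weight k) ^ n := by
  have hcomp : (fun y : Fin d → ℝ => mFourier k (proj y)) =
      (fun t : ℝ => Complex.exp (t * I)) ∘ phase k :=
    funext (mFourier_proj k)
  have hexp : ContDiff ℝ n fun t : ℝ => Complex.exp (t * I) :=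
    (Complex.ofRealCLM.contDiff.mul contDiff_const).cexp
  rw [hcomp, ContinuousLinearMap.iteratedFDeriv_comp_right _ hexp _ le_rfl]
  refine (ContinuousMultilinearMap.norm_compContinuousLinearMap_le _ _).trans ?_
  rw [norm_iteratedFDeriv_eq_norm_iteratedDeriv, iteratedDeriv_exp_mul_I, norm_mul, norm_pow,
    Complex.norm_I, one_pow, one_mul, Complex.norm_exp_ofReal_mul_I, one_mul, Finset.prod_const,
    Finset.card_univ, Fintype.card_fin]
  exact pow_le_pow_left₀ (norm_nonneg _) (norm_phase_le k) n

lemma isContDiff_of_summable {f : Torus d → ℝ} (hf : Continuous f) {n : ℕ}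
    (hs : Summable fun k => weight k ^ n * ‖coeff f k‖) : IsContDiff n f := by
  have hs₀ : Summable fun k => ‖coeff f k‖ :=
    hs.of_nonneg_of_le (fun k => norm_nonneg _) fun k =>
      le_mul_of_one_le_left (norm_nonneg _) (one_le_pow₀ (one_le_weight k))
  have hseries (y : Fin d → ℝ) : f (proj y) = (∑' k, coeff f k * mFourier k (proj y)).re := by
    rw [(hasSum_coeff_mul_mFourier hf hs₀ (proj y)).tsum_eq, Complex.ofReal_re]
  unfold IsContDiff
  simp only [hseries]
  refine Complex.reCLM.contDiff.comp (contDiff_tsum (N := (n : ℕ∞))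
    (v := fun j k => (2 * π * d) ^ j * (weight k ^ n * ‖coeff f k‖))
    (fun k => contDiff_const.mul (contDiff_mFourier_proj k _)) (fun j _ => hs.mul_left _) ?_)
  intro j k y hj
  have hsmul : (fun y : Fin d → ℝ => coeff f k * mFourier k (proj y)) =
      coeff f k • fun y : Fin d → ℝ => mFourier k (proj y) := rfl
  rw [hsmul, iteratedFDeriv_const_smul_apply (contDiff_mFourier_proj k j).contDiffAt, norm_smul]
  calc ‖coeff f k‖ * ‖iteratedFDeriv ℝ j (fun y : Fin d → ℝ => mFourier k (proj y)) y‖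
      ≤ ‖coeff f k‖ * (2 * π * d * weight k) ^ j := by
        gcongr
        exact norm_iteratedFDeriv_mFourier_le k j y
    _ = (2 * π * d) ^ j * (weight k ^ j * ‖coeff f k‖) := by rw [mul_pow]; ring
    _ ≤ _ := by
        gcongr
        · exact one_le_weight k
        · exact_mod_cast hj

lemma IsContDiff.memH {n : ℕ} {f : Torus d → ℝ} (hf : IsContDiff n f) : MemH n (coeff f) := by
  have hderiv (i : Fin d) : Summable fun k => ‖symbol k i ^ n * coeff f k‖ ^ 2 := by
    have hc : Continuous ((RegMFG.pd i)^[n] f) :=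
      (IsContDiff.pd_iterate (n := 0) (j := n) (by rwa [zero_add]) i).continuous
    simpa only [coeff_pd_iterate hf i] using
      (hasSum_sq_norm_coeff (memLp_of_continuous hc 2)).summable
  have hf₂ := (hasSum_sq_norm_coeff (memLp_of_continuous hf.continuous 2)).summable
  exact Summable.of_nonneg_of_le (fun k => weight_pow_mul_nonneg k _ (sq_nonneg _))
    (fun k => weight_pow_mul_sq_norm_le k n _)
    ((hf₂.add (summable_sum fun i _ => hderiv i)).mul_left _)

/-! ### Sobolev spaces in terms of Fourier coefficients -/

/-- The symbol `(2πik)^α` of `∂^α`. -/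
def symbolMulti {κ : ℕ} (α : MultiIdx d κ) (k : Fin d → ℤ) : ℂ := ∏ i, symbol k i ^ (α.1 i : ℕ)

/-- The multi-index `κ e_i`. -/
def MultiIdx.single (d κ : ℕ) (i : Fin d) : MultiIdx d κ :=
  ⟨Pi.single i (Fin.last κ), by
    rw [Finset.sum_eq_single i (fun j _ hj => by simp [hj]) (by simp)]
    simp⟩

section symbolMulti

variable {κ : ℕ} (α : MultiIdx d κ) (k : Fin d → ℤ)

lemma symbolMulti_zero : symbolMulti (MultiIdx.zero d κ) k = 1 := by
  simp [symbolMulti, MultiIdx.zero]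

lemma symbolMulti_single (i : Fin d) : symbolMulti (MultiIdx.single d κ i) k = symbol k i ^ κ := by
  unfold symbolMulti MultiIdx.single
  rw [Finset.prod_eq_single i (fun j _ hj => by simp [hj]) (by simp)]
  simp

lemma symbolMulti_neg : symbolMulti α (-k) = (-1) ^ α.len * symbolMulti α k := by
  unfold symbolMulti MultiIdx.len
  rw [← Finset.prod_pow_eq_pow_sum, ← Finset.prod_mul_distrib]
  exact Finset.prod_congr rfl fun i _ => by rw [symbol_neg, ← mul_pow, neg_one_mul]

lemma conj_symbolMulti : starRingEnd ℂ (symbolMulti α k) = (-1) ^ α.len * symbolMulti α k := by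
  rw [← symbolMulti_neg]
  simp only [symbolMulti, map_prod, map_pow, conj_symbol, symbol_neg]

lemma norm_symbolMulti_le : ‖symbolMulti α k‖ ≤ (2 * π * weight k) ^ κ := by
  have hone : 1 ≤ 2 * π * weight k := by
    nlinarith [one_le_weight k, Real.pi_gt_three]
  rw [symbolMulti, norm_prod]
  calc ∏ i, ‖symbol k i ^ (α.1 i : ℕ)‖ ≤ ∏ i, (2 * π * weight k) ^ (α.1 i : ℕ) := by
        refine Finset.prod_le_prod (fun i _ => norm_nonneg _) fun i _ => ?_
        rw [norm_pow]
        exact pow_le_pow_left₀ (norm_nonneg _) (norm_symbol_le k i) _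
    _ = (2 * π * weight k) ^ (∑ i, (α.1 i : ℕ)) := Finset.prod_pow_eq_pow_sum _ _ _
    _ ≤ _ := pow_le_pow_right₀ hone α.2

lemma pdMulti_trig (c : ℂ) : pdMulti α (trig c k) = trig (symbolMulti α k * c) k := by
  have hfold (l : List (Fin d)) : l.foldr (fun i ψ => (pd i)^[(α.1 i : ℕ)] ψ) (trig c k) =
      trig ((l.map fun i => symbol k i ^ (α.1 i : ℕ)).prod * c) k := by
    induction l with
    | nil => simp
    | cons i l ih =>
      rw [List.foldr_cons, ih, pd_iterate_trig, List.map_cons, List.prod_cons, mul_assoc]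
  rw [pdMulti, hfold, symbolMulti, Fin.prod_univ_def]

lemma coeff_pdMulti {f : Torus d → ℝ} (hf : IsSmooth f) :
    coeff (pdMulti α f) k = symbolMulti α k * coeff f k := by
  have hfold (l : List (Fin d)) : IsSmooth (l.foldr (fun i ψ => (pd i)^[(α.1 i : ℕ)] ψ) f) ∧
      coeff (l.foldr (fun i ψ => (pd i)^[(α.1 i : ℕ)] ψ) f) k =
        (l.map fun i => symbol k i ^ (α.1 i : ℕ)).prod * coeff f k := by
    induction l with
    | nil => exact ⟨hf, by simp⟩
    | cons i l ih =>
      refine ⟨ih.1.pd_iterate i _, ?_⟩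
      rw [List.foldr_cons, coeff_pd_iterate (ih.1.isContDiff _), ih.2, List.map_cons,
        List.prod_cons, mul_assoc]
  rw [pdMulti, (hfold _).2, symbolMulti, Fin.prod_univ_def]

lemma sq_norm_symbolMulti_mul_le (z : ℂ) :
    ‖symbolMulti α k * z‖ ^ 2 ≤ (2 * π) ^ (2 * κ) * (weight k ^ (2 * κ) * ‖z‖ ^ 2) := by
  calc ‖symbolMulti α k * z‖ ^ 2 ≤ ((2 * π * weight k) ^ κ * ‖z‖) ^ 2 := by
        rw [norm_mul]
        gcongr
        exact norm_symbolMulti_le α k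
    _ = _ := by ring

end symbolMulti

section Sobolev

variable {κ : ℕ}

lemma coeff_sobolev (G : Sobolev d κ) (α : MultiIdx d κ) (k : Fin d → ℤ) :
    coeff (G.1 α) k = symbolMulti α k * coeff (sobFn G) k := by
  have hinteg (β : MultiIdx d κ) : Integrable (G.1 β) (volume : Measure (Torus d)) :=
    (Lp.memLp (G.1 β)).integrable one_le_two
  refine eq_of_forall_re_mul_eq fun c => ?_
  have htest := G.2 α (trig c (-k)) (isSmooth_trig c _)
  have hsign : (-1 : ℂ) ^ α.len * symbolMulti α k * c * coeff (sobFn G) k =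
      (((-1 : ℝ) ^ α.len : ℝ) : ℂ) * (c * (symbolMulti α k * coeff (sobFn G) k)) := by
    push_cast
    ring
  rw [pdMulti_trig, integral_mul_trig (hinteg _), integral_mul_trig (hinteg _),
    symbolMulti_neg] at htest
  change ((-1 : ℂ) ^ α.len * symbolMulti α k * c * coeff (sobFn G) k).re = _ at htest
  rw [hsign, Complex.re_ofReal_mul] at htest
  exact (mul_left_cancel₀ (pow_ne_zero _ (by norm_num)) htest).symm

lemma sobolev_memH_and_sqNormH_le (G : Sobolev d κ) :
    MemH κ (coeff (sobFn G)) ∧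
      sqNormH κ (coeff (sobFn G)) ≤ 2 ^ (2 * κ) * (1 + d) * ‖G‖ ^ 2 := by
  have hsingle (i : Fin d) : HasSum (fun k => ‖symbol k i ^ κ * coeff (sobFn G) k‖ ^ 2)
      (‖G.1 (MultiIdx.single d κ i)‖ ^ 2) := by
    simpa only [coeff_sobolev, symbolMulti_single] using
      hasSum_sq_norm_coeff_Lp (G.1 (MultiIdx.single d κ i))
  have hsum := ((hasSum_sq_norm_coeff_Lp (G.1 (MultiIdx.zero d κ))).add
    (hasSum_sum (s := Finset.univ) fun i _ => hsingle i)).mul_left (2 ^ (2 * κ))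
  have hle (k : Fin d → ℤ) := weight_pow_mul_sq_norm_le k κ (coeff (sobFn G) k)
  have hmem : MemH κ (coeff (sobFn G)) :=
    Summable.of_nonneg_of_le (fun k => weight_pow_mul_nonneg k _ (sq_nonneg _)) hle hsum.summable
  have hnorm (α : MultiIdx d κ) : ‖G.1 α‖ ≤ ‖G‖ := PiLp.norm_apply_le G.1 α
  refine ⟨hmem, (hasSum_le hle hmem.hasSum hsum).trans ?_⟩
  rw [mul_assoc]
  gcongr
  calc ‖G.1 (MultiIdx.zero d κ)‖ ^ 2 + ∑ i : Fin d, ‖G.1 (MultiIdx.single d κ i)‖ ^ 2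
      ≤ ‖G‖ ^ 2 + ∑ _i : Fin d, ‖G‖ ^ 2 := by gcongr <;> exact hnorm _
    _ = (1 + d) * ‖G‖ ^ 2 := by
        rw [Fin.sum_const, nsmul_eq_mul]
        ring

/-- The constant of the Sobolev embedding `W^{κ,2} ⊂ C⁰`. -/
def sobConst (d κ : ℕ) : ℝ := embConst d κ 0 * √(2 ^ (2 * κ) * (1 + d))

lemma abs_le_sobConst_mul_norm (hκ : d < 2 * κ) (G : Sobolev d κ) {f : Torus d → ℝ}
    (hf : Continuous f) (hG : sobFn G =ᵐ[volume] f) (x : Torus d) :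
    |f x| ≤ sobConst d κ * ‖G‖ := by
  have hcoeff : coeff (sobFn G) = coeff f := funext (coeff_congr hG)
  obtain ⟨hmem, hle⟩ := sobolev_memH_and_sqNormH_le G
  rw [hcoeff] at hmem hle
  obtain ⟨hs, htsum⟩ := hmem.summable_norm_and_tsum_le hκ
  calc |f x| ≤ ∑' k, ‖coeff f k‖ := abs_le_tsum_norm_coeff hf hs x
    _ ≤ embConst d κ 0 * √(sqNormH κ (coeff f)) := htsum
    _ ≤ embConst d κ 0 * √(2 ^ (2 * κ) * (1 + d) * ‖G‖ ^ 2) := by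
        gcongr
        exact Real.sqrt_nonneg _
    _ = _ := by
        rw [Real.sqrt_mul (by positivity), Real.sqrt_sq (norm_nonneg _), sobConst, mul_assoc]

lemma sobFn_add (G G' : Sobolev d κ) : sobFn (G + G') =ᵐ[volume] fun x => sobFn G x + sobFn G' x :=
  Lp.coeFn_add _ _

lemma sobFn_sub (G G' : Sobolev d κ) : sobFn (G - G') =ᵐ[volume] fun x => sobFn G x - sobFn G' x :=
  Lp.coeFn_sub _ _

lemma sobFn_smul (c : ℝ) (G : Sobolev d κ) : sobFn (c • G) =ᵐ[volume] fun x => c * sobFn G x :=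
  Lp.coeFn_smul _ _

lemma sobFn_zero : sobFn (0 : Sobolev d κ) =ᵐ[volume] fun _ => 0 :=
  Lp.coeFn_zero _ _ _

lemma sobFn_sum {ι : Type*} (s : Finset ι) (G : ι → Sobolev d κ) :
    sobFn (∑ j ∈ s, G j) =ᵐ[volume] fun x => ∑ j ∈ s, sobFn (G j) x := by
  classical
  induction s using Finset.induction_on with
  | empty => simpa using sobFn_zero
  | insert a s ha ih =>
    rw [Finset.sum_insert ha]
    filter_upwards [sobFn_add (G a) (∑ j ∈ s, G j), ih] with x hadd hsum
    rw [hadd, hsum, Finset.sum_insert ha]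

end Sobolev

lemma coeff_neg (f : Torus d → ℝ) (k : Fin d → ℤ) :
    coeff f (-k) = starRingEnd ℂ (coeff f k) := by
  rw [coeff, coeff, ← integral_conj]
  exact integral_congr_ae (.of_forall fun x => by simp [mFourier_neg])

lemma coeff_re {F : Torus d → ℂ} (hF : Integrable F (volume : Measure (Torus d)))
    (k : Fin d → ℤ) :
    coeff (fun x => (F x).re) k =
      ((∫ x, mFourier (-k) x * F x) + starRingEnd ℂ (∫ x, mFourier k x * F x)) / 2 := by
  have hinteg (k : Fin d → ℤ) : Integrable (fun x => mFourier k x * F x) volume :=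
    hF.bdd_mul (c := 1) (mFourier k).continuous.aestronglyMeasurable
      (.of_forall fun x => (norm_mFourier_apply k x).le)
  have hinteg' : Integrable (fun x => starRingEnd ℂ (mFourier k x * F x)) volume :=
    Complex.conjLIE.integrable_comp_iff.2 (hinteg k)
  rw [← integral_conj, ← integral_add (hinteg _) hinteg', ← integral_div, coeff]
  refine integral_congr_ae (.of_forall fun x => ?_)
  simp only [map_mul, mFourier_neg, Complex.re_eq_add_conj]
  ring

lemma exists_Lp_coeff_eq {c : (Fin d → ℤ) → ℂ} (hc : Summable fun k => ‖c k‖ ^ 2)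
    (hconj : ∀ k, c (-k) = starRingEnd ℂ (c k)) :
    ∃ a : Lp ℝ 2 (volume : Measure (Torus d)), coeff a = c := by
  have hmem : Memℓp c 2 := memℓp_gen (by simpa using hc)
  let A := (mFourierBasis (d := Fin d)).repr.symm ⟨c, hmem⟩
  have hA : MemLp A 2 (volume : Measure (Torus d)) := volume_eq_pi_haar (d := d) ▸ Lp.memLp A
  have hcoeff (k : Fin d → ℤ) : ∫ x, mFourier (-k) x * A x = c k := by
    have h : mFourierCoeff A k = c k := by rw [← mFourierBasis_repr]; simp [A]
    rw [← h, volume_eq_pi_haar]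
    rfl
  refine ⟨hA.re.toLp _, funext fun k => ?_⟩
  have hneg := hcoeff (-k)
  rw [neg_neg] at hneg
  rw [coeff_congr hA.re.coeFn_toLp]
  refine (coeff_re (hA.integrable one_le_two) k).trans ?_
  rw [hcoeff, hneg, hconj, Complex.conj_conj]
  ring

/-- The constant of the embedding of the functions with Fourier coefficients in `H^κ` into
`W^{κ,2}`. -/
def coeffConst (d κ : ℕ) : ℝ := Fintype.card (MultiIdx d κ) * (2 * π) ^ (2 * κ)

lemma integral_mul_pdMulti {κ : ℕ} (α : MultiIdx d κ) {f g φ : Torus d → ℝ}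
    (hf : MemLp f 2 (volume : Measure (Torus d))) (hg : MemLp g 2 (volume : Measure (Torus d)))
    (hfg : ∀ k, coeff g k = symbolMulti α k * coeff f k) (hφ : IsSmooth φ) :
    ∫ x, f x * pdMulti α φ x = (-1) ^ α.len * ∫ x, g x * φ x := by
  have hleft := hasSum_conj_coeff_mul hf ((hφ.pdMulti α).memLp 2)
  have hright := (hasSum_conj_coeff_mul hg (hφ.memLp 2)).mul_left ((-1 : ℂ) ^ α.len)
  have heq := hleft.unique <| hright.congr_fun fun k => by
    have hsign : (-1 : ℂ) ^ α.len * (-1) ^ α.len = 1 := by rw [← mul_pow]; norm_num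
    rw [hfg, coeff_pdMulti α k hφ, map_mul, conj_symbolMulti]
    linear_combination
      -(symbolMulti α k * starRingEnd ℂ (coeff f k) * coeff φ k) * hsign
  exact_mod_cast heq

lemma exists_sobolev {κ : ℕ} {f : Torus d → ℝ} (hf : Continuous f) (h : MemH κ (coeff f)) :
    ∃ G : Sobolev d κ, sobFn G =ᵐ[volume] f ∧ ‖G‖ ^ 2 ≤ coeffConst d κ * sqNormH κ (coeff f) := by
  have hle (α : MultiIdx d κ) (k : Fin d → ℤ) := sq_norm_symbolMulti_mul_le α k (coeff f k)
  have hsummable (α : MultiIdx d κ) : Summable fun k => ‖symbolMulti α k * coeff f k‖ ^ 2 :=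
    Summable.of_nonneg_of_le (fun k => sq_nonneg _) (hle α) (h.mul_left _)
  choose a ha using fun α => exists_Lp_coeff_eq (hsummable α) fun k => by
    rw [symbolMulti_neg, coeff_neg, map_mul, conj_symbolMulti]
  have hzero : a (MultiIdx.zero d κ) =ᵐ[volume] f :=
    ae_eq_of_coeff_eq (Lp.memLp _) (memLp_of_continuous hf 2) <| by
      simp only [ha, symbolMulti_zero, one_mul]
  have hnorm (α : MultiIdx d κ) : ‖a α‖ ^ 2 ≤ (2 * π) ^ (2 * κ) * sqNormH κ (coeff f) := by
    have hsum := hasSum_sq_norm_coeff_Lp (a α)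
    rw [ha] at hsum
    exact hasSum_le (hle α) hsum (h.hasSum.mul_left _)
  refine ⟨⟨WithLp.toLp 2 a, fun α φ hφ => ?_⟩, hzero, ?_⟩
  · refine integral_mul_pdMulti α (Lp.memLp _) (Lp.memLp _) (fun k => ?_) hφ
    simp only [ha, symbolMulti_zero, one_mul]
  · change ‖WithLp.toLp 2 a‖ ^ 2 ≤ _
    rw [PiLp.norm_sq_eq_of_L2]
    calc ∑ α, ‖a α‖ ^ 2 ≤ ∑ _α : MultiIdx d κ, (2 * π) ^ (2 * κ) * sqNormH κ (coeff f) :=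
          Finset.sum_le_sum fun α _ => hnorm α
      _ = _ := by simp [coeffConst, mul_assoc]

/-! ### The nonlocal operator -/

open Classical in
lemma bold_val (m : Torus d → ℝ) : (bold m).val =
    if Integrable m volume then volume.withDensity fun x => ENNReal.ofReal (m x) else 0 := by
  by_cases hm : Integrable m volume
  · exact (congrArg Subtype.val (dif_pos hm)).trans (if_pos hm).symm
  · exact (congrArg Subtype.val (dif_neg hm)).trans (if_neg hm).symm

lemma bold_congr {m m' : Torus d → ℝ} (hm : m =ᵐ[volume] m') : bold m = bold m' := by
  have hdens : volume.withDensity (fun x => ENNReal.ofReal (m x)) =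
      volume.withDensity fun x => ENNReal.ofReal (m' x) :=
    withDensity_congr_ae (hm.fun_comp ENNReal.ofReal)
  exact Subtype.ext (by rw [bold_val, bold_val, hdens, integrable_congr hm])

/-- The cone of the nonnegative elements of `W^{κ,2}`, on which assumption (h) is imposed. -/
def nonnegCone (d κ : ℕ) : Set (Sobolev d κ) := {M | 0 ≤ᵐ[volume] sobFn M}

lemma mem_nonnegCone {κ : ℕ} {m : Torus d → ℝ} {M : Sobolev d κ} (hM : sobFn M =ᵐ[volume] m)
    (hm : ∀ x, 0 ≤ m x) : M ∈ nonnegCone d κ := by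
  change 0 ≤ᵐ[volume] sobFn M
  filter_upwards [hM] with x hx
  rw [hx]
  exact hm x

/-- `F` represents the restriction of `m ↦ h(𝐦)` to the nonnegative elements of `W^{κ,2}`. -/
def IsLift {κ : ℕ} (h : Mac d → C(Torus d, ℝ)) (F : Sobolev d κ → Sobolev d κ) : Prop :=
  ∀ M ∈ nonnegCone d κ, sobFn (F M) =ᵐ[volume] h (bold (sobFn M))

section Nonlocal

variable {h : Mac d → C(Torus d, ℝ)}

lemma AssumptionH.exists_lift (hh : AssumptionH h) {κ : ℕ} (hκ : d + 2 < 2 * κ) :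
    ∃ F : Sobolev d κ → Sobolev d κ, IsLift h F ∧ DifferentiableOn ℝ F (nonnegCone d κ) := by
  refine hh κ ?_
  have hκ' : (d : ℝ) + 2 < 2 * κ := by exact_mod_cast hκ
  linarith

lemma IsLift.ae_eq {κ : ℕ} {F : Sobolev d κ → Sobolev d κ} (hF : IsLift h F) {m : Torus d → ℝ}
    (hm : ∀ x, 0 ≤ m x) {M : Sobolev d κ} (hM : sobFn M =ᵐ[volume] m) :
    sobFn (F M) =ᵐ[volume] h (bold m) := by
  rw [← bold_congr hM]
  exact hF M (mem_nonnegCone hM hm)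

lemma IsLift.abs_sub_le {κ : ℕ} (hκ : d < 2 * κ) {F : Sobolev d κ → Sobolev d κ}
    (hF : IsLift h F) {m m' : Torus d → ℝ} (hm : ∀ x, 0 ≤ m x) (hm' : ∀ x, 0 ≤ m' x)
    {M M' : Sobolev d κ} (hM : sobFn M =ᵐ[volume] m) (hM' : sobFn M' =ᵐ[volume] m')
    (x : Torus d) :
    |h (bold m') x - h (bold m) x| ≤ sobConst d κ * ‖F M' - F M‖ := by
  refine abs_le_sobConst_mul_norm hκ (F M' - F M) (f := fun x => h (bold m') x - h (bold m) x)
    ((map_continuous _).sub (map_continuous _)) ?_ x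
  filter_upwards [sobFn_sub (F M') (F M), hF.ae_eq hm hM, hF.ae_eq hm' hM'] with x hsub hFM hFM'
  rw [hsub, hFM, hFM']

lemma memH_nonlocal (hh : AssumptionH h) {κ : ℕ} (hκ : d + 2 < 2 * κ) {m : Torus d → ℝ}
    (hc : Continuous m) (hm : ∀ x, 0 ≤ m x) (hmem : MemH κ (coeff m)) :
    MemH κ (coeff (h (bold m))) := by
  obtain ⟨F, hF, -⟩ := hh.exists_lift hκ
  obtain ⟨M, hM, -⟩ := exists_sobolev hc hmem
  rw [← funext (coeff_congr (hF.ae_eq hm hM))]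
  exact (sobolev_memH_and_sqNormH_le (F M)).1

lemma IsSmooth.memH {f : Torus d → ℝ} (hf : IsSmooth f) (s : ℕ) : MemH s (coeff f) :=
  (hf.isContDiff s).memH

lemma MemH.isContDiff {f : Torus d → ℝ} {s n : ℕ} (h : MemH s (coeff f)) (hf : Continuous f)
    (hs : 2 * n + d < 2 * s) : IsContDiff n f :=
  isContDiff_of_summable hf (h.summable_and_tsum_le hs).1

lemma isSmooth_of_forall_memH {f : Torus d → ℝ} (hf : Continuous f) {s₀ : ℕ}
    (h : ∀ s, s₀ ≤ s → MemH s (coeff f)) : IsSmooth f :=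
  isSmooth_of_forall_isContDiff fun n =>
    (h (s₀ + n + d + 1) (by omega)).isContDiff hf (by omega)

lemma isSmooth_nonlocal (hh : AssumptionH h) {m : Torus d → ℝ} (hs : IsSmooth m)
    (hm : ∀ x, 0 ≤ m x) : IsSmooth (h (bold m)) :=
  isSmooth_of_forall_memH (map_continuous _) (s₀ := d + 2) fun s _ =>
    memH_nonlocal hh (by omega) hs.continuous hm (hs.memH s)

lemma exists_tendsto_sobolev {κ : ℕ} {m : Torus d → ℝ} (hc : Continuous m)
    (hmem : MemH κ (coeff m)) {mn : ℕ → Torus d → ℝ} (hcn : ∀ n, Continuous (mn n))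
    (hmemn : ∀ n, MemH κ (coeff (mn n)))
    (hlim : Tendsto (fun n => sqNormH κ (coeff fun x => mn n x - m x)) atTop (𝓝 0)) :
    ∃ (M : Sobolev d κ) (Mn : ℕ → Sobolev d κ), sobFn M =ᵐ[volume] m ∧
      (∀ n, sobFn (Mn n) =ᵐ[volume] mn n) ∧ Tendsto Mn atTop (𝓝 M) := by
  obtain ⟨M, hM, -⟩ := exists_sobolev hc hmem
  have hsub (n : ℕ) : MemH κ (coeff fun x => mn n x - m x) := by
    rw [funext (coeff_sub (integrable_of_continuous (hcn n)) (integrable_of_continuous hc))]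
    exact (hmemn n).sub hmem
  choose D hD hnorm using fun n =>
    exists_sobolev (f := fun x => mn n x - m x) ((hcn n).sub hc) (hsub n)
  refine ⟨M, fun n => M + D n, hM, fun n => ?_, ?_⟩
  · filter_upwards [sobFn_add M (D n), hM, hD n] with x hadd hMx hDx
    rw [hadd, hMx, hDx, add_sub_cancel]
  · have hsq : Tendsto (fun n => ‖D n‖ ^ 2) atTop (𝓝 0) :=
      squeeze_zero (fun n => sq_nonneg _) hnorm (by simpa using hlim.const_mul (coeffConst d κ))
    have hD₀ : Tendsto D atTop (𝓝 0) :=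
      tendsto_zero_iff_norm_tendsto_zero.2 (by simpa [Real.sqrt_sq (norm_nonneg _)] using hsq.sqrt)
    simpa using hD₀.const_add M

lemma tendsto_nonlocal (hh : AssumptionH h) {κ : ℕ} (hκ : d + 2 < 2 * κ) {m : Torus d → ℝ}
    (hc : Continuous m) (hm : ∀ x, 0 ≤ m x) (hmem : MemH κ (coeff m)) {mn : ℕ → Torus d → ℝ}
    (hcn : ∀ n, Continuous (mn n)) (hmn : ∀ n x, 0 ≤ mn n x)
    (hmemn : ∀ n, MemH κ (coeff (mn n)))
    (hlim : Tendsto (fun n => sqNormH κ (coeff fun x => mn n x - m x)) atTop (𝓝 0)) :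
    ∃ δ : ℕ → ℝ, Tendsto δ atTop (𝓝 0) ∧
      ∀ n x, |h (bold (mn n)) x - h (bold m) x| ≤ δ n := by
  obtain ⟨F, hF, hdiff⟩ := hh.exists_lift hκ
  obtain ⟨M, Mn, hM, hMn, hMt⟩ := exists_tendsto_sobolev hc hmem hcn hmemn hlim
  have hFt : Tendsto (fun n => F (Mn n)) atTop (𝓝 (F M)) :=
    (hdiff M (mem_nonnegCone hM hm)).continuousWithinAt.tendsto.comp <|
      tendsto_nhdsWithin_iff.2 ⟨hMt, .of_forall fun n => mem_nonnegCone (hMn n) (hmn n)⟩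
  refine ⟨fun n => sobConst d κ * ‖F (Mn n) - F M‖, ?_, fun n x => ?_⟩
  · simpa using (tendsto_iff_norm_sub_tendsto_zero.1 hFt).const_mul (sobConst d κ)
  · exact hF.abs_sub_le (by omega) hm (hmn n) hM (hMn n) x

section FiniteDimensional

variable {V : Type*} [NormedAddCommGroup V] [NormedSpace ℝ V] [FiniteDimensional ℝ V]

lemma exists_sobolev_clm (L : V →ₗ[ℝ] smoothFun d) (κ : ℕ) :
    ∃ M : V →L[ℝ] Sobolev d κ, ∀ v, sobFn (M v) =ᵐ[volume] L v := by
  let b := Module.finBasis ℝ V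
  choose Φ hΦ _ using fun j => exists_sobolev (L (b j)).2.continuous ((L (b j)).2.memH κ)
  refine ⟨(b.constr ℝ Φ).toContinuousLinearMap, fun v => ?_⟩
  have hterm : ∀ᵐ x ∂(volume : Measure (Torus d)), ∀ j,
      sobFn (b.equivFun v j • Φ j) x = b.equivFun v j * L (b j) x := by
    refine ae_all_iff.2 fun j => ?_
    filter_upwards [sobFn_smul (b.equivFun v j) (Φ j), hΦ j] with x hsmul hx
    rw [hsmul, hx]
  have hL : (L v : Torus d → ℝ) = fun x => ∑ j, b.equivFun v j * L (b j) x := by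
    funext x
    conv_lhs => rw [← b.sum_equivFun v, map_sum]
    simp only [map_smul, Submodule.coe_sum, Submodule.coe_smul, Finset.sum_apply, Pi.smul_apply,
      smul_eq_mul]
  filter_upwards [sobFn_sum Finset.univ fun j => b.equivFun v j • Φ j, hterm] with x hsum hx
  rw [hL, LinearMap.coe_toContinuousLinearMap', Module.Basis.constr_apply_fintype, hsum]
  exact Finset.sum_congr rfl fun j _ => hx j

lemma nonlocal_isBigO_sub (hh : AssumptionH h) (L : V →ₗ[ℝ] smoothFun d) {a : V}
    (ha : ∀ x, 0 ≤ L a x) :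
    (fun z : V × Torus d => h (bold (L z.1)) z.2 - h (bold (L a)) z.2)
      =O[𝓝[{b | ∀ x, 0 ≤ L b x}] a ×ˢ ⊤] fun z => z.1 - a := by
  obtain ⟨F, hF, hdiff⟩ := hh.exists_lift (κ := d + 2) (by omega)
  obtain ⟨M, hM⟩ := exists_sobolev_clm L (d + 2)
  set S : Set V := {b | ∀ x, 0 ≤ L b x}
  have hcone {b : V} (hb : b ∈ S) : M b ∈ nonnegCone d (d + 2) := mem_nonnegCone (hM b) hb
  have hM₀ : Tendsto M (𝓝[S] a) (𝓝[nonnegCone d (d + 2)] (M a)) :=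
    M.continuous.continuousWithinAt.tendsto_nhdsWithin fun _ hb => hcone hb
  have hM_sub : (fun b => M b - M a) =O[𝓝[S] a] fun b => b - a := by
    simpa only [map_sub] using M.isBigO_sub (𝓝[S] a) a
  have hF₀ : (fun b => F (M b) - F (M a)) =O[𝓝[S] a] fun b => b - a :=
    ((hdiff (M a) (hcone ha)).hasFDerivWithinAt.isBigO_sub.comp_tendsto hM₀).trans
      hM_sub
  refine .trans (.of_bound (sobConst d (d + 2)) ?_) (hF₀.comp_tendsto tendsto_fst)
  filter_upwards [tendsto_fst.eventually self_mem_nhdsWithin] with z hz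
  exact hF.abs_sub_le (by omega) ha hz (hM a) (hM z.1) z.2

end FiniteDimensional

end Nonlocal

/-! ### Smooth functions of the jet -/

/-- The space of the arguments `(p, M, m, θ)` of a Hamiltonian. -/
abbrev JetSpace (d : ℕ) : Type := Vec d × Mat d × ℝ × ℝ

/-- The jet `(Du, D²u, m, θ)` at a point. -/
def jet (u m θ : Torus d → ℝ) (x : Torus d) : JetSpace d := (grad u x, hess u x, m x, θ x)

/-- The lift of a function of the point and the jet to the universal cover of the torus. -/
def jetLift (Ψ : Torus d → JetSpace d → ℝ) (z : (Fin d → ℝ) × JetSpace d) : ℝ := Ψ (proj z.1) z.2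

/-- `Ψ(x, p, M, m, θ)` is smooth for `m > 0`. -/
def IsJetSmooth (Ψ : Torus d → JetSpace d → ℝ) : Prop :=
  ContDiffOn ℝ ∞ (jetLift Ψ) {z | 0 < z.2.2.2.1}

/-- A Hamiltonian as a function of the point and the jet. -/
def jetHamiltonian (H : Hamiltonian d) (x : Torus d) (z : JetSpace d) : ℝ :=
  H x z.1 z.2.1 z.2.2.1 z.2.2.2

lemma isOpen_jetDomain : IsOpen {z : (Fin d → ℝ) × JetSpace d | 0 < z.2.2.2.1} :=
  isOpen_lt continuous_const (by fun_prop)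

lemma isJetSmooth_hamiltonian {E : Set ℝ} (hE : Set.Ioi 0 ⊆ E) {H : Hamiltonian d}
    (hH : AssumptionH2 E H) : IsJetSmooth (jetHamiltonian H) :=
  ContDiffOn.mono hH fun _ hz => hE hz

lemma isJetSmooth_penalization {ε₁ q : ℝ} {β : ℝ → ℝ} (hβ : IsPenalization ε₁ q β) :
    IsJetSmooth (d := d) fun _ z => β z.2.2.1 :=
  hβ.smooth.comp (ContDiff.contDiffOn (by fun_prop)) fun _ hz => hz

namespace IsJetSmooth

variable {Ψ Ψ' : Torus d → JetSpace d → ℝ}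

lemma add (h : IsJetSmooth Ψ) (h' : IsJetSmooth Ψ') : IsJetSmooth fun x z => Ψ x z + Ψ' x z :=
  ContDiffOn.add h h'

lemma neg (h : IsJetSmooth Ψ) : IsJetSmooth fun x z => -Ψ x z :=
  ContDiffOn.neg h

lemma density_mul (h : IsJetSmooth Ψ) : IsJetSmooth fun x z => z.2.2.1 * Ψ x z :=
  ContDiffOn.mul (ContDiff.contDiffOn (by fun_prop)) h

lemma fderiv_apply (h : IsJetSmooth Ψ) (w : JetSpace d) :
    ContDiffOn ℝ ∞ (fun z => fderiv ℝ (jetLift Ψ) z (0, w)) {z | 0 < z.2.2.2.1} :=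
  (ContDiffOn.fderiv_of_isOpen h isOpen_jetDomain (by simp)).clm_apply contDiffOn_const

lemma fderiv_comp {V : Type*} [NormedAddCommGroup V] [NormedSpace ℝ V] (h : IsJetSmooth Ψ)
    (y : Fin d → ℝ) {j : V → JetSpace d} {j' : V →L[ℝ] JetSpace d} {v : V}
    (hj : HasFDerivAt j j' v) (hpos : 0 < (j v).2.2.1) (w : V) :
    fderiv ℝ (fun v => Ψ (proj y) (j v)) v w = fderiv ℝ (jetLift Ψ) (y, j v) (0, j' w) := by
  have hd : DifferentiableAt ℝ (jetLift Ψ) (y, j v) :=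
    (ContDiffOn.differentiableOn h (by simp)).differentiableAt (isOpen_jetDomain.mem_nhds hpos)
  exact congrArg (· w) (hd.hasFDerivAt.comp v ((hasFDerivAt_const y v).prodMk hj)).fderiv

lemma dpH {H : Hamiltonian d} (hH : IsJetSmooth (jetHamiltonian H)) (i : Fin d) :
    IsJetSmooth (jetHamiltonian (DpH H i)) := by
  refine (hH.fderiv_apply (EuclideanSpace.single i 1, 0, 0, 0)).congr ?_
  rintro ⟨y, p, M, m, θ⟩ hz
  exact hH.fderiv_comp y ((hasFDerivAt_id p).prodMk (hasFDerivAt_const (M, m, θ) p)) hz _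

lemma dMH {H : Hamiltonian d} (hH : IsJetSmooth (jetHamiltonian H)) (i j : Fin d) :
    IsJetSmooth (jetHamiltonian (DMH H i j)) := by
  refine (hH.fderiv_apply (0, Pi.single i (Pi.single j 1), 0, 0)).congr ?_
  rintro ⟨y, p, M, m, θ⟩ hz
  exact hH.fderiv_comp y ((hasFDerivAt_const p M).prodMk
    ((hasFDerivAt_id M).prodMk (hasFDerivAt_const (m, θ) M))) hz _

end IsJetSmooth

lemma exists_mem_Icc_proj_eq (x : Torus d) : ∃ y ∈ Set.Icc (0 : Fin d → ℝ) 1, proj y = x := by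
  obtain ⟨y, rfl⟩ := isQuotientMap_proj.surjective x
  exact ⟨fun i => Int.fract (y i), ⟨fun i => Int.fract_nonneg _, fun i => (Int.fract_lt_one _).le⟩,
    funext fun i => AddCircle.coe_fract (y i)⟩

-- The fundamental cube is convex and compact, so the lift is Lipschitz on the relevant set.
lemma IsJetSmooth.exists_lipschitz {Ψ : Torus d → JetSpace d → ℝ} (h : IsJetSmooth Ψ) {c : ℝ}
    (hc : 0 < c) (R : ℝ) :
    ∃ K : ℝ, 0 ≤ K ∧ ∀ (x : Torus d) (z z' : JetSpace d), ‖z‖ ≤ R → ‖z'‖ ≤ R →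
      c ≤ z.2.2.1 → c ≤ z'.2.2.1 → |Ψ x z - Ψ x z'| ≤ K * ‖z - z'‖ := by
  let S : Set ((Fin d → ℝ) × JetSpace d) :=
    Set.Icc 0 1 ×ˢ (Metric.closedBall 0 R ∩ {z : JetSpace d | c ≤ z.2.2.1})
  have hcompact : IsCompact S := isCompact_Icc.prod
    ((isCompact_closedBall 0 R).inter_right (isClosed_le continuous_const (by fun_prop)))
  have hconvex : Convex ℝ S := (convex_Icc 0 1).prod ((convex_closedBall 0 R).inter
    (convex_halfSpace_ge (f := fun z : JetSpace d => z.2.2.1)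
      ⟨fun _ _ => rfl, fun _ _ => rfl⟩ c))
  have hdiff : ContDiffOn ℝ 1 (jetLift Ψ) S :=
    (ContDiffOn.mono h fun z hz => hc.trans_le hz.2.2).of_le (by exact_mod_cast le_top)
  obtain ⟨K, hK⟩ := (hdiff.locallyLipschitzOn hconvex).exists_lipschitzOnWith_of_compact hcompact
  refine ⟨K, K.2, fun x z z' hz hz' hcz hcz' => ?_⟩
  obtain ⟨y, hy, rfl⟩ := exists_mem_Icc_proj_eq x
  have hdist := hK.dist_le_mul (y, z) ⟨hy, by simpa using hz, hcz⟩ (y, z')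
    ⟨hy, by simpa using hz', hcz'⟩
  simpa [dist_eq_norm, jetLift] using hdist

section Composition

variable {Ψ : Torus d → JetSpace d → ℝ} {u m θ : Torus d → ℝ}

lemma contDiff_jet {n : ℕ} (hu : IsContDiff (n + 2 : ℕ) u) (hm : IsContDiff n m)
    (hθ : IsContDiff n θ) : ContDiff ℝ n fun y : Fin d → ℝ => jet u m θ (proj y) := by
  have hpd (i : Fin d) : IsContDiff (n + 1 : ℕ) (pd i u) :=
    IsContDiff.pd (n := (n + 1 : ℕ)) (by exact_mod_cast hu) i
  have hpd₂ (i j : Fin d) : IsContDiff n (pd i (pd j u)) :=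
    IsContDiff.pd (by exact_mod_cast hpd j) i
  refine ContDiff.prodMk ?_ (ContDiff.prodMk ?_ (ContDiff.prodMk hm hθ))
  · exact contDiff_euclidean.2 fun i => (hpd i).of_le (by exact_mod_cast Nat.le_succ n)
  · exact contDiff_pi.2 fun i => contDiff_pi.2 fun j => hpd₂ i j

lemma IsJetSmooth.isContDiff (h : IsJetSmooth Ψ) {n : ℕ} (hu : IsContDiff (n + 2 : ℕ) u)
    (hm : IsContDiff n m) (hθ : IsContDiff n θ) (hpos : ∀ x, 0 < m x) :
    IsContDiff n fun x => Ψ x (jet u m θ x) := by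
  have hjet : ContDiff ℝ n fun y : Fin d → ℝ => (y, jet u m θ (proj y)) :=
    contDiff_id.prodMk (contDiff_jet hu hm hθ)
  exact contDiffOn_univ.1 <| (ContDiffOn.of_le h (m := (n : WithTop ℕ∞))
    (by exact_mod_cast le_top)).comp hjet.contDiffOn fun y _ => hpos (proj y)

lemma IsJetSmooth.isSmooth (h : IsJetSmooth Ψ) (hu : IsSmooth u) (hm : IsSmooth m)
    (hθ : IsSmooth θ) (hpos : ∀ x, 0 < m x) : IsSmooth fun x => Ψ x (jet u m θ x) :=
  isSmooth_of_forall_isContDiff fun n =>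
    h.isContDiff (hu.isContDiff _) (hm.isContDiff n) (hθ.isContDiff n) hpos

lemma continuous_jet (hu : IsContDiff 2 u) (hm : Continuous m) (hθ : Continuous θ) :
    Continuous (jet u m θ) :=
  isQuotientMap_proj.continuous_iff.2 <| ContDiff.continuous (n := ((0 : ℕ) : WithTop ℕ∞)) <|
    contDiff_jet (by exact_mod_cast hu)
      (contDiff_zero.2 (hm.comp isQuotientMap_proj.continuous))
      (contDiff_zero.2 (hθ.comp isQuotientMap_proj.continuous))

end Composition

section Asymptotics

variable {ι W : Type*} {l : Filter ι} [NormedAddCommGroup W] {φ : ι → W}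

lemma isBigO_jet_sub {u m θ : ι → Torus d → ℝ} {u₀ m₀ θ₀ : Torus d → ℝ}
    (hpd : ∀ i, (fun z : ι × Torus d => pd i (u z.1) z.2 - pd i u₀ z.2)
      =O[l ×ˢ ⊤] fun z => φ z.1)
    (hpd₂ : ∀ i j, (fun z : ι × Torus d => pd i (pd j (u z.1)) z.2 - pd i (pd j u₀) z.2)
      =O[l ×ˢ ⊤] fun z => φ z.1)
    (hm : (fun z : ι × Torus d => m z.1 z.2 - m₀ z.2) =O[l ×ˢ ⊤] fun z => φ z.1)
    (hθ : (fun z : ι × Torus d => θ z.1 z.2 - θ₀ z.2) =O[l ×ˢ ⊤] fun z => φ z.1) :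
    (fun z : ι × Torus d => jet (u z.1) (m z.1) (θ z.1) z.2 - jet u₀ m₀ θ₀ z.2)
      =O[l ×ˢ ⊤] fun z => φ z.1 := by
  have hgrad : (fun z : ι × Torus d => grad (u z.1) z.2 - grad u₀ z.2)
      =O[l ×ˢ ⊤] fun z => φ z.1 :=
    ((EuclideanSpace.equiv (Fin d) ℝ).symm.toContinuousLinearMap.isBigO_comp
      (fun (z : ι × Torus d) i => pd i (u z.1) z.2 - pd i u₀ z.2) _).trans
      (Asymptotics.isBigO_pi.2 hpd)
  have hhess : (fun z : ι × Torus d => hess (u z.1) z.2 - hess u₀ z.2)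
      =O[l ×ˢ ⊤] fun z => φ z.1 :=
    Asymptotics.isBigO_pi.2 fun i => Asymptotics.isBigO_pi.2 fun j => hpd₂ i j
  exact hgrad.prod_left (hhess.prod_left (hm.prod_left hθ))

lemma exists_pos_lt {f : Torus d → ℝ} (hf : Continuous f) (hpos : ∀ x, 0 < f x) :
    ∃ c > 0, ∀ x, c < f x := by
  obtain ⟨y, -, hy⟩ := isCompact_univ.exists_isMinOn Set.univ_nonempty hf.continuousOn
  exact ⟨f y / 2, half_pos (hpos y), fun x =>
    (half_lt_self (hpos y)).trans_le (hy (Set.mem_univ x))⟩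

lemma IsJetSmooth.isBigO_comp_sub {Ψ : Torus d → JetSpace d → ℝ} (h : IsJetSmooth Ψ)
    (hφ : Tendsto φ l (𝓝 0)) {J : ι → Torus d → JetSpace d} {J₀ : Torus d → JetSpace d}
    (hJ₀ : Continuous J₀) (hpos : ∀ x, 0 < (J₀ x).2.2.1)
    (hJ : (fun z : ι × Torus d => J z.1 z.2 - J₀ z.2) =O[l ×ˢ ⊤] fun z => φ z.1) :
    (fun z : ι × Torus d => Ψ z.2 (J z.1 z.2) - Ψ z.2 (J₀ z.2))
      =O[l ×ˢ ⊤] fun z => φ z.1 := by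
  obtain ⟨c, hc, hcJ⟩ := exists_pos_lt (f := fun x => (J₀ x).2.2.1) (by fun_prop) hpos
  obtain ⟨R, hR⟩ := isCompact_univ.exists_bound_of_continuousOn hJ₀.continuousOn
  obtain ⟨K, -, hK⟩ := h.exists_lipschitz (half_pos hc) (R + 1)
  have hnear : ∀ᶠ z : ι × Torus d in l ×ˢ ⊤, ‖J z.1 z.2 - J₀ z.2‖ < min 1 (c / 2) :=
    (hJ.trans_tendsto (hφ.comp tendsto_fst)).norm.eventually_lt_const (by simpa using hc)
  refine .trans (.of_bound K ?_) hJ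
  filter_upwards [hnear] with ⟨y, x⟩ hz
  have hdensity : |(J y x).2.2.1 - (J₀ x).2.2.1| ≤ c / 2 :=
    ((norm_fst_le (J y x - J₀ x).2.2).trans ((norm_snd_le (J y x - J₀ x).2).trans
      (norm_snd_le (J y x - J₀ x)))).trans (hz.le.trans (min_le_right _ _))
  refine hK x _ _ ?_ ?_ ?_ ?_
  · linarith [norm_le_insert' (J y x) (J₀ x), hR x trivial, hz.le.trans (min_le_left _ _)]
  · linarith [hR x trivial]
  · linarith [hcJ x, abs_le.1 hdensity]
  · linarith [hcJ x]

lemma isBigO_integral_mul_sub {f : ι → Torus d → ℝ} {f₀ w : Torus d → ℝ}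
    (hf : ∀ᶠ y in l, Continuous (f y)) (hf₀ : Continuous f₀) (hw : Continuous w)
    (hsub : (fun z : ι × Torus d => f z.1 z.2 - f₀ z.2) =O[l ×ˢ ⊤] fun z => φ z.1) :
    (fun y => (∫ x, f y x * w x) - ∫ x, f₀ x * w x) =O[l] φ := by
  obtain ⟨C, hC⟩ := hsub.bound
  obtain ⟨B, hB⟩ := isCompact_univ.exists_bound_of_continuousOn hw.continuousOn
  refine .of_bound (C * B) ?_
  filter_upwards [hf, hC.curry] with y hy hyC
  have hinteg : Integrable fun x => f y x * w x := integrable_of_continuous (hy.mul hw)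
  have hinteg₀ : Integrable fun x => f₀ x * w x := integrable_of_continuous (hf₀.mul hw)
  rw [← integral_sub hinteg hinteg₀]
  have hbound := norm_integral_le_of_norm_le_const (μ := (volume : Measure (Torus d)))
    (f := fun x => f y x * w x - f₀ x * w x) (C := C * ‖φ y‖ * B) <| .of_forall fun x => by
      rw [← sub_mul, norm_mul]
      have hx := eventually_top.1 hyC x
      exact mul_le_mul hx (hB x trivial) (norm_nonneg _) ((norm_nonneg _).trans hx)
  rw [probReal_univ, mul_one] at hbound
  linarith

end Asymptotics

/-! ### The Laplacian and the regularizing operator -/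

section Laplacian

variable {f g : Torus d → ℝ}

lemma IsSmooth.add (hf : IsSmooth f) (hg : IsSmooth g) : IsSmooth fun x => f x + g x :=
  ContDiff.add hf hg

lemma IsSmooth.mul (hf : IsSmooth f) (hg : IsSmooth g) : IsSmooth fun x => f x * g x :=
  ContDiff.mul hf hg

lemma IsSmooth.neg (hf : IsSmooth f) : IsSmooth fun x => -f x := ContDiff.neg hf

lemma isSmooth_const (c : ℝ) : IsSmooth fun _ : Torus d => c := contDiff_const

lemma IsSmooth.integrable (hf : IsSmooth f) : Integrable f volume :=
  integrable_of_continuous hf.continuous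

lemma IsSmooth.integral_pd_mul (hf : IsSmooth f) (hg : IsSmooth g) (i : Fin d) :
    ∫ x, RegMFG.pd i f x * g x = -∫ x, f x * RegMFG.pd i g x :=
  RegMFG.integral_pd_mul (hf.isContDiff 1) (hg.isContDiff 1) i

/-- The symbol `4π²|k|²` of `-Δ`. -/
def lapSymbol (k : Fin d → ℤ) : ℝ := 4 * Real.pi ^ 2 * ∑ i, (k i : ℝ) ^ 2

lemma lapSymbol_nonneg (k : Fin d → ℤ) : 0 ≤ lapSymbol k := by unfold lapSymbol; positivity

lemma sq_le_lapSymbol (k : Fin d → ℤ) (i : Fin d) : (k i : ℝ) ^ 2 ≤ lapSymbol k := by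
  have hsum : (k i : ℝ) ^ 2 ≤ ∑ j, (k j : ℝ) ^ 2 :=
    Finset.single_le_sum (f := fun j => (k j : ℝ) ^ 2) (fun j _ => sq_nonneg _)
      (Finset.mem_univ i)
  have hpi : 1 ≤ 4 * Real.pi ^ 2 := by nlinarith [Real.pi_gt_three]
  exact hsum.trans (le_mul_of_one_le_left (by positivity) hpi)

lemma sum_symbol_mul_symbol (k : Fin d → ℤ) :
    ∑ i, symbol k i * symbol k i = -(lapSymbol k : ℂ) := by
  unfold lapSymbol symbol
  push_cast
  rw [Finset.mul_sum, ← Finset.sum_neg_distrib]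
  refine Finset.sum_congr rfl fun i _ => ?_
  linear_combination (4 * (Real.pi : ℂ) ^ 2 * (k i : ℂ) ^ 2) * Complex.I_sq

lemma coeff_lap (hf : IsSmooth f) (k : Fin d → ℤ) :
    coeff (lap f) k = -(lapSymbol k : ℂ) * coeff f k := by
  unfold lap
  rw [coeff_sum _ fun i _ => ((hf.pd i).pd i).integrable, ← sum_symbol_mul_symbol, Finset.sum_mul]
  refine Finset.sum_congr rfl fun i _ => ?_
  rw [coeff_pd ((hf.pd i).isContDiff 1), coeff_pd (hf.isContDiff 1), mul_assoc]

lemma coeff_lap_iterate (hf : IsSmooth f) (n : ℕ) (k : Fin d → ℤ) :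
    coeff (lap^[n] f) k = (-(lapSymbol k : ℂ)) ^ n * coeff f k := by
  induction n with
  | zero => simp
  | succ n ih =>
    rw [Function.iterate_succ_apply', coeff_lap (hf.lap_iterate n), ih]
    ring

end Laplacian

lemma AssumptionH3.mono {E E' : Set ℝ} {h : Mac d → C(Torus d, ℝ)} {H : Hamiltonian d}
    (hH : AssumptionH3 E h H) (hE : E' ⊆ E) : AssumptionH3 E' h H :=
  fun η v η' v' hη hv hη' hv' hηE hηE' =>
    hH η v η' v' hη hv hη' hv' (fun x => hE (hηE x)) fun x => hE (hηE' x)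

/-- The data of the regularized mean-field game system, with the assumptions the existence proof
rests on. -/
structure RegProblem (d : ℕ) where
  /-- the nonlocal coupling -/
  h : Mac d → C(Torus d, ℝ)
  /-- the Hamiltonian -/
  H : Hamiltonian d
  /-- half the number of Laplacians in the high order regularization -/
  p : ℕ
  /-- the exponent of the penalization -/
  q : ℝ
  /-- the parameter of the penalization and of the high order regularization -/
  ε₁ : ℝ
  /-- the parameter of the second order regularization -/
  ε₂ : ℝ
  /-- the penalization -/
  β : ℝ → ℝ
  assumptionH : AssumptionH h
  jetSmooth : IsJetSmooth (jetHamiltonian H)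
  monotone : AssumptionH3 (Set.Ioi 0) h H
  order : d + 10 < 4 * p
  lt_q : (d : ℝ) < q
  ε₁_pos : 0 < ε₁
  ε₁_le : ε₁ ≤ 1
  ε₂_nonneg : 0 ≤ ε₂
  penalization : IsPenalization ε₁ q β

namespace RegProblem

variable (D : RegProblem d) {f g : Torus d → ℝ}

/-- The regularizing operator `ε₁ (1 + Δ^{2p}) + ε₂ (1 - Δ)`. -/
def reg (f : Torus d → ℝ) (x : Torus d) : ℝ :=
  D.ε₁ * (f x + lap^[2 * D.p] f x) + D.ε₂ * (f x - lap f x)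

/-- The symbol of the regularizing operator. -/
def regSymbol (k : Fin d → ℤ) : ℝ :=
  D.ε₁ * (1 + lapSymbol k ^ (2 * D.p)) + D.ε₂ * (1 + lapSymbol k)

lemma isSmooth_reg (hf : IsSmooth f) : IsSmooth (D.reg f) :=
  ((isSmooth_const D.ε₁).mul (hf.add (hf.lap_iterate _))).add
    ((isSmooth_const D.ε₂).mul (hf.sub hf.lap))

/-- The regularizing operator, as a linear map. -/
def regLM : smoothFun d →ₗ[ℝ] smoothFun d :=
  D.ε₁ • (1 + smoothFun.lapLM d ^ (2 * D.p)) + D.ε₂ • (1 - smoothFun.lapLM d)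

lemma coe_regLM (f : smoothFun d) : (D.regLM f : Torus d → ℝ) = D.reg f := by
  funext x
  simp only [regLM, reg, LinearMap.add_apply, LinearMap.smul_apply, LinearMap.sub_apply,
    Module.End.one_apply, Submodule.coe_add, Submodule.coe_sub, Submodule.coe_smul, Pi.add_apply,
    Pi.sub_apply, Pi.smul_apply, smul_eq_mul, smoothFun.coe_lapLM, smoothFun.coe_lapLM_pow]

lemma reg_sub (hf : IsSmooth f) (hg : IsSmooth g) :
    D.reg (fun x => f x - g x) = fun x => D.reg f x - D.reg g x := by
  let F : smoothFun d := ⟨f, hf⟩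
  let G : smoothFun d := ⟨g, hg⟩
  calc D.reg (fun x => f x - g x) = (D.regLM (F - G) : Torus d → ℝ) := (D.coe_regLM (F - G)).symm
    _ = (D.regLM F : Torus d → ℝ) - (D.regLM G : Torus d → ℝ) := by
        rw [map_sub, Submodule.coe_sub]
    _ = fun x => D.reg f x - D.reg g x := by rw [coe_regLM, coe_regLM]; rfl

lemma coeff_reg (hf : IsSmooth f) (k : Fin d → ℤ) :
    coeff (D.reg f) k = (D.regSymbol k : ℂ) * coeff f k := by
  have hiter := hf.lap_iterate (2 * D.p)
  unfold reg
  rw [coeff_add ((hf.add hiter).integrable.const_mul _) ((hf.sub hf.lap).integrable.const_mul _),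
    coeff_const_mul, coeff_const_mul, coeff_add hf.integrable hiter.integrable,
    coeff_sub hf.integrable hf.lap.integrable, coeff_lap hf, coeff_lap_iterate hf,
    Even.neg_pow (even_two_mul _)]
  unfold regSymbol
  push_cast
  ring

lemma mul_le_regSymbol (k : Fin d → ℤ) : D.ε₁ * (1 + lapSymbol k ^ (2 * D.p)) ≤ D.regSymbol k :=
  le_add_of_nonneg_right
    (mul_nonneg D.ε₂_nonneg (add_nonneg zero_le_one (lapSymbol_nonneg k)))

lemma ε₁_le_regSymbol (k : Fin d → ℤ) : D.ε₁ ≤ D.regSymbol k :=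
  (le_mul_of_one_le_right D.ε₁_pos.le
    (le_add_of_nonneg_right (pow_nonneg (lapSymbol_nonneg k) _))).trans (D.mul_le_regSymbol k)

lemma regSymbol_pos (k : Fin d → ℤ) : 0 < D.regSymbol k := D.ε₁_pos.trans_le (D.ε₁_le_regSymbol k)

/-- The constant of the ellipticity estimate `weight_pow_le_regSymbol`. -/
def ellipticConst : ℝ := 2 ^ (4 * D.p) * (1 + d) / D.ε₁

lemma ellipticConst_pos : 0 < D.ellipticConst := by
  have := D.ε₁_pos
  unfold ellipticConst
  positivity

lemma weight_pow_le_regSymbol (k : Fin d → ℤ) :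
    weight k ^ (4 * D.p) ≤ D.ellipticConst * D.regSymbol k := by
  have hε := D.ε₁_pos
  have hpow : 0 ≤ lapSymbol k ^ (2 * D.p) := pow_nonneg (lapSymbol_nonneg k) _
  have habs (i : Fin d) : |(k i : ℝ)| ^ (4 * D.p) ≤ lapSymbol k ^ (2 * D.p) := by
    rw [show 4 * D.p = 2 * (2 * D.p) by ring, pow_mul, sq_abs]
    exact pow_le_pow_left₀ (sq_nonneg _) (sq_le_lapSymbol k i) _
  calc weight k ^ (4 * D.p) ≤ 2 ^ (4 * D.p) * (1 + ∑ i, |(k i : ℝ)| ^ (4 * D.p)) :=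
        weight_pow_le k _
    _ ≤ 2 ^ (4 * D.p) * (1 + ∑ _i : Fin d, lapSymbol k ^ (2 * D.p)) := by
        gcongr with i
        exact habs i
    _ ≤ 2 ^ (4 * D.p) * ((1 + d) * (1 + lapSymbol k ^ (2 * D.p))) := by
        gcongr
        simp only [Finset.sum_const, Finset.card_univ, Fintype.card_fin, nsmul_eq_mul]
        nlinarith [(Nat.cast_nonneg d : (0 : ℝ) ≤ d)]
    _ = D.ellipticConst * (D.ε₁ * (1 + lapSymbol k ^ (2 * D.p))) := by
        unfold ellipticConst
        field_simp
    _ ≤ _ := mul_le_mul_of_nonneg_left (D.mul_le_regSymbol k) D.ellipticConst_pos.le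

/-- The quadratic form `⟨reg f, f⟩` of the regularizing operator. -/
def energy (f : Torus d → ℝ) : ℝ := ∫ x, D.reg f x * f x

lemma hasSum_energy (hf : IsSmooth f) :
    HasSum (fun k => D.regSymbol k * ‖coeff f k‖ ^ 2) (D.energy f) := by
  have hparseval := Complex.hasSum_re (hasSum_conj_coeff_mul ((D.isSmooth_reg hf).memLp 2)
    (hf.memLp 2))
  rw [Complex.ofReal_re] at hparseval
  refine hparseval.congr_fun fun k => ?_
  rw [D.coeff_reg hf, map_mul, Complex.conj_ofReal, mul_assoc, Complex.re_ofReal_mul,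
    ← Complex.normSq_eq_conj_mul_self, Complex.ofReal_re, Complex.normSq_eq_norm_sq]

lemma sqNormH_le_energy (hf : IsSmooth f) :
    sqNormH (2 * D.p) (coeff f) ≤ D.ellipticConst * D.energy f := by
  have henergy := (D.hasSum_energy hf).mul_left D.ellipticConst
  rw [← henergy.tsum_eq]
  refine Summable.tsum_le_tsum (fun k => ?_) (hf.memH _) henergy.summable
  rw [show 2 * (2 * D.p) = 4 * D.p by ring, ← mul_assoc]
  exact mul_le_mul_of_nonneg_right (D.weight_pow_le_regSymbol k) (sq_nonneg _)

lemma integral_sq_le_energy (hf : IsSmooth f) : D.ε₁ * ∫ x, f x ^ 2 ≤ D.energy f :=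
  hasSum_le (fun k => mul_le_mul_of_nonneg_right (D.ε₁_le_regSymbol k) (sq_nonneg _))
    ((hasSum_sq_norm_coeff (hf.memLp 2)).mul_left D.ε₁) (D.hasSum_energy hf)

lemma energy_nonneg (hf : IsSmooth f) : 0 ≤ D.energy f :=
  (mul_nonneg D.ε₁_pos.le (integral_nonneg fun _ => sq_nonneg _)).trans (D.integral_sq_le_energy hf)

/-! ### The residuals of the regularized system -/

/-- The left-hand side of the first equation. -/
def res₁ (m u : Torus d → ℝ) (x : Torus d) : ℝ :=
  opA₁ D.h D.H m u x + D.reg m x + D.β (m x)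

/-- The left-hand side of the second equation. -/
def res₂ (m u : Torus d → ℝ) (x : Torus d) : ℝ := opA₂ D.h D.H m u x + D.reg u x

/-- The nonlinearity `-H + β(m)` of the first equation. -/
def source (x : Torus d) (z : JetSpace d) : ℝ := -jetHamiltonian D.H x z + D.β z.2.2.1

/-- The flux `m D_p H`. -/
def flux (i : Fin d) (x : Torus d) (z : JetSpace d) : ℝ :=
  z.2.2.1 * jetHamiltonian (DpH D.H i) x z

/-- The second order flux `m D_M H`. -/
def flux₂ (i j : Fin d) (x : Torus d) (z : JetSpace d) : ℝ :=
  z.2.2.1 * jetHamiltonian (DMH D.H i j) x z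

lemma isJetSmooth_source : IsJetSmooth D.source :=
  D.jetSmooth.neg.add (isJetSmooth_penalization D.penalization)

lemma isJetSmooth_flux (i : Fin d) : IsJetSmooth (D.flux i) := (D.jetSmooth.dpH i).density_mul

lemma isJetSmooth_flux₂ (i j : Fin d) : IsJetSmooth (D.flux₂ i j) :=
  (D.jetSmooth.dMH i j).density_mul

/-- The jet of `(m, u)`, with `θ = h(𝐦)`. -/
def jetOf (m u : Torus d → ℝ) (x : Torus d) : JetSpace d := jet u m (D.h (bold m)) x

lemma res₁_eq (m u : Torus d → ℝ) :
    D.res₁ m u = fun x => -u x + D.reg m x + D.source x (D.jetOf m u x) := by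
  funext x
  simp only [res₁, opA₁, source, jetHamiltonian, jetOf, jet]
  ring

lemma res₂_eq (m u : Torus d → ℝ) :
    D.res₂ m u = fun x => m x - 1 + D.reg u x
      - ∑ i, pd i (fun y => D.flux i y (D.jetOf m u y)) x
      + ∑ i, ∑ j, pd i (pd j fun y => D.flux₂ i j y (D.jetOf m u y)) x := by
  funext x
  simp only [res₂, opA₂, flux, flux₂, jetHamiltonian, jetOf, jet]
  ring

variable {m u w : Torus d → ℝ}

variable {D} in
lemma isSmooth_jetOf {Ψ : Torus d → JetSpace d → ℝ} (hΨ : IsJetSmooth Ψ) (hm : IsSmooth m)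
    (hu : IsSmooth u) (hpos : ∀ x, 0 < m x) : IsSmooth fun x => Ψ x (D.jetOf m u x) :=
  hΨ.isSmooth hu hm (isSmooth_nonlocal D.assumptionH hm fun x => (hpos x).le) hpos

section Smooth

variable (hm : IsSmooth m) (hu : IsSmooth u) (hpos : ∀ x, 0 < m x)
include hm hu hpos

lemma isSmooth_flux (i : Fin d) : IsSmooth fun x => D.flux i x (D.jetOf m u x) :=
  isSmooth_jetOf (D.isJetSmooth_flux i) hm hu hpos

lemma isSmooth_flux₂ (i j : Fin d) : IsSmooth fun x => D.flux₂ i j x (D.jetOf m u x) :=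
  isSmooth_jetOf (D.isJetSmooth_flux₂ i j) hm hu hpos

lemma isSmooth_res₁ : IsSmooth (D.res₁ m u) := by
  rw [res₁_eq]
  exact (hu.neg.add (D.isSmooth_reg hm)).add (isSmooth_jetOf D.isJetSmooth_source hm hu hpos)

lemma isSmooth_res₂ : IsSmooth (D.res₂ m u) := by
  rw [res₂_eq]
  exact (((hm.sub (isSmooth_const 1)).add (D.isSmooth_reg hu)).sub
    (.sum fun i _ => (D.isSmooth_flux hm hu hpos i).pd i)).add
    (.sum fun i _ => .sum fun j _ => ((D.isSmooth_flux₂ hm hu hpos i j).pd j).pd i)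

lemma integral_res₁_mul (hw : IsSmooth w) :
    ∫ x, D.res₁ m u x * w x =
      (∫ x, (-u x + D.reg m x) * w x) + ∫ x, D.source x (D.jetOf m u x) * w x := by
  simp only [res₁_eq, add_mul _ (D.source _ _)]
  exact integral_add ((hu.neg.add (D.isSmooth_reg hm)).mul hw).integrable
    ((isSmooth_jetOf D.isJetSmooth_source hm hu hpos).mul hw).integrable

lemma integral_div_flux_mul (hw : IsSmooth w) :
    ∫ x, (∑ i, pd i (fun y => D.flux i y (D.jetOf m u y)) x) * w x =
      -∑ i, ∫ x, D.flux i x (D.jetOf m u x) * pd i w x := by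
  simp only [Finset.sum_mul]
  rw [integral_finsetSum _ fun i _ => (((D.isSmooth_flux hm hu hpos i).pd i).mul hw).integrable,
    ← Finset.sum_neg_distrib]
  exact Finset.sum_congr rfl fun i _ => (D.isSmooth_flux hm hu hpos i).integral_pd_mul hw i

lemma integral_div_flux₂_mul (hw : IsSmooth w) :
    ∫ x, (∑ i, ∑ j, pd i (pd j fun y => D.flux₂ i j y (D.jetOf m u y)) x) * w x =
      ∑ i, ∑ j, ∫ x, D.flux₂ i j x (D.jetOf m u x) * pd j (pd i w) x := by
  have hflux (i j : Fin d) := D.isSmooth_flux₂ hm hu hpos i j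
  simp only [Finset.sum_mul]
  rw [integral_finsetSum _ fun i _ => IsSmooth.integrable
    (.sum fun j _ => (((hflux i j).pd j).pd i).mul hw)]
  refine Finset.sum_congr rfl fun i _ => ?_
  rw [integral_finsetSum _ fun j _ => ((((hflux i j).pd j).pd i).mul hw).integrable]
  refine Finset.sum_congr rfl fun j _ => ?_
  rw [((hflux i j).pd j).integral_pd_mul hw, (hflux i j).integral_pd_mul (hw.pd i), neg_neg]

lemma integral_res₂_mul (hw : IsSmooth w) :
    ∫ x, D.res₂ m u x * w x = (∫ x, (m x - 1 + D.reg u x) * w x) +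
      (∑ i, ∫ x, D.flux i x (D.jetOf m u x) * pd i w x) +
      ∑ i, ∑ j, ∫ x, D.flux₂ i j x (D.jetOf m u x) * pd j (pd i w) x := by
  have hlin := ((hm.sub (isSmooth_const 1)).add (D.isSmooth_reg hu)).mul hw
  have hdiv : IsSmooth fun x => ∑ i, pd i (fun y => D.flux i y (D.jetOf m u y)) x :=
    .sum fun i _ => (D.isSmooth_flux hm hu hpos i).pd i
  have hdiv₂ : IsSmooth fun x => ∑ i, ∑ j, pd i (pd j fun y => D.flux₂ i j y (D.jetOf m u y)) x :=
    .sum fun i _ => .sum fun j _ => ((D.isSmooth_flux₂ hm hu hpos i j).pd j).pd i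
  simp only [res₂_eq, add_mul _ (Finset.sum _ _), sub_mul _ (Finset.sum _ _)]
  rw [integral_add (hlin.sub (hdiv.mul hw)).integrable (hdiv₂.mul hw).integrable,
    integral_sub hlin.integrable (hdiv.mul hw).integrable,
    D.integral_div_flux_mul hm hu hpos hw, D.integral_div_flux₂_mul hm hu hpos hw, sub_neg_eq_add]

end Smooth

end RegProblem

/-! ### The lower bound for the density -/

lemma exists_proj_eq_norm_le (x : Torus d) : ∃ t : Fin d → ℝ, proj t = x ∧ ‖t‖ ≤ ‖x‖ := by
  obtain ⟨y, rfl⟩ := isQuotientMap_proj.surjective x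
  refine ⟨fun i => y i - round (y i), ?_, (pi_norm_le_iff_of_nonneg (norm_nonneg _)).2 fun i => ?_⟩
  · funext i
    simp [proj]
  · have hi := norm_le_pi_norm (proj y) i
    rwa [proj, UnitAddCircle.norm_eq] at hi

lemma proj_add (y t : Fin d → ℝ) : proj (y + t) = proj y + proj t := by
  funext i
  simp only [proj, Pi.add_apply, AddCircle.coe_add]

namespace IsContDiff

variable {f : Torus d → ℝ} {Λ : ℝ}

lemma fderiv_apply (hf : IsContDiff 1 f) (z v : Fin d → ℝ) :
    fderiv ℝ (fun y : Fin d → ℝ => f (proj y)) z v = ∑ i, v i * RegMFG.pd i f (proj z) := by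
  conv_lhs => rw [← Finset.univ_sum_single v]
  rw [map_sum]
  refine Finset.sum_congr rfl fun i _ => ?_
  rw [hf.pd_proj le_rfl, ← smul_eq_mul, ← map_smul, ← Pi.single_smul, smul_eq_mul, mul_one]

lemma norm_fderiv_le (hf : IsContDiff 1 f) (hΛ₀ : 0 ≤ Λ) (hΛ : ∀ i x, |RegMFG.pd i f x| ≤ Λ)
    (z : Fin d → ℝ) : ‖fderiv ℝ (fun y : Fin d → ℝ => f (proj y)) z‖ ≤ d * Λ := by
  refine ContinuousLinearMap.opNorm_le_bound _ (by positivity) fun v => ?_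
  rw [hf.fderiv_apply]
  calc ‖∑ i, v i * RegMFG.pd i f (proj z)‖ ≤ ∑ i, ‖v i * RegMFG.pd i f (proj z)‖ :=
        norm_sum_le _ _
    _ ≤ ∑ _i : Fin d, ‖v‖ * Λ := by
        refine Finset.sum_le_sum fun i _ => ?_
        rw [norm_mul]
        exact mul_le_mul (norm_le_pi_norm v i) (hΛ i _) (norm_nonneg _) (norm_nonneg _)
    _ = d * Λ * ‖v‖ := by
        rw [Finset.sum_const, Finset.card_univ, Fintype.card_fin, nsmul_eq_mul]
        ring

lemma abs_sub_le (hf : IsContDiff 1 f) (hΛ₀ : 0 ≤ Λ) (hΛ : ∀ i x, |RegMFG.pd i f x| ≤ Λ)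
    (x x₀ : Torus d) : |f x - f x₀| ≤ d * Λ * ‖x - x₀‖ := by
  obtain ⟨t, ht, htn⟩ := exists_proj_eq_norm_le (x - x₀)
  obtain ⟨y, rfl⟩ := isQuotientMap_proj.surjective x₀
  have hx : x = proj (y + t) := by rw [proj_add, ht, add_sub_cancel]
  have hmean := Convex.norm_image_sub_le_of_norm_fderiv_le
    (fun z _ => (ContDiff.differentiable hf one_ne_zero) z)
    (fun z _ => hf.norm_fderiv_le hΛ₀ hΛ z) convex_univ (Set.mem_univ y) (Set.mem_univ (y + t))
  rw [add_sub_cancel_left, Real.norm_eq_abs, ← hx] at hmean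
  exact hmean.trans (mul_le_mul_of_nonneg_left htn (by positivity))

end IsContDiff

lemma volume_real_closedBall (x : Torus d) {r : ℝ} (hr : 0 ≤ r) (hr' : r ≤ 1 / 2) :
    (volume : Measure (Torus d)).real (Metric.closedBall x r) = (2 * r) ^ d := by
  rw [measureReal_def, volume_pi, Measure.pi_closedBall _ x hr]
  simp only [AddCircle.volume_closedBall, Finset.prod_const, Finset.card_univ, Fintype.card_fin]
  rw [min_eq_right (by linarith), ← ENNReal.ofReal_pow (by linarith),
    ENNReal.toReal_ofReal (by positivity)]

lemma ball_bound_eq {s A q : ℝ} (hs : 0 < s) (hA : 0 < A) :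
    s ^ (-(q - d)) =
      (2 * (s / A)) ^ d * (1 / 2 * (2 * s) ^ (-q)) * (2 * 2 ^ q * A ^ d / 2 ^ d) := by
  have hsplit : s ^ (-(q - d)) = s ^ d * s ^ (-q) := by
    rw [← Real.rpow_natCast, ← Real.rpow_add hs]
    congr 1
    ring
  rw [hsplit, Real.mul_rpow two_pos.le hs.le, Real.rpow_neg two_pos.le q, mul_pow, div_pow]
  field_simp

namespace IsPenalization

variable {ε₁ q : ℝ} {β : ℝ → ℝ}

lemma sub_mul_sub_nonneg (hβ : IsPenalization ε₁ q β) {s t : ℝ} (hs : 0 < s) (ht : 0 < t) :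
    0 ≤ (β s - β t) * (s - t) := by
  rcases le_total s t with h | h
  · exact mul_nonneg_of_nonpos_of_nonpos
      (sub_nonpos.2 (hβ.mono hs ht h)) (sub_nonpos.2 h)
  · exact mul_nonneg (sub_nonneg.2 (hβ.mono ht hs h)) (sub_nonneg.2 h)

lemma mul_sub_one_nonneg (hβ : IsPenalization ε₁ q β) (hε₁ : ε₁ ≤ 1) {s : ℝ} (hs : 0 < s) :
    0 ≤ β s * (s - 1) := by
  simpa only [hβ.eq_zero 1 hε₁, sub_zero] using hβ.sub_mul_sub_nonneg hs one_pos

lemma continuous_comp (hβ : IsPenalization ε₁ q β) {m : Torus d → ℝ} (hm : Continuous m)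
    (hpos : ∀ x, 0 < m x) : Continuous fun x => β (m x) :=
  hβ.smooth.continuousOn.comp_continuous hm hpos

lemma half_rpow_le (hβ : IsPenalization ε₁ q β) (hε₁ : ε₁ ≤ 1) (hq : 0 ≤ q) {s t : ℝ}
    (hs : s ≤ ε₁ / 4) (ht : 0 < t) (hts : t ≤ 2 * s) :
    1 / 2 * (2 * s) ^ (-q) ≤ β t * (t - 1) := by
  have hrpow : (2 * s) ^ (-q) ≤ t ^ (-q) :=
    Real.rpow_le_rpow_of_nonpos ht hts (neg_nonpos.2 hq)
  have hnonneg : 0 ≤ (2 * s) ^ (-q) := Real.rpow_nonneg (ht.le.trans hts) _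
  rw [hβ.eq_neg t ht (by linarith), one_div (t ^ q), ← Real.rpow_neg ht.le]
  nlinarith

-- Near a point where `m` takes the small value `s`, `m ≤ 2 s` on a ball of radius `s / A`.
lemma ball_bound_le_integral (hβ : IsPenalization ε₁ q β) (hε₁ : ε₁ ≤ 1) (hq : 0 ≤ q)
    {m : Torus d → ℝ} (hm : IsContDiff 1 m) (hpos : ∀ x, 0 < m x) {Λ A : ℝ} (hΛ₀ : 0 ≤ Λ)
    (hΛ : ∀ i x, |pd i m x| ≤ Λ) (hA : 1 ≤ A) (hΛA : d * Λ ≤ A) {x₀ : Torus d}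
    (hs : m x₀ ≤ ε₁ / 4) :
    (2 * (m x₀ / A)) ^ d * (1 / 2 * (2 * m x₀) ^ (-q)) ≤ ∫ x, β (m x) * (m x - 1) := by
  have hA₀ : 0 < A := one_pos.trans_le hA
  have hr₀ : 0 ≤ m x₀ / A := div_nonneg (hpos x₀).le hA₀.le
  have hr : m x₀ / A ≤ m x₀ := div_le_self (hpos x₀).le hA
  have hball (x : Torus d) (hx : x ∈ Metric.closedBall x₀ (m x₀ / A)) : m x ≤ 2 * m x₀ := by
    rw [Metric.mem_closedBall, dist_eq_norm] at hx
    have hosc : |m x - m x₀| ≤ m x₀ :=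
      calc |m x - m x₀| ≤ d * Λ * ‖x - x₀‖ := hm.abs_sub_le hΛ₀ hΛ x x₀
        _ ≤ A * (m x₀ / A) := mul_le_mul hΛA hx (norm_nonneg _) hA₀.le
        _ = m x₀ := mul_div_cancel₀ _ hA₀.ne'
    linarith [(abs_le.1 hosc).2]
  have hinteg : Integrable fun x => β (m x) * (m x - 1) := integrable_of_continuous
    ((hβ.continuous_comp hm.continuous hpos).mul (hm.continuous.sub continuous_const))
  rw [← volume_real_closedBall x₀ hr₀ (by linarith), ← smul_eq_mul, ← setIntegral_const]
  refine (setIntegral_mono_on (integrable_const _).integrableOn hinteg.integrableOn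
    measurableSet_closedBall fun x hx =>
      hβ.half_rpow_le hε₁ hq hs (hpos x) (hball x hx)).trans ?_
  exact setIntegral_le_integral hinteg (.of_forall fun x => hβ.mul_sub_one_nonneg hε₁ (hpos x))

lemma exists_lower_bound (hβ : IsPenalization ε₁ q β) (hε₀ : 0 < ε₁) (hε₁ : ε₁ ≤ 1)
    (hq : (d : ℝ) < q) {Λ : ℝ} (hΛ₀ : 0 ≤ Λ) (B : ℝ) :
    ∃ c : ℝ, 0 < c ∧ ∀ m : Torus d → ℝ, IsContDiff 1 m → (∀ x, 0 < m x) →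
      (∀ i x, |pd i m x| ≤ Λ) → ∫ x, β (m x) * (m x - 1) ≤ B → ∀ x, c ≤ m x := by
  have hqd : 0 < q - d := sub_pos.2 hq
  set A : ℝ := max (d * Λ) 1
  have hA₀ : 0 < A := one_pos.trans_le (le_max_right _ _)
  set B' : ℝ := max (B * (2 * 2 ^ q * A ^ d / 2 ^ d)) 1
  have hB' : 0 < B' := one_pos.trans_le (le_max_right _ _)
  refine ⟨min (ε₁ / 4) (B' ^ (-(q - d)⁻¹)), by positivity, fun m hm hpos hΛ hB x₀ => ?_⟩
  by_contra! hlt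
  obtain ⟨hsε, hsB⟩ := lt_min_iff.1 hlt
  have hupper : m x₀ ^ (-(q - d)) ≤ B' := by
    rw [ball_bound_eq (hpos x₀) hA₀]
    refine (mul_le_mul_of_nonneg_right ?_ (by positivity)).trans (le_max_left _ _)
    exact (hβ.ball_bound_le_integral hε₁ ((Nat.cast_nonneg d).trans hq.le) hm hpos hΛ₀ hΛ
      (le_max_right _ _) (le_max_left _ _) hsε.le).trans hB
  have hlower : B' < m x₀ ^ (-(q - d)) := by
    have hrpow := Real.rpow_lt_rpow_of_neg (hpos x₀) hsB (neg_lt_zero.2 hqd)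
    rwa [← Real.rpow_mul hB'.le, neg_mul_neg, inv_mul_cancel₀ hqd.ne', Real.rpow_one] at hrpow
  exact hlower.not_ge hupper

end IsPenalization

/-! ### Monotonicity and the a priori estimate -/

lemma young_integral_mul {ε : ℝ} (hε : 0 < ε) {f w : Torus d → ℝ} (hf : Continuous f)
    (hw : Continuous w) :
    -((∫ x, f x ^ 2) / (2 * ε)) - ε / 2 * ∫ x, w x ^ 2 ≤ ∫ x, f x * w x := by
  have hf₂ : Integrable fun x => -(f x ^ 2 / (2 * ε)) :=
    integrable_of_continuous ((hf.pow 2).div_const _).neg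
  have hw₂ : Integrable fun x => ε / 2 * w x ^ 2 :=
    integrable_of_continuous ((hw.pow 2).const_mul _)
  rw [← integral_div, ← integral_const_mul, ← integral_neg, ← integral_sub hf₂ hw₂]
  refine integral_mono (hf₂.sub hw₂) (integrable_of_continuous (hf.mul hw)) fun x => ?_
  have hsq : 0 ≤ (f x + ε * w x) ^ 2 / (2 * ε) := by positivity
  have hexpand : (f x + ε * w x) ^ 2 / (2 * ε) =
      f x ^ 2 / (2 * ε) + f x * w x + ε / 2 * w x ^ 2 := by
    field_simp
    ring
  simp only
  linarith

namespace RegProblem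

variable (D : RegProblem d)

section Monotone

variable {m u m' u' : Torus d → ℝ} (hm : IsSmooth m) (hu : IsSmooth u) (hpos : ∀ x, 0 < m x)
  (hm' : IsSmooth m') (hu' : IsSmooth u') (hpos' : ∀ x, 0 < m' x)
include hm hu hpos hm' hu' hpos'

lemma integral_opA₁_sub_mul :
    ∫ x, (opA₁ D.h D.H m u x - opA₁ D.h D.H m' u' x) * (m x - m' x) =
      (∫ x, (D.res₁ m u x - D.res₁ m' u' x) * (m x - m' x)) - D.energy (fun x => m x - m' x) -
        ∫ x, (D.β (m x) - D.β (m' x)) * (m x - m' x) := by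
  have hsub := hm.sub hm'
  have hres := ((D.isSmooth_res₁ hm hu hpos).sub (D.isSmooth_res₁ hm' hu' hpos')).mul hsub
  have hreg := (D.isSmooth_reg hsub).mul hsub
  have hβ : Integrable fun x => (D.β (m x) - D.β (m' x)) * (m x - m' x) :=
    integrable_of_continuous (((D.penalization.continuous_comp hm.continuous hpos).sub
      (D.penalization.continuous_comp hm'.continuous hpos')).mul hsub.continuous)
  unfold energy
  rw [← integral_sub hres.integrable hreg.integrable,
    ← integral_sub (hres.sub hreg).integrable hβ]
  congr 1
  funext x
  rw [D.reg_sub hm hm']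
  simp only [res₁]
  ring

lemma integral_opA₂_sub_mul :
    ∫ x, (opA₂ D.h D.H m u x - opA₂ D.h D.H m' u' x) * (u x - u' x) =
      (∫ x, (D.res₂ m u x - D.res₂ m' u' x) * (u x - u' x)) -
        D.energy (fun x => u x - u' x) := by
  have hsub := hu.sub hu'
  have hres := ((D.isSmooth_res₂ hm hu hpos).sub (D.isSmooth_res₂ hm' hu' hpos')).mul hsub
  have hreg := (D.isSmooth_reg hsub).mul hsub
  unfold energy
  rw [← integral_sub hres.integrable hreg.integrable]
  congr 1
  funext x
  rw [D.reg_sub hu hu']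
  simp only [res₂]
  ring

lemma energy_add_energy_le :
    D.energy (fun x => m x - m' x) + D.energy (fun x => u x - u' x) +
      ∫ x, (D.β (m x) - D.β (m' x)) * (m x - m' x) ≤
    (∫ x, (D.res₁ m u x - D.res₁ m' u' x) * (m x - m' x)) +
      ∫ x, (D.res₂ m u x - D.res₂ m' u' x) * (u x - u' x) := by
  have hmono := D.monotone m u m' u' hm hu hm' hu' hpos hpos'
  rw [D.integral_opA₁_sub_mul hm hu hpos hm' hu' hpos',
    D.integral_opA₂_sub_mul hm hu hpos hm' hu' hpos'] at hmono
  linarith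

lemma energy_add_energy_le_of_pos :
    D.energy (fun x => m x - m' x) + D.energy (fun x => u x - u' x) ≤
    (∫ x, (D.res₁ m u x - D.res₁ m' u' x) * (m x - m' x)) +
      ∫ x, (D.res₂ m u x - D.res₂ m' u' x) * (u x - u' x) :=
  (le_add_of_nonneg_right (integral_nonneg fun x =>
    D.penalization.sub_mul_sub_nonneg (hpos x) (hpos' x))).trans
    (D.energy_add_energy_le hm hu hpos hm' hu' hpos')

end Monotone

lemma le_integral_mul {f w : Torus d → ℝ} (hf : Continuous f) (hw : IsSmooth w) :
    -((∫ x, f x ^ 2) / (2 * D.ε₁)) - D.energy w / 2 ≤ ∫ x, f x * w x := by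
  linarith [young_integral_mul D.ε₁_pos hf hw.continuous, D.integral_sq_le_energy hw]

/-- The constant of the a priori estimate, given by the residuals of the state `(1, 0)`. -/
def aprioriConst : ℝ := (∫ x, D.res₁ (fun _ => 1) (fun _ => 0) x ^ 2) / (2 * D.ε₁) +
  (∫ x, D.res₂ (fun _ => 1) (fun _ => 0) x ^ 2) / (2 * D.ε₁)

lemma aprioriConst_nonneg : 0 ≤ D.aprioriConst := by
  have hε := D.ε₁_pos
  exact add_nonneg (div_nonneg (integral_nonneg fun _ => sq_nonneg _) (by positivity))
    (div_nonneg (integral_nonneg fun _ => sq_nonneg _) (by positivity))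

lemma integral_penalization_mul_sub_one_nonneg {m : Torus d → ℝ} (hpos : ∀ x, 0 < m x) :
    0 ≤ ∫ x, D.β (m x) * (m x - 1) :=
  integral_nonneg fun x => D.penalization.mul_sub_one_nonneg D.ε₁_le (hpos x)

lemma apriori_estimate {m u : Torus d → ℝ} (hm : IsSmooth m) (hu : IsSmooth u)
    (hpos : ∀ x, 0 < m x) :
    (D.energy (fun x => m x - 1) + D.energy u) / 2 + (∫ x, D.β (m x) * (m x - 1)) -
        D.aprioriConst ≤
      (∫ x, D.res₁ m u x * (m x - 1)) + ∫ x, D.res₂ m u x * u x := by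
  have hone (x : Torus d) : (0 : ℝ) < (fun _ => 1) x := one_pos
  have hm₁ := hm.sub (isSmooth_const 1)
  have hres₁ := D.isSmooth_res₁ (isSmooth_const 1) (isSmooth_const 0) hone
  have hres₂ := D.isSmooth_res₂ (isSmooth_const 1) (isSmooth_const 0) hone
  have hmono := D.energy_add_energy_le hm hu hpos (isSmooth_const 1) (isSmooth_const 0) hone
  simp only [D.penalization.eq_zero 1 D.ε₁_le, sub_zero, sub_mul] at hmono
  rw [integral_sub ((D.isSmooth_res₁ hm hu hpos).mul hm₁).integrable (hres₁.mul hm₁).integrable,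
    integral_sub ((D.isSmooth_res₂ hm hu hpos).mul hu).integrable
      (hres₂.mul hu).integrable] at hmono
  unfold aprioriConst
  linarith [D.le_integral_mul hres₁.continuous hm₁, D.le_integral_mul hres₂.continuous hu]

end RegProblem

/-! ### Galerkin approximations -/

section StronglyMonotone

variable {V : Type*} [NormedAddCommGroup V] [InnerProductSpace ℝ V] {U : Set V} {F : V → V} {c : ℝ}

/- Moving by `t` in the direction `v = -F x` changes `‖F‖²` by at most
`-2 c t ‖v‖² + C² t² ‖v‖²`. -/
lemma exists_norm_lt_of_stronglyMonotone {x : V} (hc : 0 < c) (hU : U ∈ 𝓝 x)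
    (hF : (fun y => F y - F x) =O[𝓝 x] fun y => y - x)
    (hmono : ∀ y ∈ U, c * ‖y - x‖ ^ 2 ≤ inner ℝ (F y - F x) (y - x)) (hne : F x ≠ 0) :
    ∃ y ∈ U, ‖F y‖ < ‖F x‖ := by
  obtain ⟨C, hC⟩ := hF.bound
  set v := -F x with hv
  have hv₀ : 0 < ‖v‖ := by rwa [hv, norm_neg, norm_pos_iff]
  have hpath : Tendsto (fun t : ℝ => x + t • v) (𝓝[>] 0) (𝓝 x) :=
    Continuous.tendsto' (by fun_prop) 0 x (by simp) |>.mono_left nhdsWithin_le_nhds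
  have hsmall : ∀ᶠ t : ℝ in 𝓝[>] 0, t * C ^ 2 < 2 * c :=
    ((Continuous.tendsto' (by fun_prop) 0 0 (by simp)).mono_left
      nhdsWithin_le_nhds).eventually_lt_const (by positivity)
  obtain ⟨t, ⟨⟨hLip, htU⟩, htc⟩, ht⟩ :=
    (((hpath.eventually hC).and (hpath.eventually hU)).and hsmall |>.and self_mem_nhdsWithin).exists
  replace ht : 0 < t := ht
  have hinner := hmono _ htU
  rw [add_sub_cancel_left, norm_smul, Real.norm_of_nonneg ht.le] at hLip hinner
  rw [real_inner_smul_right] at hinner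
  set w := F (x + t • v) - F x with hw
  have hFt : F (x + t • v) = w - v := by rw [hw, hv]; abel
  have hw_sq : ‖w‖ ^ 2 ≤ (C * (t * ‖v‖)) ^ 2 := pow_le_pow_left₀ (norm_nonneg _) hLip 2
  have hgain : 0 < t * ‖v‖ ^ 2 * (2 * c - t * C ^ 2) := mul_pos (by positivity) (by linarith)
  have hdirection : c * t * ‖v‖ ^ 2 ≤ inner ℝ w v :=
    le_of_mul_le_mul_left (by linarith [hinner]) ht
  refine ⟨_, htU, lt_of_pow_lt_pow_left₀ 2 (norm_nonneg _) ?_⟩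
  rw [hFt, norm_sub_sq_real, ← norm_neg (F x), ← hv]
  nlinarith

lemma exists_zero_of_stronglyMonotone {K : Set V} (hc : 0 < c) (hU : IsOpen U)
    (hF : ∀ x ∈ U, (fun y => F y - F x) =O[𝓝 x] fun y => y - x)
    (hmono : ∀ x ∈ U, ∀ y ∈ U, c * ‖x - y‖ ^ 2 ≤ inner ℝ (F x - F y) (x - y))
    (hK : IsCompact K) (hKU : K ⊆ U) {a : V} (ha : a ∈ U)
    (hsub : ∀ x ∈ U, ‖F x‖ ≤ ‖F a‖ → x ∈ K) : ∃ x ∈ U, F x = 0 := by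
  have hcont : ContinuousOn F K := fun x hx =>
    (tendsto_sub_nhds_zero_iff.1 ((hF x (hKU hx)).trans_tendsto
      (Continuous.tendsto' (by fun_prop) x 0 (sub_self x)))).mono_left nhdsWithin_le_nhds
  have haK : a ∈ K := hsub a ha le_rfl
  obtain ⟨x, hxK, hmin⟩ := hK.exists_isMinOn ⟨a, haK⟩ hcont.norm
  refine ⟨x, hKU hxK, by_contra fun hne => ?_⟩
  obtain ⟨y, hy, hlt⟩ := exists_norm_lt_of_stronglyMonotone hc (hU.mem_nhds (hKU hxK))
    (hF x (hKU hxK)) (fun y hy => hmono y hy x (hKU hxK)) hne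
  exact hlt.not_ge (hmin (hsub y hy (hlt.le.trans (hmin haK))))

end StronglyMonotone

section LinearFamily

variable {V : Type*} [NormedAddCommGroup V] [NormedSpace ℝ V] [FiniteDimensional ℝ V]

/-- The inclusion of `C^∞(𝕋^d)` in `C(𝕋^d)`, as a linear map. -/
def smoothFun.toContinuous (d : ℕ) : smoothFun d →ₗ[ℝ] C(Torus d, ℝ) where
  toFun f := ⟨f, IsSmooth.continuous f.2⟩
  map_add' _ _ := rfl
  map_smul' _ _ := rfl

lemma exists_abs_apply_le_mul_norm (L : V →ₗ[ℝ] smoothFun d) :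
    ∃ B, 0 ≤ B ∧ ∀ v x, |L v x| ≤ B * ‖v‖ :=
  let T := (smoothFun.toContinuous d ∘ₗ L).toContinuousLinearMap
  ⟨‖T‖, T.opNorm_nonneg, fun v x => ((T v).norm_coe_le_norm x).trans (T.le_opNorm v)⟩

lemma isBigO_apply_sub (L : V →ₗ[ℝ] smoothFun d) (a : V) :
    (fun z : V × Torus d => L z.1 z.2 - L a z.2) =O[𝓝 a ×ˢ ⊤] fun z => z.1 - a := by
  obtain ⟨B, -, hB⟩ := exists_abs_apply_le_mul_norm L
  refine .of_bound B (.of_forall fun z => ?_)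
  have hz := hB (z.1 - a) z.2
  rw [map_sub] at hz
  exact hz

/-- The set of the parameters of the positive members of a linear family of functions. -/
def positiveSet (L : V →ₗ[ℝ] smoothFun d) : Set V := {v | ∀ x, 0 < L v x}

lemma isOpen_positiveSet (L : V →ₗ[ℝ] smoothFun d) : IsOpen (positiveSet L) := by
  have hopen := (ContinuousMap.isOpen_setOfPred_mapsTo (X := Torus d) isCompact_univ
    (isOpen_Ioi (a := (0 : ℝ)))).preimage
      (smoothFun.toContinuous d ∘ₗ L).continuous_of_finiteDimensional
  convert hopen using 1
  ext v
  exact ⟨fun hv x _ => hv x, fun hv x => hv trivial⟩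

lemma isClosed_setOf_forall_le (L : V →ₗ[ℝ] smoothFun d) (c : ℝ) :
    IsClosed {v | ∀ x, c ≤ L v x} := by
  rw [Set.ofPred_forall]
  exact isClosed_iInter fun x => isClosed_le continuous_const <|
    (continuous_eval_const x).comp (smoothFun.toContinuous d ∘ₗ L).continuous_of_finiteDimensional

end LinearFamily

namespace RegProblem

variable (D : RegProblem d)

section LinearFamily

variable {V : Type*} [NormedAddCommGroup V] [NormedSpace ℝ V] [FiniteDimensional ℝ V]
  (M U : V →ₗ[ℝ] smoothFun d) {x : V} (hx : x ∈ positiveSet M)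
include hx

lemma isBigO_jetOf_sub :
    (fun z : V × Torus d => D.jetOf (M z.1) (U z.1) z.2 - D.jetOf (M x) (U x) z.2)
      =O[𝓝 x ×ˢ ⊤] fun z => z.1 - x := by
  have hnhds : 𝓝[{y | ∀ t, 0 ≤ M y t}] x = 𝓝 x := nhdsWithin_eq_nhds.2 <|
    mem_of_superset ((isOpen_positiveSet M).mem_nhds hx) fun y hy t => (hy t).le
  refine isBigO_jet_sub (u := fun y => U y) (m := fun y => M y) (θ := fun y => D.h (bold (M y)))
    (φ := fun y => y - x) (fun i => ?_) (fun i j => ?_) (isBigO_apply_sub M x) ?_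
  · exact isBigO_apply_sub (smoothFun.pdLM i ∘ₗ U) x
  · exact isBigO_apply_sub (smoothFun.pdLM i ∘ₗ smoothFun.pdLM j ∘ₗ U) x
  · exact hnhds ▸ nonlocal_isBigO_sub D.assumptionH M fun t => (hx t).le

lemma isBigO_integral_comp_jetOf_sub {Ψ : Torus d → JetSpace d → ℝ} (hΨ : IsJetSmooth Ψ)
    {w : Torus d → ℝ} (hw : IsSmooth w) :
    (fun y => (∫ t, Ψ t (D.jetOf (M y) (U y) t) * w t) - ∫ t, Ψ t (D.jetOf (M x) (U x) t) * w t)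
      =O[𝓝 x] fun y => y - x := by
  have hx₀ : Tendsto (fun y => y - x) (𝓝 x) (𝓝 0) :=
    Continuous.tendsto' (by fun_prop) x 0 (sub_self x)
  have hsmooth {y : V} (hy : y ∈ positiveSet M) : IsSmooth fun t => Ψ t (D.jetOf (M y) (U y) t) :=
    isSmooth_jetOf hΨ (M y).2 (U y).2 hy
  have hjet : Continuous (D.jetOf (M x) (U x)) :=
    continuous_jet ((U x).2.isContDiff 2) (M x).2.continuous (D.h _).continuous
  refine isBigO_integral_mul_sub ?_ (hsmooth hx).continuous hw.continuous <|
    hΨ.isBigO_comp_sub hx₀ (J := fun y => D.jetOf (M y) (U y)) hjet hx (D.isBigO_jetOf_sub M U hx)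
  filter_upwards [(isOpen_positiveSet M).mem_nhds hx] with y hy using (hsmooth hy).continuous

omit hx in
lemma isBigO_integral_apply_mul_sub (L : V →ₗ[ℝ] smoothFun d) {w : Torus d → ℝ}
    (hw : IsSmooth w) :
    (fun y => (∫ t, L y t * w t) - ∫ t, L x t * w t) =O[𝓝 x] fun y => y - x :=
  isBigO_integral_mul_sub (.of_forall fun y => (L y).2.continuous) (L x).2.continuous
    hw.continuous (isBigO_apply_sub L x)

lemma isBigO_integral_res₁_mul_sub {w : Torus d → ℝ} (hw : IsSmooth w) :
    (fun y => (∫ t, D.res₁ (M y) (U y) t * w t) - ∫ t, D.res₁ (M x) (U x) t * w t)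
      =O[𝓝 x] fun y => y - x := by
  have hlin (y : V) : ((D.regLM ∘ₗ M - U) y : Torus d → ℝ) = fun t => -U y t + D.reg (M y) t := by
    rw [LinearMap.sub_apply, Submodule.coe_sub, LinearMap.comp_apply, coe_regLM]
    funext t
    exact sub_eq_neg_add _ _
  have hlinO := isBigO_integral_apply_mul_sub (x := x) (D.regLM ∘ₗ M - U) hw
  simp only [hlin] at hlinO
  refine (hlinO.add (D.isBigO_integral_comp_jetOf_sub M U hx D.isJetSmooth_source hw)).congr' ?_
    .rfl
  filter_upwards [(isOpen_positiveSet M).mem_nhds hx] with y hy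
  rw [D.integral_res₁_mul (M y).2 (U y).2 hy hw, D.integral_res₁_mul (M x).2 (U x).2 hx hw]
  ring

lemma isBigO_integral_res₂_mul_sub {w : Torus d → ℝ} (hw : IsSmooth w) :
    (fun y => (∫ t, D.res₂ (M y) (U y) t * w t) - ∫ t, D.res₂ (M x) (U x) t * w t)
      =O[𝓝 x] fun y => y - x := by
  have hlin (y : V) : ∫ t, (M y t - 1 + D.reg (U y) t) * w t =
      (∫ t, (M + D.regLM ∘ₗ U) y t * w t) - ∫ t, w t := by
    rw [← integral_sub ((((M + D.regLM ∘ₗ U) y).2.mul hw)).integrable hw.integrable,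
      LinearMap.add_apply, Submodule.coe_add, LinearMap.comp_apply, coe_regLM]
    congr with t
    simp only [Pi.add_apply]
    ring
  have hlinO := isBigO_integral_apply_mul_sub (x := x) (M + D.regLM ∘ₗ U) hw
  have hfluxO (i : Fin d) :=
    D.isBigO_integral_comp_jetOf_sub M U hx (D.isJetSmooth_flux i) (hw.pd i)
  have hflux₂O (i j : Fin d) :=
    D.isBigO_integral_comp_jetOf_sub M U hx (D.isJetSmooth_flux₂ i j) ((hw.pd i).pd j)
  refine ((hlinO.add (.fun_sum (s := .univ) fun i _ => hfluxO i)).add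
    (.fun_sum (s := .univ) fun i _ => .fun_sum (s := .univ) fun j _ => hflux₂O i j)).congr' ?_ .rfl
  filter_upwards [(isOpen_positiveSet M).mem_nhds hx] with y hy
  rw [D.integral_res₂_mul (M y).2 (U y).2 hy hw, D.integral_res₂_mul (M x).2 (U x).2 hx hw,
    hlin, hlin]
  simp only [Finset.sum_sub_distrib]
  ring

end LinearFamily

end RegProblem

namespace smoothFun

/-- The inclusion of `C^∞(𝕋^d)` in `L²(𝕋^d)`, as a linear map. -/
def toL2 (d : ℕ) : smoothFun d →ₗ[ℝ] Lp ℝ 2 (volume : Measure (Torus d)) :=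
  (ContinuousMap.toLp 2 volume ℝ : C(Torus d, ℝ) →L[ℝ] _) ∘ₗ toContinuous d

lemma toL2_injective (d : ℕ) : Function.Injective (toL2 d) :=
  (ContinuousMap.toLp_injective (𝕜 := ℝ) volume).comp fun _ _ hfg =>
    Subtype.ext (congrArg (fun F : C(Torus d, ℝ) => ⇑F) hfg)

lemma sq_norm_toL2 (f : smoothFun d) : ‖toL2 d f‖ ^ 2 = ∫ x, f x ^ 2 := by
  rw [← real_inner_self_eq_norm_sq]
  refine (ContinuousMap.inner_toLp (𝕜 := ℝ) volume _ _).trans ?_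
  simp only [sq]
  rfl

end smoothFun

namespace RegProblem

variable (D : RegProblem d)

section Galerkin

variable {V : Type*} [NormedAddCommGroup V] [InnerProductSpace ℝ V] (M U : V →ₗ[ℝ] smoothFun d)

/-- The weak form of the system at the state `(M x, U x)`, tested with `(M z, U z)`. -/
def weakForm (x z : V) : ℝ :=
  (∫ t, D.res₁ (M x) (U x) t * M z t) + ∫ t, D.res₂ (M x) (U x) t * U z t

lemma isLinearMap_weakForm {x : V} (hx : x ∈ positiveSet M) : IsLinearMap ℝ (D.weakForm M U x) where
  map_add z z' := by
    have hres₁ := D.isSmooth_res₁ (M x).2 (U x).2 hx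
    have hres₂ := D.isSmooth_res₂ (M x).2 (U x).2 hx
    simp only [weakForm, map_add, Submodule.coe_add, Pi.add_apply, mul_add]
    rw [integral_add (hres₁.mul (M z).2).integrable (hres₁.mul (M z').2).integrable,
      integral_add (hres₂.mul (U z).2).integrable (hres₂.mul (U z').2).integrable]
    ring
  map_smul c z := by
    simp only [weakForm, map_smul, Submodule.coe_smul, Pi.smul_apply, smul_eq_mul,
      mul_left_comm _ c, integral_const_mul, mul_add]

lemma mul_sq_norm_le_energy (hnorm : ∀ z, ‖z‖ ^ 2 = (∫ t, M z t ^ 2) + ∫ t, U z t ^ 2) (z : V) :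
    D.ε₁ * ‖z‖ ^ 2 ≤ D.energy (M z) + D.energy (U z) := by
  rw [hnorm, mul_add]
  exact add_le_add (D.integral_sq_le_energy (M z).2) (D.integral_sq_le_energy (U z).2)

variable [FiniteDimensional ℝ V]

/-- The vector representing the weak form of the system at the state `(M x, U x)`. -/
def galerkin (x : V) : V :=
  ∑ i, D.weakForm M U x (stdOrthonormalBasis ℝ V i) • stdOrthonormalBasis ℝ V i

section Positive

variable {x : V} (hx : x ∈ positiveSet M)
include hx

lemma inner_galerkin (z : V) : inner ℝ (D.galerkin M U x) z = D.weakForm M U x z := by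
  have hlin := congrArg ((D.isLinearMap_weakForm M U hx).mk')
    ((stdOrthonormalBasis ℝ V).sum_repr' z)
  simp only [map_sum, map_smul, IsLinearMap.mk'_apply, smul_eq_mul] at hlin
  simp only [galerkin, sum_inner, real_inner_smul_left, ← hlin, mul_comm]

lemma isBigO_galerkin_sub :
    (fun y => D.galerkin M U y - D.galerkin M U x) =O[𝓝 x] fun y => y - x := by
  simp only [galerkin, ← Finset.sum_sub_distrib, ← sub_smul]
  refine .fun_sum fun i _ => ?_
  have hres₁ := D.isBigO_integral_res₁_mul_sub M U hx (M (stdOrthonormalBasis ℝ V i)).2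
  have hres₂ := D.isBigO_integral_res₂_mul_sub M U hx (U (stdOrthonormalBasis ℝ V i)).2
  have hcoord : (fun y => D.weakForm M U y (stdOrthonormalBasis ℝ V i) -
      D.weakForm M U x (stdOrthonormalBasis ℝ V i)) =O[𝓝 x] fun y => y - x := by
    simpa only [weakForm, add_sub_add_comm] using hres₁.add hres₂
  refine .trans (.of_bound 1 (.of_forall fun y => ?_)) hcoord
  rw [norm_smul, OrthonormalBasis.norm_eq_one, mul_one, one_mul]

variable (hnorm : ∀ z, ‖z‖ ^ 2 = (∫ t, M z t ^ 2) + ∫ t, U z t ^ 2)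
include hnorm

lemma le_inner_galerkin_sub {y : V} (hy : y ∈ positiveSet M) :
    D.ε₁ * ‖x - y‖ ^ 2 ≤ inner ℝ (D.galerkin M U x - D.galerkin M U y) (x - y) := by
  have hres₁ {z : V} (hz : z ∈ positiveSet M) := D.isSmooth_res₁ (M z).2 (U z).2 hz
  have hres₂ {z : V} (hz : z ∈ positiveSet M) := D.isSmooth_res₂ (M z).2 (U z).2 hz
  have hmono := D.energy_add_energy_le_of_pos (M x).2 (U x).2 hx (M y).2 (U y).2 hy
  have hM : (M (x - y) : Torus d → ℝ) = fun t => M x t - M y t := by rw [map_sub]; rfl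
  have hU : (U (x - y) : Torus d → ℝ) = fun t => U x t - U y t := by rw [map_sub]; rfl
  have hM_sub := (M x).2.sub (M y).2
  have hU_sub := (U x).2.sub (U y).2
  simp only [sub_mul (D.res₁ _ _ _), sub_mul (D.res₂ _ _ _)] at hmono
  rw [integral_sub ((hres₁ hx).mul hM_sub).integrable ((hres₁ hy).mul hM_sub).integrable,
    integral_sub ((hres₂ hx).mul hU_sub).integrable ((hres₂ hy).mul hU_sub).integrable] at hmono
  have henergy := D.mul_sq_norm_le_energy M U hnorm (x - y)
  rw [inner_sub_left, D.inner_galerkin M U hx, D.inner_galerkin M U hy, weakForm, weakForm]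
  rw [hM, hU] at henergy ⊢
  linarith

variable {a : V} (hMa : ∀ t, M a t = 1) (hUa : ∀ t, U a t = 0)
include hMa hUa

lemma le_inner_galerkin :
    D.ε₁ / 2 * ‖x - a‖ ^ 2 + (∫ t, D.β (M x t) * (M x t - 1)) - D.aprioriConst ≤
      inner ℝ (D.galerkin M U x) (x - a) := by
  have hM : (M (x - a) : Torus d → ℝ) = fun t => M x t - 1 := by
    funext t
    rw [← hMa t, map_sub]
    rfl
  have hU : (U (x - a) : Torus d → ℝ) = U x := by
    funext t
    rw [← sub_zero (U x t), ← hUa t, map_sub]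
    rfl
  have hest := D.apriori_estimate (M x).2 (U x).2 hx
  have henergy := D.mul_sq_norm_le_energy M U hnorm (x - a)
  rw [D.inner_galerkin M U hx, weakForm]
  rw [hM, hU] at henergy ⊢
  linarith

lemma norm_sub_le_of_norm_galerkin_le {ρ : ℝ} (hρ : ‖D.galerkin M U x‖ ≤ ρ) :
    ‖x - a‖ ≤ max 1 (2 * (ρ + D.aprioriConst) / D.ε₁) := by
  by_contra! hlt
  obtain ⟨hone, hlarge⟩ := max_lt_iff.1 hlt
  rw [div_lt_iff₀ D.ε₁_pos] at hlarge
  have hC := D.aprioriConst_nonneg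
  have hinner : inner ℝ (D.galerkin M U x) (x - a) ≤ ρ * ‖x - a‖ :=
    (real_inner_le_norm _ _).trans (mul_le_mul_of_nonneg_right hρ (norm_nonneg _))
  have hquad : D.ε₁ / 2 * ‖x - a‖ ^ 2 ≤ (ρ + D.aprioriConst) * ‖x - a‖ := by
    linarith [D.le_inner_galerkin M U hx hnorm hMa hUa,
      D.integral_penalization_mul_sub_one_nonneg hx, le_mul_of_one_le_right hC hone.le]
  nlinarith

end Positive

variable (hnorm : ∀ z, ‖z‖ ^ 2 = (∫ t, M z t ^ 2) + ∫ t, U z t ^ 2)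
  {a : V} (hMa : ∀ t, M a t = 1) (hUa : ∀ t, U a t = 0)
include hnorm hMa hUa

lemma exists_forall_le_of_norm_galerkin_le (ρ : ℝ) :
    ∃ c > 0, ∀ x ∈ positiveSet M, ‖D.galerkin M U x‖ ≤ ρ → ∀ t, c ≤ M x t := by
  set r := max 1 (2 * (ρ + D.aprioriConst) / D.ε₁)
  choose B hB hpd using fun i => exists_abs_apply_le_mul_norm (smoothFun.pdLM i ∘ₗ M)
  have hBsum : 0 ≤ ∑ i, B i := Finset.sum_nonneg fun i _ => hB i
  have hr₀ : 0 ≤ r := zero_le_one.trans (le_max_left _ _)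
  obtain ⟨c, hc, hlow⟩ := D.penalization.exists_lower_bound D.ε₁_pos D.ε₁_le D.lt_q
    (mul_nonneg hBsum (add_nonneg (norm_nonneg a) hr₀)) (ρ * r + D.aprioriConst)
  refine ⟨c, hc, fun x hx hρ => ?_⟩
  have hxr : ‖x - a‖ ≤ r := D.norm_sub_le_of_norm_galerkin_le M U hx hnorm hMa hUa hρ
  have hpd_le (i : Fin d) (t : Torus d) : |pd i (M x) t| ≤ (∑ i, B i) * (‖a‖ + r) :=
    calc |pd i (M x) t| ≤ B i * ‖x‖ := hpd i x t
      _ ≤ (∑ i, B i) * (‖a‖ + r) := by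
        gcongr
        · exact Finset.single_le_sum (fun i _ => hB i) (Finset.mem_univ i)
        · exact (norm_le_insert' x a).trans (by gcongr)
  have hinner : inner ℝ (D.galerkin M U x) (x - a) ≤ ρ * r := (real_inner_le_norm _ _).trans
    (mul_le_mul hρ hxr (norm_nonneg _) ((norm_nonneg _).trans hρ))
  have hsq : 0 ≤ D.ε₁ / 2 * ‖x - a‖ ^ 2 := mul_nonneg (half_pos D.ε₁_pos).le (sq_nonneg _)
  refine hlow _ ((M x).2.isContDiff 1) hx hpd_le ?_
  linarith [D.le_inner_galerkin M U hx hnorm hMa hUa]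

lemma exists_galerkin_eq_zero : ∃ x ∈ positiveSet M, D.galerkin M U x = 0 := by
  have ha : a ∈ positiveSet M := fun t => by rw [hMa]; exact one_pos
  obtain ⟨c, hc, hlow⟩ :=
    D.exists_forall_le_of_norm_galerkin_le M U hnorm hMa hUa ‖D.galerkin M U a‖
  have hball {x : V} (hx : x ∈ positiveSet M) (hxa : ‖D.galerkin M U x‖ ≤ ‖D.galerkin M U a‖) :=
    mem_closedBall_iff_norm.2 (D.norm_sub_le_of_norm_galerkin_le M U hx hnorm hMa hUa hxa)
  exact exists_zero_of_stronglyMonotone D.ε₁_pos (isOpen_positiveSet M)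
    (fun x hx => D.isBigO_galerkin_sub M U hx)
    (fun x hx y hy => D.le_inner_galerkin_sub M U hx hnorm hy)
    ((isCompact_closedBall a _).inter_right (isClosed_setOf_forall_le M c))
    (fun x hx t => hc.trans_le (hx.2 t)) ha fun x hx hxa => ⟨hball hx hxa, hlow x hx hxa⟩

end Galerkin

lemma exists_galerkin_of_norm_eq {E : Type*} [NormedAddCommGroup E] [InnerProductSpace ℝ E]
    [FiniteDimensional ℝ E] (L : E →ₗ[ℝ] smoothFun d) (hL : ∀ y, ‖y‖ ^ 2 = ∫ x, L y x ^ 2) {e : E}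
    (he : ∀ x, L e x = 1) :
    ∃ m u : E, (∀ x, 0 < L m x) ∧ ∀ w : E,
      ∫ x, D.res₁ (L m) (L u) x * L w x = 0 ∧ ∫ x, D.res₂ (L m) (L u) x * L w x = 0 := by
  let M : WithLp 2 (E × E) →ₗ[ℝ] smoothFun d := L ∘ₗ WithLp.fstₗ 2 ℝ E E
  let U : WithLp 2 (E × E) →ₗ[ℝ] smoothFun d := L ∘ₗ WithLp.sndₗ 2 ℝ E E
  have hnorm (z : WithLp 2 (E × E)) : ‖z‖ ^ 2 = (∫ t, M z t ^ 2) + ∫ t, U z t ^ 2 := by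
    rw [WithLp.prod_norm_sq_eq_of_L2, hL, hL]
    rfl
  obtain ⟨x, hx, hzero⟩ := D.exists_galerkin_eq_zero M U hnorm (a := WithLp.toLp 2 (e, 0)) he
    (congrFun (congrArg Subtype.val L.map_zero))
  have hweak (v w : E) : (∫ t, D.res₁ (L x.fst) (L x.snd) t * L v t) +
      ∫ t, D.res₂ (L x.fst) (L x.snd) t * L w t = 0 := by
    have hinner := D.inner_galerkin M U hx (WithLp.toLp 2 (v, w))
    rw [hzero, inner_zero_left] at hinner
    exact hinner.symm
  exact ⟨x.fst, x.snd, hx, fun w => ⟨by simpa using hweak w 0, by simpa using hweak 0 w⟩⟩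

lemma exists_galerkin (W : Submodule ℝ (smoothFun d)) [FiniteDimensional ℝ W] {e : smoothFun d}
    (he : e ∈ W) (he₁ : ∀ x, e x = 1) :
    ∃ m ∈ W, ∃ u ∈ W, (∀ x, 0 < m x) ∧ ∀ w ∈ W,
      ∫ x, D.res₁ m u x * w x = 0 ∧ ∫ x, D.res₂ m u x * w x = 0 := by
  let T := smoothFun.toL2 d ∘ₗ W.subtype
  let Φ := LinearEquiv.ofInjective T ((smoothFun.toL2_injective d).comp W.injective_subtype)
  obtain ⟨m, u, hpos, hweak⟩ := D.exists_galerkin_of_norm_eq (W.subtype ∘ₗ Φ.symm.toLinearMap)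
    (fun y => by
      obtain ⟨w, rfl⟩ := Φ.surjective y
      exact (smoothFun.sq_norm_toL2 (w : smoothFun d)).trans (by simp))
    (e := Φ ⟨e, he⟩) (fun x => by simp [he₁])
  exact ⟨_, (Φ.symm m).2, _, (Φ.symm u).2, hpos, fun w hw => by simpa using hweak (Φ ⟨w, hw⟩)⟩

end RegProblem

/-! ### Compactness of `H^(s+1)` in `H^s` -/

lemma finite_setOf_weight_le (R : ℝ) : {k : Fin d → ℤ | weight k ≤ R}.Finite := by
  refine (isCompact_closedBall (0 : Fin d → ℤ) (R - 1)).finite_of_discrete.subset fun k hk => ?_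
  rw [mem_closedBall_zero_iff]
  exact le_sub_iff_add_le'.2 hk

lemma sqNormH_sub_le {s : ℕ} {c c' : (Fin d → ℤ) → ℂ} (h : MemH s c) (h' : MemH s c') :
    sqNormH s (fun k => c k - c' k) ≤ 2 * (sqNormH s c + sqNormH s c') := by
  rw [sqNormH, sqNormH, sqNormH, ← Summable.tsum_add h h', ← tsum_mul_left]
  refine (h.sub h').tsum_le_tsum (fun k => ?_) ((Summable.add h h').mul_left 2)
  calc weight k ^ (2 * s) * ‖c k - c' k‖ ^ 2
      ≤ weight k ^ (2 * s) * (2 * (‖c k‖ ^ 2 + ‖c' k‖ ^ 2)) := by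
        refine mul_le_mul_of_nonneg_left ?_ (pow_nonneg (weight_pos k).le _)
        exact (pow_le_pow_left₀ (norm_nonneg _) (norm_sub_le (c k) (c' k)) 2).trans add_sq_le
    _ = _ := by ring

lemma tsum_le_sum_add_tsum {ι : Type*} {f g : ι → ℝ} (hf : Summable f) (hg : Summable g)
    (hg₀ : ∀ i, 0 ≤ g i) (T : Finset ι) (h : ∀ i ∉ T, f i ≤ g i) :
    ∑' i, f i ≤ ∑ i ∈ T, f i + ∑' i, g i := by
  rw [← hf.sum_add_tsum_compl (s := T)]
  have htail : ∑' i : ↥((T : Set ι)ᶜ), f i ≤ ∑' i : ↥((T : Set ι)ᶜ), g i :=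
    Summable.tsum_le_tsum (fun i => h i.1 i.2) (hf.subtype _) (hg.subtype _)
  exact add_le_add_right (htail.trans (Summable.tsum_subtype_le g _ hg₀ hg)) _

lemma sqNormH_le_sum_add {s : ℕ} {c : (Fin d → ℤ) → ℂ} (hc : MemH (s + 1) c) {R : ℝ}
    (hR : 0 < R) :
    sqNormH s c ≤ ∑ k ∈ (finite_setOf_weight_le R).toFinset, weight k ^ (2 * s) * ‖c k‖ ^ 2 +
      sqNormH (s + 1) c / R ^ 2 := by
  rw [sqNormH, sqNormH, ← tsum_div_const]
  refine tsum_le_sum_add_tsum (hc.mono (Nat.le_succ s)) (Summable.div_const hc _)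
    (fun k => div_nonneg (weight_pow_mul_nonneg k _ (sq_nonneg _)) (sq_nonneg R)) _ fun k hk => ?_
  have hRk : R < weight k := by simpa using hk
  rw [le_div_iff₀ (by positivity)]
  calc weight k ^ (2 * s) * ‖c k‖ ^ 2 * R ^ 2
      ≤ weight k ^ (2 * s) * ‖c k‖ ^ 2 * weight k ^ 2 := by
        gcongr
        exact weight_pow_mul_nonneg k _ (sq_nonneg _)
    _ = _ := by ring

lemma tendsto_sqNormH_of_tendsto {s : ℕ} {e : ℕ → (Fin d → ℤ) → ℂ} {A : ℝ}
    (he : ∀ n, MemH (s + 1) (e n)) (hA : ∀ n, sqNormH (s + 1) (e n) ≤ A)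
    (hlim : ∀ k, Tendsto (fun n => e n k) atTop (𝓝 0)) :
    Tendsto (fun n => sqNormH s (e n)) atTop (𝓝 0) := by
  refine tendsto_order.2 ⟨fun a ha => .of_forall fun n => ha.trans_le (sqNormH_nonneg _ _),
    fun ε hε => ?_⟩
  obtain ⟨R, hR, hRA⟩ : ∃ R : ℝ, 0 < R ∧ A / R ^ 2 < ε / 2 := by
    have hlim : Tendsto (fun R : ℝ => A / R ^ 2) atTop (𝓝 0) :=
      tendsto_const_nhds.div_atTop (tendsto_pow_atTop two_ne_zero)
    exact ((eventually_gt_atTop 0).and (hlim.eventually_lt_const (half_pos hε))).exists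
  have hlow : Tendsto (fun n => ∑ k ∈ (finite_setOf_weight_le (d := d) R).toFinset,
      weight k ^ (2 * s) * ‖e n k‖ ^ 2) atTop (𝓝 0) := by
    simpa using tendsto_finsetSum (finite_setOf_weight_le (d := d) R).toFinset fun k _ =>
      (((hlim k).norm).pow 2).const_mul (weight k ^ (2 * s))
  filter_upwards [hlow.eventually_lt_const (half_pos hε)] with n hn
  calc sqNormH s (e n) ≤ _ := sqNormH_le_sum_add (he n) hR
    _ < ε / 2 + ε / 2 := add_lt_add hn ((div_le_div_of_nonneg_right (hA n) (by positivity)).trans_lt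
        hRA)
    _ = ε := add_halves ε

lemma norm_le_sqrt_sqNormH {s : ℕ} {c : (Fin d → ℤ) → ℂ} (hc : MemH s c) (k : Fin d → ℤ) :
    ‖c k‖ ≤ √(sqNormH s c) :=
  Real.le_sqrt_of_sq_le <|
    (le_mul_of_one_le_left (sq_nonneg _) (one_le_pow₀ (one_le_weight k))).trans <|
      hc.le_tsum k fun j _ => weight_pow_mul_nonneg j _ (sq_nonneg _)

lemma memH_and_sqNormH_le_of_tendsto {s : ℕ} {c : ℕ → (Fin d → ℤ) → ℂ} {c' : (Fin d → ℤ) → ℂ}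
    {A : ℝ} (hc : ∀ n, MemH s (c n)) (hA : ∀ n, sqNormH s (c n) ≤ A)
    (hlim : ∀ k, Tendsto (fun n => c n k) atTop (𝓝 (c' k))) : MemH s c' ∧ sqNormH s c' ≤ A := by
  have hpartial (T : Finset (Fin d → ℤ)) : ∑ k ∈ T, weight k ^ (2 * s) * ‖c' k‖ ^ 2 ≤ A :=
    le_of_tendsto (tendsto_finsetSum T fun k _ =>
      (((hlim k).norm).pow 2).const_mul (weight k ^ (2 * s))) <| .of_forall fun n =>
        ((hc n).sum_le_tsum T fun k _ => weight_pow_mul_nonneg k _ (sq_nonneg _)).trans (hA n)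
  have hc' : MemH s c' :=
    summable_of_sum_le (fun k => weight_pow_mul_nonneg k _ (sq_nonneg _)) hpartial
  exact ⟨hc', hc'.tsum_le_of_sum_le hpartial⟩

lemma exists_subseq_tendsto_sqNormH {s : ℕ} {c : ℕ → (Fin d → ℤ) → ℂ} {A : ℝ}
    (hc : ∀ n, MemH (s + 1) (c n)) (hA : ∀ n, sqNormH (s + 1) (c n) ≤ A) :
    ∃ (σ : ℕ → ℕ) (c' : (Fin d → ℤ) → ℂ), StrictMono σ ∧ MemH s c' ∧
      Tendsto (fun n => sqNormH s fun k => c (σ n) k - c' k) atTop (𝓝 0) := by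
  have hcompact : IsCompact (Set.univ.pi fun _ : Fin d → ℤ => Metric.closedBall (0 : ℂ) √A) :=
    isCompact_univ_pi fun _ => isCompact_closedBall _ _
  obtain ⟨c', -, σ, hσ, hlim⟩ := hcompact.tendsto_subseq (x := c) fun n k _ =>
    mem_closedBall_zero_iff.2 <|
      (norm_le_sqrt_sqNormH (hc n) k).trans (Real.sqrt_le_sqrt (hA n))
  rw [tendsto_pi_nhds] at hlim
  obtain ⟨hc', hA'⟩ := memH_and_sqNormH_le_of_tendsto (fun n => hc (σ n)) (fun n => hA (σ n)) hlim
  refine ⟨σ, c', hσ, hc'.mono (Nat.le_succ s), tendsto_sqNormH_of_tendsto (A := 2 * (A + A))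
    (fun n => (hc (σ n)).sub hc') (fun n => ?_) fun k => ?_⟩
  · refine (sqNormH_sub_le (hc (σ n)) hc').trans ?_
    gcongr
    exact hA (σ n)
  · simpa using (hlim k).sub_const (c' k)

lemma abs_sub_re_tsum_le {f : Torus d → ℝ} (hf : Continuous f) {c : (Fin d → ℤ) → ℂ}
    (hfs : Summable fun k => ‖coeff f k‖) (hc : Summable fun k => ‖c k‖) (x : Torus d) :
    |f x - (∑' k, c k * mFourier k x).re| ≤ ∑' k, ‖coeff f k - c k‖ := by
  have hnorm (c : (Fin d → ℤ) → ℂ) (k : Fin d → ℤ) : ‖c k * mFourier k x‖ = ‖c k‖ := by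
    rw [norm_mul, norm_mFourier_apply, mul_one]
  have hseries : Summable fun k => c k * mFourier k x := .of_norm (by simpa only [hnorm] using hc)
  have hsum := (hasSum_coeff_mul_mFourier hf hfs x).sub hseries.hasSum
  simp only [← sub_mul] at hsum
  rw [← Complex.ofReal_re (f x), ← Complex.sub_re, ← hsum.tsum_eq]
  refine (Complex.abs_re_le_norm _).trans ?_
  simpa only [hnorm (fun k => coeff f k - c k)] using
    norm_tsum_le_tsum_norm (f := fun k => (coeff f k - c k) * mFourier k x) <| by
      simpa only [hnorm (fun k => coeff f k - c k)] using
        (hfs.add hc).of_nonneg_of_le (fun k => norm_nonneg _) fun k => norm_sub_le _ _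

lemma tendsto_coeff_of_abs_sub_le {f : ℕ → Torus d → ℝ} {g : Torus d → ℝ}
    (hf : ∀ n, Continuous (f n)) (hg : Continuous g) {δ : ℕ → ℝ} (hδ : Tendsto δ atTop (𝓝 0))
    (h : ∀ n x, |f n x - g x| ≤ δ n) (k : Fin d → ℤ) :
    Tendsto (fun n => coeff (f n) k) atTop (𝓝 (coeff g k)) := by
  refine tendsto_iff_norm_sub_tendsto_zero.2
    (squeeze_zero (fun n => norm_nonneg _) (fun n => ?_) hδ)
  rw [← coeff_sub (integrable_of_continuous (hf n)) (integrable_of_continuous hg)]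
  exact norm_coeff_le (h n) k

lemma exists_continuous_coeff_eq {f : ℕ → Torus d → ℝ} (hf : ∀ n, Continuous (f n))
    (hfs : ∀ n, Summable fun k => ‖coeff (f n) k‖) {c : (Fin d → ℤ) → ℂ}
    (hc : Summable fun k => ‖c k‖)
    (hlim : Tendsto (fun n => ∑' k, ‖coeff (f n) k - c k‖) atTop (𝓝 0)) :
    ∃ g : Torus d → ℝ, Continuous g ∧ coeff g = c := by
  let g : Torus d → ℝ := fun x => (∑' k, c k * mFourier k x).re
  have hg : Continuous g := Complex.continuous_re.comp <|
    continuous_tsum (fun k => continuous_const.mul (mFourier k).continuous) hc fun k x => by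
      rw [norm_mul, norm_mFourier_apply, mul_one]
  have hsub (n : ℕ) : Summable fun k => ‖coeff (f n) k - c k‖ :=
    ((hfs n).add hc).of_nonneg_of_le (fun k => norm_nonneg _) fun k => norm_sub_le _ _
  refine ⟨g, hg, funext fun k => tendsto_nhds_unique (tendsto_coeff_of_abs_sub_le hf hg hlim
    (fun n x => abs_sub_re_tsum_le (hf n) (hfs n) hc x) k) ?_⟩
  exact tendsto_iff_norm_sub_tendsto_zero.2 <| squeeze_zero (fun n => norm_nonneg _)
    (fun n => (hsub n).le_tsum k fun j _ => norm_nonneg _) hlim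

/-- Convergence of a sequence of smooth functions to a continuous function in the `H^s` norm. -/
structure TendstoH (s : ℕ) (f : ℕ → Torus d → ℝ) (g : Torus d → ℝ) : Prop where
  isSmooth (n : ℕ) : IsSmooth (f n)
  continuous : Continuous g
  memH : MemH s (coeff g)
  tendsto : Tendsto (fun n => sqNormH s (coeff fun x => f n x - g x)) atTop (𝓝 0)

lemma exists_subseq_tendstoH {s : ℕ} (hs : d < 2 * s) {f : ℕ → Torus d → ℝ} {A : ℝ}
    (hf : ∀ n, IsSmooth (f n)) (hA : ∀ n, sqNormH (s + 1) (coeff (f n)) ≤ A) :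
    ∃ (σ : ℕ → ℕ) (g : Torus d → ℝ), StrictMono σ ∧ TendstoH s (f ∘ σ) g := by
  obtain ⟨σ, c, hσ, hc, hlim⟩ := exists_subseq_tendsto_sqNormH (fun n => (hf n).memH _) hA
  have hsup : Tendsto (fun n => ∑' k, ‖coeff (f (σ n)) k - c k‖) atTop (𝓝 0) :=
    squeeze_zero (fun n => tsum_nonneg fun k => norm_nonneg _)
      (fun n => ((((hf (σ n)).memH s).sub hc).summable_norm_and_tsum_le hs).2)
      (by simpa using hlim.sqrt.const_mul (embConst d s 0))
  obtain ⟨g, hg, rfl⟩ := exists_continuous_coeff_eq (fun n => (hf (σ n)).continuous)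
    (fun n => (((hf (σ n)).memH s).summable_norm_and_tsum_le hs).1)
    (hc.summable_norm_and_tsum_le hs).1 hsup
  refine ⟨σ, g, hσ, fun n => hf (σ n), hg, hc, hlim.congr fun n => ?_⟩
  exact congrArg _ (funext fun k => (coeff_sub
    (integrable_of_continuous (hf (σ n)).continuous) (integrable_of_continuous hg) k).symm)

/-- The constant of the embedding of `H^s` into `C²`. -/
def embConst₂ (d s : ℕ) : ℝ :=
  embConst d s 0 + 2 * π * embConst d s 1 + (2 * π) ^ 2 * embConst d s 2

lemma embConst_nonneg (d s n : ℕ) : 0 ≤ embConst d s n := Real.sqrt_nonneg _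

lemma two_pi_pow_mul_embConst_le {n : ℕ} (d s : ℕ) (hn : n ≤ 2) :
    (2 * π) ^ n * embConst d s n ≤ embConst₂ d s := by
  have h (n : ℕ) : 0 ≤ (2 * π) ^ n * embConst d s n :=
    mul_nonneg (by positivity) (embConst_nonneg d s n)
  have h₀ := h 0
  have h₁ := h 1
  have h₂ := h 2
  unfold embConst₂
  interval_cases n <;> linarith

lemma embConst₂_nonneg (d s : ℕ) : 0 ≤ embConst₂ d s :=
  (mul_nonneg (by positivity) (embConst_nonneg d s 0)).trans <|
    two_pi_pow_mul_embConst_le d s zero_le_two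

lemma abs_le_embConst₂ {f g : Torus d → ℝ} (hg : Continuous g) {s n : ℕ} (hn : n ≤ 2)
    (hs : 4 + d < 2 * s) (h : MemH s (coeff f))
    (hle : ∀ k, ‖coeff g k‖ ≤ (2 * π * weight k) ^ n * ‖coeff f k‖) (x : Torus d) :
    |g x| ≤ embConst₂ d s * √(sqNormH s (coeff f)) := by
  obtain ⟨hsum, htsum⟩ := h.summable_and_tsum_le (n := n) (by omega)
  have hle (k : Fin d → ℤ) : ‖coeff g k‖ ≤ (2 * π) ^ n * (weight k ^ n * ‖coeff f k‖) :=
    (hle k).trans_eq (by rw [mul_pow, mul_assoc])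
  have hsum' := hsum.mul_left ((2 * π) ^ n)
  have hgs : Summable fun k => ‖coeff g k‖ := hsum'.of_nonneg_of_le (fun k => norm_nonneg _) hle
  calc |g x| ≤ ∑' k, ‖coeff g k‖ := abs_le_tsum_norm_coeff hg hgs x
    _ ≤ ∑' k, (2 * π) ^ n * (weight k ^ n * ‖coeff f k‖) := hgs.tsum_le_tsum hle hsum'
    _ ≤ (2 * π) ^ n * (embConst d s n * √(sqNormH s (coeff f))) := by
        rw [tsum_mul_left]
        gcongr
    _ ≤ embConst₂ d s * √(sqNormH s (coeff f)) := by
        rw [← mul_assoc]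
        gcongr
        exact two_pi_pow_mul_embConst_le d s hn

lemma MemH.abs_le {f : Torus d → ℝ} {s : ℕ} (h : MemH s (coeff f)) (hf : Continuous f)
    (hs : 4 + d < 2 * s) (x : Torus d) : |f x| ≤ embConst₂ d s * √(sqNormH s (coeff f)) :=
  abs_le_embConst₂ hf (n := 0) (by omega) hs h (fun k => by simp) x

lemma MemH.abs_pd_le {f : Torus d → ℝ} {s : ℕ} (h : MemH s (coeff f)) (hf : IsContDiff 1 f)
    (hs : 4 + d < 2 * s) (i : Fin d) (x : Torus d) :
    |pd i f x| ≤ embConst₂ d s * √(sqNormH s (coeff f)) :=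
  abs_le_embConst₂ (hf.continuous_pd i) (n := 1) (by omega) hs h (fun k => by
    rw [coeff_pd hf, norm_mul, pow_one]
    gcongr
    exact norm_symbol_le k i) x

lemma MemH.abs_pd_pd_le {f : Torus d → ℝ} {s : ℕ} (h : MemH s (coeff f)) (hf : IsContDiff 2 f)
    (hs : 4 + d < 2 * s) (i j : Fin d) (x : Torus d) :
    |pd i (pd j f) x| ≤ embConst₂ d s * √(sqNormH s (coeff f)) := by
  have hf₁ : IsContDiff 1 f := hf.of_le (by norm_num)
  have hpd : IsContDiff 1 (pd j f) := hf.pd (n := 1) j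
  refine abs_le_embConst₂ (hpd.continuous_pd i) (n := 2) le_rfl hs h (fun k => ?_) x
  rw [coeff_pd hpd, coeff_pd hf₁, norm_mul, norm_mul, ← mul_assoc, pow_two]
  gcongr
  · exact mul_nonneg (by positivity) (weight_pos k).le
  · exact norm_symbol_le k i
  · exact norm_symbol_le k j

/-- The distance of two functions in the `H^s` norm. -/
def distH (s : ℕ) (f g : Torus d → ℝ) : ℝ := √(sqNormH s (coeff fun x => f x - g x))

lemma distH_nonneg (s : ℕ) (f g : Torus d → ℝ) : 0 ≤ distH s f g := Real.sqrt_nonneg _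

lemma isBigO_fst_of_abs_le {F : ℕ → Torus d → ℝ} {C : ℝ} {δ φ : ℕ → ℝ} (hC : 0 ≤ C)
    (hF : ∀ n x, |F n x| ≤ C * δ n) (hδ : ∀ n, δ n ≤ φ n) :
    (fun z : ℕ × Torus d => F z.1 z.2) =O[atTop ×ˢ ⊤] fun z => φ z.1 :=
  .of_bound C <| .of_forall fun z => (hF z.1 z.2).trans <|
    mul_le_mul_of_nonneg_left ((hδ z.1).trans (le_abs_self _)) hC

lemma isBigO_coeff_sub {f : ℕ → Torus d → ℝ} {g : Torus d → ℝ} {φ : ℕ → ℝ}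
    (hf : ∀ n, Continuous (f n)) (hg : Continuous g)
    (hsub : (fun z : ℕ × Torus d => f z.1 z.2 - g z.2) =O[atTop ×ˢ ⊤] fun z => φ z.1)
    (k : Fin d → ℤ) : (fun n => coeff (f n) k - coeff g k) =O[atTop] φ := by
  obtain ⟨C, hC⟩ := hsub.bound
  refine .of_bound C ?_
  filter_upwards [hC.curry] with n hn
  rw [← coeff_sub (integrable_of_continuous (hf n)) (integrable_of_continuous hg)]
  exact norm_coeff_le hn k

namespace TendstoH

variable {s : ℕ} {f : ℕ → Torus d → ℝ} {g : Torus d → ℝ}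

lemma comp (h : TendstoH s f g) {σ : ℕ → ℕ} (hσ : StrictMono σ) : TendstoH s (f ∘ σ) g :=
  ⟨fun n => h.isSmooth (σ n), h.continuous, h.memH, h.tendsto.comp hσ.tendsto_atTop⟩

lemma tendsto_distH (h : TendstoH s f g) : Tendsto (fun n => distH s (f n) g) atTop (𝓝 0) := by
  simpa only [distH, Real.sqrt_zero] using h.tendsto.sqrt

lemma memH_sub (h : TendstoH s f g) (n : ℕ) : MemH s (coeff fun x => f n x - g x) := by
  rw [funext (coeff_sub (h.isSmooth n).integrable (integrable_of_continuous h.continuous))]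
  exact ((h.isSmooth n).memH s).sub h.memH

lemma isContDiff_two (h : TendstoH s f g) (hs : 4 + d < 2 * s) : IsContDiff 2 g :=
  h.memH.isContDiff (n := 2) h.continuous hs

lemma abs_sub_le (h : TendstoH s f g) (hs : 4 + d < 2 * s) (n : ℕ) (x : Torus d) :
    |f n x - g x| ≤ embConst₂ d s * distH s (f n) g :=
  (h.memH_sub n).abs_le ((h.isSmooth n).continuous.sub h.continuous) hs x

lemma abs_pd_sub_le (h : TendstoH s f g) (hs : 4 + d < 2 * s) (i : Fin d) (n : ℕ) (x : Torus d) :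
    |pd i (f n) x - pd i g x| ≤ embConst₂ d s * distH s (f n) g := by
  have hf : IsContDiff 1 (f n) := (h.isSmooth n).isContDiff 1
  have hg : IsContDiff 1 g := (h.isContDiff_two hs).of_le (by norm_num)
  rw [← congrFun (hf.pd_sub hg i) x]
  exact (h.memH_sub n).abs_pd_le (hf.sub hg) hs i x

lemma abs_pd_pd_sub_le (h : TendstoH s f g) (hs : 4 + d < 2 * s) (i j : Fin d) (n : ℕ)
    (x : Torus d) :
    |pd i (pd j (f n)) x - pd i (pd j g) x| ≤ embConst₂ d s * distH s (f n) g := by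
  have hf : IsContDiff 2 (f n) := (h.isSmooth n).isContDiff 2
  have hg := h.isContDiff_two hs
  have hpd : pd j (fun x => f n x - g x) = fun x => pd j (f n) x - pd j g x :=
    IsContDiff.pd_sub (hf.of_le (by norm_num)) (hg.of_le (by norm_num)) j
  rw [← congrFun (IsContDiff.pd_sub (hf.pd (n := 1) j) (hg.pd (n := 1) j) i) x, ← hpd]
  exact (h.memH_sub n).abs_pd_pd_le (hf.sub hg) hs i j x

lemma tendsto_apply (h : TendstoH s f g) (hs : 4 + d < 2 * s) (x : Torus d) :
    Tendsto (fun n => f n x) atTop (𝓝 (g x)) :=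
  tendsto_iff_norm_sub_tendsto_zero.2 <| squeeze_zero (fun n => norm_nonneg _)
    (fun n => h.abs_sub_le hs n x) (by simpa using h.tendsto_distH.const_mul (embConst₂ d s))

lemma tendsto_coeff (h : TendstoH s f g) (hs : 4 + d < 2 * s) (k : Fin d → ℤ) :
    Tendsto (fun n => coeff (f n) k) atTop (𝓝 (coeff g k)) :=
  tendsto_coeff_of_abs_sub_le (fun n => (h.isSmooth n).continuous) h.continuous
    (by simpa using h.tendsto_distH.const_mul (embConst₂ d s)) (h.abs_sub_le hs) k

end TendstoH

namespace RegProblem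

variable (D : RegProblem d) {s : ℕ} {mn un : ℕ → Torus d → ℝ} {m u : Torus d → ℝ}

lemma exists_isBigO_jetOf_sub (hs : 4 + d < 2 * s) (hm : TendstoH s mn m) (hu : TendstoH s un u)
    (hposn : ∀ n x, 0 < mn n x) (hpos : ∀ x, 0 < m x) :
    ∃ φ : ℕ → ℝ, Tendsto φ atTop (𝓝 0) ∧
      (fun z : ℕ × Torus d => D.jetOf (mn z.1) (un z.1) z.2 - D.jetOf m u z.2)
        =O[atTop ×ˢ ⊤] fun z => φ z.1 := by
  obtain ⟨δ, hδ, hle⟩ := tendsto_nonlocal D.assumptionH (by omega) hm.continuous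
    (fun x => (hpos x).le) hm.memH (fun n => (hm.isSmooth n).continuous)
    (fun n x => (hposn n x).le) (fun n => (hm.isSmooth n).memH s) hm.tendsto
  have hδ₀ (n : ℕ) : 0 ≤ δ n := (abs_nonneg _).trans (hle n 0)
  have hu₀ (n : ℕ) : 0 ≤ distH s (un n) u := distH_nonneg _ _ _
  have hm₀ (n : ℕ) : 0 ≤ distH s (mn n) m := distH_nonneg _ _ _
  obtain ⟨φ, hφ, huφ, hmφ, hδφ⟩ : ∃ φ : ℕ → ℝ, Tendsto φ atTop (𝓝 0) ∧
      (∀ n, distH s (un n) u ≤ φ n) ∧ (∀ n, distH s (mn n) m ≤ φ n) ∧ ∀ n, δ n ≤ φ n :=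
    ⟨fun n => distH s (un n) u + distH s (mn n) m + δ n,
      by simpa using (hu.tendsto_distH.add hm.tendsto_distH).add hδ,
      fun n => by linarith [hδ₀ n, hm₀ n], fun n => by linarith [hδ₀ n, hu₀ n],
      fun n => by linarith [hu₀ n, hm₀ n]⟩
  have hC := embConst₂_nonneg d s
  exact ⟨φ, hφ, isBigO_jet_sub (θ := fun n => D.h (bold (mn n)))
    (fun i => isBigO_fst_of_abs_le hC (hu.abs_pd_sub_le hs i) huφ)
    (fun i j => isBigO_fst_of_abs_le hC (hu.abs_pd_pd_sub_le hs i j) huφ)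
    (isBigO_fst_of_abs_le hC (hm.abs_sub_le hs) hmφ)
    (isBigO_fst_of_abs_le zero_le_one (by simpa only [one_mul] using hle) hδφ)⟩

lemma tendsto_coeff_comp_jetOf {Ψ : Torus d → JetSpace d → ℝ} (hΨ : IsJetSmooth Ψ)
    (hs : 4 + d < 2 * s) (hm : TendstoH s mn m) (hu : TendstoH s un u)
    (hposn : ∀ n x, 0 < mn n x) (hpos : ∀ x, 0 < m x) (k : Fin d → ℤ) :
    Tendsto (fun n => coeff (fun x => Ψ x (D.jetOf (mn n) (un n) x)) k) atTop
      (𝓝 (coeff (fun x => Ψ x (D.jetOf m u x)) k)) := by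
  obtain ⟨φ, hφ, hjet⟩ := D.exists_isBigO_jetOf_sub hs hm hu hposn hpos
  have hθ : Continuous (D.h (bold m)) := (D.h (bold m)).continuous
  have hlim : IsContDiff 0 fun x => Ψ x (D.jetOf m u x) :=
    hΨ.isContDiff (n := 0) (hu.isContDiff_two hs)
      (contDiff_zero.2 (hm.continuous.comp isQuotientMap_proj.continuous))
      (contDiff_zero.2 (hθ.comp isQuotientMap_proj.continuous)) hpos
  have hcoeff := isBigO_coeff_sub
    (fun n => (isSmooth_jetOf hΨ (hm.isSmooth n) (hu.isSmooth n) (hposn n)).continuous)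
    hlim.continuous (hΨ.isBigO_comp_sub hφ (J := fun n => D.jetOf (mn n) (un n))
      (continuous_jet (hu.isContDiff_two hs) hm.continuous hθ) hpos hjet) k
  exact tendsto_sub_nhds_zero_iff.1 (hcoeff.trans_tendsto hφ)

end RegProblem

/-! ### Trigonometric polynomials -/

/-- The space of real trigonometric polynomials with frequencies of weight at most `R`. -/
def trigPoly (d : ℕ) (R : ℝ) : Submodule ℝ (smoothFun d) :=
  .span ℝ (Set.image2 (fun c k => ⟨trig c k, isSmooth_trig c k⟩) {1, I} {k | weight k ≤ R})

instance (R : ℝ) : FiniteDimensional ℝ (trigPoly d R) :=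
  FiniteDimensional.span_of_finite ℝ ((Set.toFinite _).image2 _ (finite_setOf_weight_le R))

lemma trig_mem_trigPoly {R : ℝ} (c : ℂ) {k : Fin d → ℤ} (hk : weight k ≤ R) :
    ⟨trig c k, isSmooth_trig c k⟩ ∈ trigPoly d R := by
  have h₁ := (trigPoly d R).smul_mem c.re <|
    Submodule.subset_span (Set.mem_image2_of_mem (Set.mem_insert 1 {I}) hk)
  have hI := (trigPoly d R).smul_mem c.im <|
    Submodule.subset_span (Set.mem_image2_of_mem (Set.mem_insert_of_mem 1 rfl) hk)
  convert (trigPoly d R).add_mem h₁ hI using 1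
  ext x
  simp [trig, sub_eq_add_neg]

lemma one_mem_trigPoly {R : ℝ} (hR : 1 ≤ R) :
    (⟨fun _ => 1, isSmooth_const 1⟩ : smoothFun d) ∈ trigPoly d R := by
  convert trig_mem_trigPoly 1 (k := 0) (by simpa [weight] using hR) using 1
  ext x
  simp [trig, mFourier_zero]

lemma coeff_eq_zero_of_forall_mem_trigPoly {R : ℝ} {f : Torus d → ℝ} (hf : Continuous f)
    (h : ∀ w ∈ trigPoly d R, ∫ x, f x * w x = 0) {k : Fin d → ℤ} (hk : weight k ≤ R) :
    coeff f k = 0 := by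
  refine eq_of_forall_re_mul_eq fun c => ?_
  rw [← integral_mul_trig (integrable_of_continuous hf), mul_zero, Complex.zero_re]
  exact h _ (trig_mem_trigPoly c (by rwa [weight, norm_neg]))

namespace RegProblem

/-! ### Weak solutions -/

section Coeff

variable (D : RegProblem d) (m u : Torus d → ℝ) (k : Fin d → ℤ)

/-- The Fourier coefficients of `res₁ m u`, in a form that does not differentiate `m` and only
needs two derivatives of `u`. -/
def coeffRes₁ : ℂ :=
  D.regSymbol k * coeff m k - coeff u k + coeff (fun x => D.source x (D.jetOf m u x)) k

/-- The Fourier coefficients of `res₂ m u`, in a form that does not differentiate `m` and only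
needs two derivatives of `u`. -/
def coeffRes₂ : ℂ :=
  coeff m k - coeff (fun _ => 1) k + D.regSymbol k * coeff u k
    - ∑ i, symbol k i * coeff (fun x => D.flux i x (D.jetOf m u x)) k
    + ∑ i, ∑ j, symbol k i * (symbol k j * coeff (fun x => D.flux₂ i j x (D.jetOf m u x)) k)

variable {m u} (hm : IsSmooth m) (hu : IsSmooth u) (hpos : ∀ x, 0 < m x)
include hm hu hpos

lemma coeff_res₁ : coeff (D.res₁ m u) k = D.coeffRes₁ m u k := by
  have hreg := D.isSmooth_reg hm
  simp only [res₁_eq, neg_add_eq_sub]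
  rw [coeff_add (hreg.sub hu).integrable
    (isSmooth_jetOf D.isJetSmooth_source hm hu hpos).integrable,
    coeff_sub hreg.integrable hu.integrable, D.coeff_reg hm, coeffRes₁]

lemma coeff_res₂ : coeff (D.res₂ m u) k = D.coeffRes₂ m u k := by
  have hone := isSmooth_const (d := d) 1
  have hflux (i : Fin d) := D.isSmooth_flux hm hu hpos i
  have hflux₂ (i j : Fin d) := D.isSmooth_flux₂ hm hu hpos i j
  have hlin := (hm.sub hone).add (D.isSmooth_reg hu)
  have hdiv : IsSmooth fun x => ∑ i, pd i (fun y => D.flux i y (D.jetOf m u y)) x :=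
    .sum fun i _ => (hflux i).pd i
  have hdiv₂ (i : Fin d) :
      IsSmooth fun x => ∑ j, pd i (pd j fun y => D.flux₂ i j y (D.jetOf m u y)) x :=
    .sum fun j _ => ((hflux₂ i j).pd j).pd i
  rw [res₂_eq, coeff_add (hlin.sub hdiv).integrable (IsSmooth.sum fun i _ => hdiv₂ i).integrable,
    coeff_sub hlin.integrable hdiv.integrable,
    coeff_add (hm.sub hone).integrable (D.isSmooth_reg hu).integrable,
    coeff_sub hm.integrable hone.integrable, D.coeff_reg hu,
    coeff_sum _ fun i _ => ((hflux i).pd i).integrable, coeff_sum _ fun i _ => (hdiv₂ i).integrable,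
    coeffRes₂]
  congr 2
  · exact Finset.sum_congr rfl fun i _ => coeff_pd ((hflux i).isContDiff 1) i k
  · funext i
    rw [coeff_sum _ fun j _ => (((hflux₂ i j).pd j).pd i).integrable]
    refine Finset.sum_congr rfl fun j _ => ?_
    rw [coeff_pd (((hflux₂ i j).pd j).isContDiff 1), coeff_pd ((hflux₂ i j).isContDiff 1)]

end Coeff

variable (D : RegProblem d)

lemma tendsto_coeffRes {s : ℕ} {mn un : ℕ → Torus d → ℝ} {m u : Torus d → ℝ}
    (hs : 4 + d < 2 * s) (hm : TendstoH s mn m) (hu : TendstoH s un u)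
    (hposn : ∀ n x, 0 < mn n x) (hpos : ∀ x, 0 < m x) (k : Fin d → ℤ) :
    Tendsto (fun n => D.coeffRes₁ (mn n) (un n) k) atTop (𝓝 (D.coeffRes₁ m u k)) ∧
      Tendsto (fun n => D.coeffRes₂ (mn n) (un n) k) atTop (𝓝 (D.coeffRes₂ m u k)) := by
  have hjet {Ψ : Torus d → JetSpace d → ℝ} (hΨ : IsJetSmooth Ψ) :=
    D.tendsto_coeff_comp_jetOf hΨ hs hm hu hposn hpos k
  have hmk := hm.tendsto_coeff hs k
  have huk := hu.tendsto_coeff hs k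
  constructor
  · exact ((hmk.const_mul _).sub huk).add (hjet D.isJetSmooth_source)
  · exact (((hmk.sub_const _).add (huk.const_mul _)).sub
      (tendsto_finsetSum _ fun i _ => (hjet (D.isJetSmooth_flux i)).const_mul _)).add
      (tendsto_finsetSum _ fun i _ => tendsto_finsetSum _ fun j _ =>
        ((hjet (D.isJetSmooth_flux₂ i j)).const_mul _).const_mul _)

lemma exists_galerkin_trigPoly {R : ℝ} (hR : 1 ≤ R) :
    ∃ m u : Torus d → ℝ, IsSmooth m ∧ IsSmooth u ∧ (∀ x, 0 < m x) ∧
      (D.energy (fun x => m x - 1) + D.energy u) / 2 + (∫ x, D.β (m x) * (m x - 1)) ≤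
        D.aprioriConst ∧
      ∀ k, weight k ≤ R → D.coeffRes₁ m u k = 0 ∧ D.coeffRes₂ m u k = 0 := by
  obtain ⟨m, hmR, u, huR, hpos, hweak⟩ :=
    D.exists_galerkin (trigPoly d R) (one_mem_trigPoly hR) fun _ => rfl
  refine ⟨m, u, m.2, u.2, hpos, ?_, fun k hk => ⟨?_, ?_⟩⟩
  · have hapriori := D.apriori_estimate m.2 u.2 hpos
    rw [(hweak u huR).2] at hapriori
    have := (hweak _ ((trigPoly d R).sub_mem hmR (one_mem_trigPoly hR))).1
    simp only [Submodule.coe_sub, Pi.sub_apply] at this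
    linarith
  · rw [← D.coeff_res₁ k m.2 u.2 hpos]
    exact coeff_eq_zero_of_forall_mem_trigPoly (D.isSmooth_res₁ m.2 u.2 hpos).continuous
      (fun w hw => (hweak w hw).1) hk
  · rw [← D.coeff_res₂ k m.2 u.2 hpos]
    exact coeff_eq_zero_of_forall_mem_trigPoly (D.isSmooth_res₂ m.2 u.2 hpos).continuous
      (fun w hw => (hweak w hw).2) hk

/-- The bound on the squared `H^(2p)` norms of `m - 1` and `u` given by the a priori estimate. -/
def sobolevBound : ℝ := D.ellipticConst * (2 * D.aprioriConst)

section Bounds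

variable {m u : Torus d → ℝ} (hm : IsSmooth m) (hu : IsSmooth u) (hpos : ∀ x, 0 < m x)
  (hle : (D.energy (fun x => m x - 1) + D.energy u) / 2 + (∫ x, D.β (m x) * (m x - 1)) ≤
    D.aprioriConst)
include hm hu hpos hle

omit hpos in
lemma integral_penalization_mul_le_of_energy_le : ∫ x, D.β (m x) * (m x - 1) ≤ D.aprioriConst := by
  linarith [D.energy_nonneg (hm.sub (isSmooth_const 1)), D.energy_nonneg hu]

lemma sqNormH_sub_one_le_of_energy_le :
    sqNormH (2 * D.p) (coeff fun x => m x - 1) ≤ D.sobolevBound :=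
  (D.sqNormH_le_energy (hm.sub (isSmooth_const 1))).trans <|
    mul_le_mul_of_nonneg_left (by linarith [D.energy_nonneg hu,
      D.integral_penalization_mul_sub_one_nonneg hpos]) D.ellipticConst_pos.le

lemma sqNormH_le_of_energy_le :
    sqNormH (2 * D.p) (coeff u) ≤ D.sobolevBound :=
  (D.sqNormH_le_energy hu).trans <|
    mul_le_mul_of_nonneg_left (by linarith [D.energy_nonneg (hm.sub (isSmooth_const 1)),
      D.integral_penalization_mul_sub_one_nonneg hpos]) D.ellipticConst_pos.le

lemma abs_pd_le_of_energy_le (i : Fin d) (x : Torus d) :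
    |pd i m x| ≤ embConst₂ d (2 * D.p) * √D.sobolevBound := by
  have hone := isSmooth_const (d := d) 1
  have hpd : pd i m x = pd i (fun x => m x - 1) x := by
    rw [IsContDiff.pd_sub (hm.isContDiff 1) (hone.isContDiff 1)]
    simp [pd]
  have hbound := ((hm.sub hone).memH (2 * D.p)).abs_pd_le ((hm.sub hone).isContDiff 1)
    (by have := D.order; omega) i x
  rw [hpd]
  exact hbound.trans <| mul_le_mul_of_nonneg_left
    (Real.sqrt_le_sqrt (D.sqNormH_sub_one_le_of_energy_le hm hu hpos hle)) (embConst₂_nonneg _ _)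

lemma sqNormH_density_le_of_energy_le :
    sqNormH (2 * D.p) (coeff m) ≤ 2 * (D.sobolevBound +
      sqNormH (2 * D.p) (coeff fun _ : Torus d => -1)) := by
  have hη := hm.sub (isSmooth_const 1)
  have hone := isSmooth_const (d := d) (-1)
  have hcoeff : coeff m = fun k => coeff (fun x => m x - 1) k - coeff (fun _ => -1) k := by
    rw [← funext (coeff_sub hη.integrable hone.integrable)]
    simp only [sub_neg_eq_add, sub_add_cancel]
  rw [hcoeff]
  refine (sqNormH_sub_le (hη.memH _) (hone.memH _)).trans ?_
  gcongr
  exact D.sqNormH_sub_one_le_of_energy_le hm hu hpos hle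

end Bounds

lemma exists_galerkin_bounded :
    ∃ c > 0, ∃ A B : ℝ, ∀ R : ℝ, 1 ≤ R → ∃ m u : Torus d → ℝ, IsSmooth m ∧ IsSmooth u ∧
      (∀ x, c ≤ m x) ∧ sqNormH (2 * D.p) (coeff m) ≤ A ∧ sqNormH (2 * D.p) (coeff u) ≤ B ∧
      ∀ k, weight k ≤ R → D.coeffRes₁ m u k = 0 ∧ D.coeffRes₂ m u k = 0 := by
  obtain ⟨c, hc, hlower⟩ := D.penalization.exists_lower_bound D.ε₁_pos D.ε₁_le D.lt_q
    (mul_nonneg (embConst₂_nonneg d (2 * D.p)) (Real.sqrt_nonneg D.sobolevBound)) D.aprioriConst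
  refine ⟨c, hc, 2 * (D.sobolevBound + sqNormH (2 * D.p) (coeff fun _ : Torus d => -1)),
    D.sobolevBound, fun R hR => ?_⟩
  obtain ⟨m, u, hm, hu, hpos, hle, hweak⟩ := D.exists_galerkin_trigPoly hR
  exact ⟨m, u, hm, hu,
    hlower m (hm.isContDiff 1) hpos (D.abs_pd_le_of_energy_le hm hu hpos hle)
      (D.integral_penalization_mul_le_of_energy_le hm hu hle),
    D.sqNormH_density_le_of_energy_le hm hu hpos hle, D.sqNormH_le_of_energy_le hm hu hpos hle,
    hweak⟩

/-- A pair `m, u` in `H^s` with `m > 0` that solves both equations in the sense of Fourier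
coefficients. -/
structure IsWeakSolution (s : ℕ) (m u : Torus d → ℝ) : Prop where
  continuous₁ : Continuous m
  continuous₂ : Continuous u
  memH₁ : MemH s (coeff m)
  memH₂ : MemH s (coeff u)
  pos (x : Torus d) : 0 < m x
  coeffRes₁_eq_zero (k : Fin d → ℤ) : D.coeffRes₁ m u k = 0
  coeffRes₂_eq_zero (k : Fin d → ℤ) : D.coeffRes₂ m u k = 0

lemma exists_isWeakSolution : ∃ m u : Torus d → ℝ, D.IsWeakSolution (2 * D.p - 1) m u := by
  have horder := D.order
  set s := 2 * D.p - 1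
  have hs : 4 + d < 2 * s := by omega
  obtain ⟨c, hc, A, B, hAB⟩ := D.exists_galerkin_bounded
  rw [show 2 * D.p = s + 1 by omega] at hAB
  choose mn un hmn hun hcm hmA huB hzero using fun n : ℕ => hAB (n + 1) (by simp)
  obtain ⟨σ, m, hσ, hm⟩ := exists_subseq_tendstoH (by omega) hmn hmA
  obtain ⟨τ, u, hτ, hu⟩ := exists_subseq_tendstoH (by omega) (fun n => hun (σ n))
    fun n => huB (σ n)
  replace hm := hm.comp hτ
  have hpos (x : Torus d) : 0 < m x :=
    hc.trans_le (ge_of_tendsto' (hm.tendsto_apply hs x) fun n => hcm _ x)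
  have hlim := D.tendsto_coeffRes hs hm hu (fun n x => hc.trans_le (hcm _ x)) hpos
  have hevent (k : Fin d → ℤ) : ∀ᶠ n in atTop, weight k ≤ (σ (τ n) : ℝ) + 1 :=
    (tendsto_atTop_add_const_right _ 1 (tendsto_natCast_atTop_atTop.comp
      (hσ.comp hτ).tendsto_atTop)).eventually_ge_atTop _
  exact ⟨m, u, hm.continuous, hu.continuous, hm.memH, hu.memH, hpos,
    fun k => tendsto_nhds_unique (hlim k).1 <| tendsto_const_nhds.congr' <|
      (hevent k).mono fun n hn => (hzero _ k hn).1.symm,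
    fun k => tendsto_nhds_unique (hlim k).2 <| tendsto_const_nhds.congr' <|
      (hevent k).mono fun n hn => (hzero _ k hn).2.symm⟩

end RegProblem

/-! ### Regularity of weak solutions -/

lemma MemH.symbol_mul {s : ℕ} {c : (Fin d → ℤ) → ℂ} (h : MemH (s + 1) c) (i : Fin d) :
    MemH s fun k => symbol k i * c k :=
  h.of_le (C := 2 * π) fun k => by
    have hweight := (weight_pos k).le
    calc weight k ^ s * ‖symbol k i * c k‖ ≤ weight k ^ s * (2 * π * weight k * ‖c k‖) := by
          rw [norm_mul]
          gcongr
          exact norm_symbol_le k i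
      _ = 2 * π * (weight k ^ (s + 1) * ‖c k‖) := by ring

namespace RegProblem

variable {D : RegProblem d} {s : ℕ}

lemma memH_of_regSymbol_mul {c : (Fin d → ℤ) → ℂ}
    (h : MemH s fun k => (D.regSymbol k : ℂ) * c k) : MemH (s + 4 * D.p) c :=
  h.of_le (C := D.ellipticConst) fun k => by
    have hweight := (weight_pos k).le
    calc weight k ^ (s + 4 * D.p) * ‖c k‖
        = weight k ^ s * (weight k ^ (4 * D.p) * ‖c k‖) := by ring
      _ ≤ weight k ^ s * (D.ellipticConst * D.regSymbol k * ‖c k‖) := by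
          gcongr
          exact D.weight_pow_le_regSymbol k
      _ = D.ellipticConst * (weight k ^ s * ‖(D.regSymbol k : ℂ) * c k‖) := by
          rw [norm_mul, Complex.norm_real, Real.norm_of_nonneg (D.regSymbol_pos k).le]
          ring

namespace IsWeakSolution

variable {m u : Torus d → ℝ}

lemma memH_comp_jetOf (h : D.IsWeakSolution s m u) {Ψ : Torus d → JetSpace d → ℝ}
    (hΨ : IsJetSmooth Ψ) {n : ℕ} (hs : 2 * (n + 2) + d < 2 * s) :
    MemH n (coeff fun x => Ψ x (D.jetOf m u x)) := by
  have hθ := memH_nonlocal D.assumptionH (by omega) h.continuous₁ (fun x => (h.pos x).le) h.memH₁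
  exact (hΨ.isContDiff (h.memH₂.isContDiff h.continuous₂ hs)
    (h.memH₁.isContDiff h.continuous₁ (by omega))
    (hθ.isContDiff (map_continuous _) (by omega)) h.pos).memH

-- The regularizing operator gains `4p` derivatives, whereas the jet of `(m, u)`, the embedding of
-- `H^s` and the two divergences lose at most `5 + d / 2`.
lemma succ (h : D.IsWeakSolution s m u) (hs : 2 * D.p - 1 ≤ s) :
    D.IsWeakSolution (s + 1) m u := by
  have horder := D.order
  obtain ⟨n, hn⟩ : ∃ n, s = n + 5 + d / 2 := ⟨s - 5 - d / 2, by omega⟩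
  have hjet {Ψ : Torus d → JetSpace d → ℝ} (hΨ : IsJetSmooth Ψ) :
      MemH (n + 2) (coeff fun x => Ψ x (D.jetOf m u x)) :=
    h.memH_comp_jetOf hΨ (by omega)
  have hm : MemH n (coeff m) := h.memH₁.mono (by omega)
  have hu : MemH n (coeff u) := h.memH₂.mono (by omega)
  refine { h with memH₁ := ?_, memH₂ := ?_ }
  · have heq (k : Fin d → ℤ) : (D.regSymbol k : ℂ) * coeff m k =
        coeff u k - coeff (fun x => D.source x (D.jetOf m u x)) k := by
      linear_combination (norm := (unfold coeffRes₁; ring1)) h.coeffRes₁_eq_zero k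
    refine (memH_of_regSymbol_mul (D := D) (s := n) ?_).mono (by omega)
    rw [funext heq]
    exact hu.sub ((hjet D.isJetSmooth_source).mono (by omega))
  · have heq (k : Fin d → ℤ) : (D.regSymbol k : ℂ) * coeff u k =
        ∑ i, symbol k i * coeff (fun x => D.flux i x (D.jetOf m u x)) k
        - ∑ i, ∑ j, symbol k i * (symbol k j * coeff (fun x => D.flux₂ i j x (D.jetOf m u x)) k)
        - (coeff m k - coeff (fun _ => 1) k) := by
      linear_combination (norm := (unfold coeffRes₂; ring1)) h.coeffRes₂_eq_zero k
    refine (memH_of_regSymbol_mul (D := D) (s := n) ?_).mono (by omega)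
    rw [funext heq]
    exact ((MemH.sum _ fun i _ => ((hjet (D.isJetSmooth_flux i)).mono (by omega)).symbol_mul i).sub
      (.sum _ fun i _ => .sum _ fun j _ =>
        ((hjet (D.isJetSmooth_flux₂ i j)).symbol_mul j).symbol_mul i)).sub
      (hm.sub ((isSmooth_const 1).memH n))

lemma of_le (h : D.IsWeakSolution (2 * D.p - 1) m u) (hs : 2 * D.p - 1 ≤ s) :
    D.IsWeakSolution s m u := by
  induction s, hs using Nat.le_induction with
  | base => exact h
  | succ s hs ih => exact ih.succ hs

lemma isSmooth (h : D.IsWeakSolution (2 * D.p - 1) m u) : IsSmooth m ∧ IsSmooth u :=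
  ⟨isSmooth_of_forall_memH h.continuous₁ fun _ hs => (h.of_le hs).memH₁,
    isSmooth_of_forall_memH h.continuous₂ fun _ hs => (h.of_le hs).memH₂⟩

lemma solvesRP (h : D.IsWeakSolution s m u) (hm : IsSmooth m) (hu : IsSmooth u) :
    SolvesRP D.h D.H D.p D.ε₁ D.ε₂ D.β m u := by
  have hzero (k : Fin d → ℤ) : coeff (fun _ : Torus d => 0) k = 0 := by
    simpa using coeff_const_mul (fun _ : Torus d => 0) 0 k
  have hres₁ : D.res₁ m u = fun _ => 0 :=
    eq_of_coeff_eq (D.isSmooth_res₁ hm hu h.pos).continuous continuous_const <| funext fun k => by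
      rw [D.coeff_res₁ k hm hu h.pos, h.coeffRes₁_eq_zero, hzero]
  have hres₂ : D.res₂ m u = fun _ => 0 :=
    eq_of_coeff_eq (D.isSmooth_res₂ hm hu h.pos).continuous continuous_const <| funext fun k => by
      rw [D.coeff_res₂ k hm hu h.pos, h.coeffRes₂_eq_zero, hzero]
  exact fun x => ⟨by simpa only [res₁, reg, ← add_assoc] using congrFun hres₁ x,
    by simpa only [res₂, reg, ← add_assoc] using congrFun hres₂ x⟩

end IsWeakSolution

variable (D) in
lemma exists_solution : ∃ m u : Torus d → ℝ, IsSmooth m ∧ IsSmooth u ∧ 0 < (⨅ x, m x) ∧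
    SolvesRP D.h D.H D.p D.ε₁ D.ε₂ D.β m u := by
  obtain ⟨m, u, h⟩ := D.exists_isWeakSolution
  obtain ⟨c, hc, hcm⟩ := exists_pos_lt h.continuous₁ h.pos
  have hinf : 0 < ⨅ x, m x := hc.trans_le (le_ciInf fun x => (hcm x).le)
  exact ⟨m, u, h.isSmooth.1, h.isSmooth.2, hinf, h.solvesRP h.isSmooth.1 h.isSmooth.2⟩

end RegProblem

end RegMFG

end

theorem proposition3p1_general (d : ℕ) (E : Set ℝ) (hE : Set.Ioi 0 ⊆ E)
    (h : RegMFG.Mac d → C(RegMFG.Torus d, ℝ)) (H : RegMFG.Hamiltonian d)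
    (hh : RegMFG.AssumptionH h) (hH2 : RegMFG.AssumptionH2 E H) (hH3 : RegMFG.AssumptionH3 E h H)
    (p : ℕ) (hp : (d : ℝ) / 2 + 1 < 2 * (p : ℝ) - 4) (q : ℝ) (hq : (d : ℝ) < q)
    (ε₁ ε₂ : ℝ) (hε₁ : 0 < ε₁) (hε₁' : ε₁ ≤ 1) (hε₂ : 0 ≤ ε₂)
    (β : ℝ → ℝ) (hβ : RegMFG.IsPenalization ε₁ q β) :
    ∃ m u : RegMFG.Torus d → ℝ,
      RegMFG.IsSmooth m ∧ RegMFG.IsSmooth u ∧ 0 < (⨅ x, m x) ∧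
      RegMFG.SolvesRP h H p ε₁ ε₂ β m u := by
  have horder : d + 10 < 4 * p := by
    have : (d : ℝ) + 10 < 4 * p := by linarith
    exact_mod_cast this
  let D : RegMFG.RegProblem d :=
    { h, H, p, q, ε₁, ε₂, β
      assumptionH := hh
      jetSmooth := RegMFG.isJetSmooth_hamiltonian hE hH2
      monotone := hH3.mono hE
      order := horder
      lt_q := hq
      ε₁_pos := hε₁
      ε₁_le := hε₁'
      ε₂_nonneg := hε₂
      penalization := hβ }
  exact D.exists_solution

theorem proposition3p1 (d : ℕ) (hd : 0 < d) (E : Set ℝ)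
    (hE : E = Set.Ioi 0 ∨ E = Set.Ici 0)
    (h : RegMFG.Mac d → C(RegMFG.Torus d, ℝ))
    (g : RegMFG.Torus d → ℝ → ℝ → ℝ)
    (H : RegMFG.Hamiltonian d)
    (hh : RegMFG.AssumptionH h)
    (hg : RegMFG.AssumptionG E h g)
    (hH1 : RegMFG.AssumptionH1 E h g H)
    (hH2 : RegMFG.AssumptionH2 E H)
    (hH3 : RegMFG.AssumptionH3 E h H)
    (p : ℕ) (hp : (d : ℝ) / 2 + 1 < 2 * (p : ℝ) - 4)
    (q : ℝ) (hq : (d : ℝ) < q)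
    (ε₁ ε₂ : ℝ) (hε₁ : ε₁ ∈ Set.Ioo (0 : ℝ) 1) (hε₂ : ε₂ ∈ Set.Ioo (0 : ℝ) 1)
    (β : ℝ → ℝ) (hβ : RegMFG.IsPenalization ε₁ q β) :
    ∃ m u : RegMFG.Torus d → ℝ,
      RegMFG.IsSmooth m ∧ RegMFG.IsSmooth u ∧ 0 < (⨅ x, m x) ∧
      RegMFG.SolvesRP h H p ε₁ ε₂ β m u := by
  exact proposition3p1_general d E (by rcases hE with rfl | rfl <;> simp) h H hh hH2 hH3 p hp q hq
    ε₁ ε₂ hε₁.1 hε₁.2.le hε₂.1.le β hβ
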